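/- Let $(D,\mathcal A,\mu)$ be a measure space and let $H\neq\{0\}$ be a reproducing kernel Hilbert space of real- or complex-valued functions on $D$ (a Hilbert space of functions on which all point evaluations are continuous) that is embedded into $L_2=L_2(D,\mathcal A,\mu)$, i.e., all $f\in H$ are square-integrable, and two elements of $H$ that agree $\mu$-almost everywhere are equal. For $m\ge 0$ let \[ a_m=a_m(H):=\inf_{\substack{L_1,\dots,L_m\in H'\\ \varphi_1,\dots,\varphi_m\in L_2}}\ \sup_{\|f\|_H\le 1}\Big\|f-\sum_{i=1}^m L_i(f)\varphi_i\Big\|_{L_2} \] be the approximation numbers, and assume $\sum_{j\ge0}a_j^2<\infty$. Let ${\rm id}\colon H\to L_2$ be the embedding and $W={\rm id}^*{\rm id}$. Then $H$ has an orthogonal basis $b_1,b_2,\dots$ (finite if $\dim H<\infty$) of eigenfunctions of $W$ with $\|b_j\|_{L_2}=1$ and $\|b_1\|_H\le\|b_2\|_H\le\cdots$. Fix any such basis, where $b_j:=0$ for $j>\dim H$, and for $k\ge1$ let $V_k:={\rm span}\{b_1,\dots,b_k\}$ and \[ \varrho_k(x):=\frac12\Big(\frac1k\sum_{j<k}|b_{j+1}(x)|^2+\frac1{\sum_{j\ge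 k}a_j^2}\sum_{j\ge k}a_j^2|b_{j+1}(x)|^2\Big) \] if $\sum_{j\ge k}a_j^2\ne0$; if $\sum_{j\ge k}a_j^2=0$ (which happens only if $\dim H\le k$), let $\varrho_k(x):=\frac1{\dim H}\sum_{j\le \dim H}|b_j(x)|^2$. Then $\varrho_k$ is a probability density with respect to $\mu$. For $x_1,\dots,x_n\in D$ let \[ A_{n,k}(f):=\underset{g\in V_k}{\rm argmin}\ \sum_{i=1}^n\frac{|g(x_i)-f(x_i)|^2}{\varrho_k(x_i)}. \] Let $n\ge2$ and $c>0$ be such that \[ k_n:=2\Big\lfloor\frac{n}{2^8(2+c)\ln n}\Big\rfloor \] is positive, and let $x_1,\dots,x_n$ be i.i.d. random points with $\mu$-density $\varrho_{k_n}$. Then, with probability at least $1-\frac8{n^c}$, the minimizer $A_{n,k_n}(f)$ exists and is unique for every $f\in H$, and \[ \sup_{\|f\|_H\le1}\big\|f-A_{n,k_n}(f)\big\|_{L_2}^2\ \le\ \frac4{k_n}\sum_{j\ge k_n/2}a_j(H)^2. \] -/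

import Mathlib

open MeasureTheory
open scoped ENNReal InnerProductSpace

noncomputable section

namespace RKHSSampling

variable {𝕜 D H : Type*} [RCLike 𝕜] [MeasurableSpace D]
  [NormedAddCommGroup H] [InnerProductSpace 𝕜 H] [RKHS 𝕜 H D 𝕜]

/-- The reproducing kernel Hilbert space `H` of functions on `D` is embedded into `L₂(D, μ)`:
its elements are square-integrable, and two of them that agree almost everywhere are equal. -/
structure EmbedsInL2 (μ : Measure D) (H : Type*) [NormedAddCommGroup H] [InnerProductSpace 𝕜 H]
    [RKHS 𝕜 H D 𝕜] : Prop where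
  memLp : ∀ f : H, MemLp (⇑f : D → 𝕜) 2 μ
  eq_of_ae_eq : ∀ f g : H, (⇑f : D → 𝕜) =ᵐ[μ] ⇑g → f = g

/-- The embedding `H → L₂` as a linear map. -/
def embeddingLM {μ : Measure D} (h : EmbedsInL2 μ H) : H →ₗ[𝕜] Lp 𝕜 2 μ where
  toFun f := (h.memLp f).toLp (⇑f)
  map_add' f g := by
    rw [← MemLp.toLp_add]
    congr 1
    exact RKHS.coe_add f g
  map_smul' c f := by
    rw [RingHom.id_apply, ← MemLp.toLp_const_smul]
    congr 1
    exact RKHS.coe_smul f c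

/-- The embedding `H → L₂` is continuous, by the closed graph theorem. -/
theorem continuous_embeddingLM [CompleteSpace H] {μ : Measure D} (h : EmbedsInL2 μ H) :
    Continuous (embeddingLM h) := by
  refine LinearMap.continuous_of_seq_closed_graph _ fun u f y hu hy => ?_
  obtain ⟨ns, hns, hae⟩ := (tendstoInMeasure_of_tendsto_Lp hy).exists_seq_tendsto_ae
  have hall : ∀ᵐ x ∂μ, ∀ i, (embeddingLM h (u i) : D → 𝕜) x = u i x :=
    ae_all_iff.2 fun i => (h.memLp (u i)).coeFn_toLp
  refine Lp.ext ?_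
  filter_upwards [hae, hall, (h.memLp f).coeFn_toLp] with x h1 h2 h3
  have h4 : Filter.Tendsto (fun i => u (ns i) x) Filter.atTop (nhds (f x)) :=
    ((RKHS.continuous_eval x).tendsto f).comp (hu.comp hns.tendsto_atTop)
  refine (tendsto_nhds_unique (h1.congr fun i => h2 (ns i)) h4).trans ?_
  exact h3.symm

/-- The embedding `id : H → L₂` as a bounded operator. -/
def embedding [CompleteSpace H] {μ : Measure D} (h : EmbedsInL2 μ H) : H →L[𝕜] Lp 𝕜 2 μ :=
  ⟨embeddingLM h, continuous_embeddingLM h⟩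

/-- The operator `W = id* id` on `H`. -/
def opW [CompleteSpace H] {μ : Measure D} (h : EmbedsInL2 μ H) : H →L[𝕜] H :=
  (embedding h).adjoint ∘L embedding h

/-- The worst-case `L₂`-error over the unit ball of `H` of an algorithm with outputs in `L₂`
(given here as functions on `D`). -/
def worstCaseError (μ : Measure D) (A : H → D → 𝕜) : ℝ≥0∞ :=
  ⨆ (f : H) (_ : ‖f‖ ≤ 1), eLpNorm (fun x => f x - A f x) 2 μ

/-- The `n`-th approximation number `a_n(H)`: the minimal worst-case error of an algorithm
`f ↦ ∑ i, L_i(f) φ_i` that uses `n` bounded linear functionals. -/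
def approxNumber (μ : Measure D) (H : Type*) [NormedAddCommGroup H] [InnerProductSpace 𝕜 H]
    [RKHS 𝕜 H D 𝕜] (n : ℕ) : ℝ≥0∞ :=
  ⨅ (L : Fin n → H →L[𝕜] 𝕜) (φ : Fin n → Lp 𝕜 2 μ),
    worstCaseError μ fun (f : H) x => ∑ i, L i f * φ i x

/-- `∑_{j ≥ m} a_j(H)²`. -/
def tailSum (μ : Measure D) (H : Type*) [NormedAddCommGroup H] [InnerProductSpace 𝕜 H]
    [RKHS 𝕜 H D 𝕜] (m : ℕ) : ℝ≥0∞ :=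
  ∑' j : ℕ, approxNumber μ H (m + j) ^ 2

/-- `b` lists an orthogonal basis of `H` that consists of eigenfunctions of `W = id* id`,
normalized in `L₂` and ordered by increasing norm in `H`. Indices start at `0`. If `H` has infinite
dimension, all `b j` are nonzero; if it has finite dimension `N`, the basis is `b 0, …, b (N - 1)`
and the list is continued by zeros. -/
structure IsEigenbasis [CompleteSpace H] {μ : Measure D} (h : EmbedsInL2 μ H) (b : ℕ → H) :
    Prop where
  eigen : ∀ j, ∃ t : 𝕜, opW h (b j) = t • b j
  orthogonal : ∀ i j, i ≠ j → ⟪b i, b j⟫_𝕜 = 0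
  complete : (Submodule.span 𝕜 (Set.range b)).topologicalClosure = ⊤
  ne_zero_of_succ : ∀ j, b (j + 1) ≠ 0 → b j ≠ 0
  normalized : ∀ j, b j ≠ 0 → eLpNorm (⇑(b j) : D → 𝕜) 2 μ = 1
  norm_le_succ : ∀ j, b (j + 1) ≠ 0 → ‖b j‖ ≤ ‖b (j + 1)‖

/-- `V_k`, the span of the first `k` basis functions. -/
def spanFirst (𝕜 : Type*) [RCLike 𝕜] {H : Type*} [NormedAddCommGroup H] [InnerProductSpace 𝕜 H]
    (b : ℕ → H) (k : ℕ) : Submodule 𝕜 H :=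
  Submodule.span 𝕜 (b '' Set.Iio k)

open Classical in
/-- The sampling density `ϱ_k`. The second case is the general one. The first case occurs only if
`dim H ≤ k`, so that `V_k = H` and the second summand of the general formula would be `0 / 0`;
then the density is the normalized first summand. -/
def density (μ : Measure D) (b : ℕ → H) (k : ℕ) (x : D) : ℝ≥0∞ :=
  if tailSum μ H k = 0 then
    (Module.finrank 𝕜 (spanFirst 𝕜 b k) : ℝ≥0∞)⁻¹ * ∑ j ∈ Finset.range k, ‖b j x‖ₑ ^ 2
  else
    2⁻¹ * ((k : ℝ≥0∞)⁻¹ * ∑ j ∈ Finset.range k, ‖b j x‖ₑ ^ 2 +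
      (tailSum μ H k)⁻¹ * ∑' j : ℕ, approxNumber μ H (k + j) ^ 2 * ‖b (k + j) x‖ₑ ^ 2)

/-- `g` is a minimizer over `V_k` of the weighted sum of squares
`∑ i, |g(x_i) - f(x_i)|² / ϱ_k(x_i)`. -/
def IsWeightedLeastSquares (μ : Measure D) (b : ℕ → H) (k : ℕ) {n : ℕ} (x : Fin n → D)
    (f g : H) : Prop :=
  g ∈ spanFirst 𝕜 b k ∧ ∀ g' ∈ spanFirst 𝕜 b k,
    ∑ i, ‖g (x i) - f (x i)‖ₑ ^ 2 / density μ b k (x i) ≤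
      ∑ i, ‖g' (x i) - f (x i)‖ₑ ^ 2 / density μ b k (x i)

open Classical in
/-- The algorithm `A_{n,k}` with nodes `x`: it maps `f` to the minimizer of the weighted sum of
squares (some minimizer if it is not unique). -/
def leastSquares (μ : Measure D) (b : ℕ → H) (k : ℕ) {n : ℕ} (x : Fin n → D) (f : H) : H :=
  if hf : ∃ g, IsWeightedLeastSquares μ b k x f g then hf.choose else 0

/-- `k_n = 2 ⌊n / (2⁸ (2 + c) ln n)⌋`. -/
def kn (n : ℕ) (c : ℝ) : ℕ :=
  2 * ⌊(n : ℝ) / (2 ^ 8 * (2 + c) * Real.log n)⌋₊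

end RKHSSampling

end

open RKHSSampling

open MeasureTheory
open scoped ENNReal InnerProductSpace

namespace RKHSSampling

open Matrix
open scoped ComplexOrder MatrixOrder

/-! Put k = k_n, σ_j = 1/‖b_j‖_H, T = ∑_{j≥k} a_j² and, if T ≠ 0, q = σ_k² + T/k. Let P be the
H-orthogonal projection onto V_k. Since the b_j are eigenfunctions of W, orthogonality in H gives
orthogonality in L₂. About the singular numbers σ_j only σ_j ≤ a_j is needed, and a_j = 0 where b_j
= 0.

Keep b_j for j < k and rescale it by σ_j/√q for j ≥ k. The squared coefficient norm of f in this
system is ‖Pf‖²_{L₂} + q‖f − Pf‖²_H. The density is made so that the system divided by √ϱ_k has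
squared length at most 2k at every point. Its second moment matrix under ϱ_k dμ is diagonal with
entries at most 1 and trace at most 2k. With high probability two frame bounds hold: the samples of
every f have squared length at most 4n/3 times the squared coefficient norm, and those of g ∈ V_k at
least 2n/3 times ‖g‖²_{L₂}.

The ratio 2 of these bounds is enough. For g = A(f), the samples of (g − Pf) + (f − Pf) are twice
those of g − Pf plus the residual, which is orthogonal to the samples of V_k. Comparing both bounds
on this function gives ‖g − Pf‖²_{L₂} ≤ q‖f − Pf‖²_H (`norm_sq_embedding_sub_le`). Hence the squared
error is at most σ_k² + q, and `inv_norm_sq_add_tailScale_le` bounds this by the tail from k/2.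

The frame bounds come from trace moments of S = ∑ z_i z_i*. For the upper one, tr S^p is expanded by
removing one sample from each summand and averaging over it; the result depends on the trace of the
second moment matrix and not on its size, so all N basis functions are treated at once
(`moment_le`). For the lower one, the same is done with traces of powers of the resolvent (t + S)⁻¹
(`resolvent_moment_le`). Markov's inequality finishes both.

The eigenbasis exists because the embedding is a norm limit of finite rank operators, hence compact.
-/

theorem sum_pow_mul_sum_pow_le {ι : Type*} [Fintype ι] {w l : ι → ℝ}
    (hw : ∀ i, 0 ≤ w i) (hl : ∀ i, 0 ≤ l i) (a b : ℕ) :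
    (∑ i, w i * l i ^ a) * (∑ i, w i * l i ^ b) ≤ (∑ i, w i) * ∑ i, w i * l i ^ (a + b) := by
  -- Chebyshev's sum inequality: l^a and l^b are ordered alike, so every term of the symmetrized
  -- double sum is nonnegative.
  have key : 0 ≤ ∑ i, ∑ j, w i * w j * ((l i ^ a - l j ^ a) * (l i ^ b - l j ^ b)) := by
    refine Finset.sum_nonneg fun i _ => Finset.sum_nonneg fun j _ => ?_
    refine mul_nonneg (mul_nonneg (hw i) (hw j)) ?_
    rcases le_total (l i) (l j) with h | h
    · exact mul_nonneg_of_nonpos_of_nonpos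
        (sub_nonpos.2 (pow_le_pow_left₀ (hl i) h a)) (sub_nonpos.2 (pow_le_pow_left₀ (hl i) h b))
    · exact mul_nonneg
        (sub_nonneg.2 (pow_le_pow_left₀ (hl j) h a)) (sub_nonneg.2 (pow_le_pow_left₀ (hl j) h b))
  have e : ∑ i, ∑ j, w i * w j * ((l i ^ a - l j ^ a) * (l i ^ b - l j ^ b)) =
      (∑ i, w i * l i ^ (a + b)) * (∑ i, w i) + (∑ i, w i) * (∑ i, w i * l i ^ (a + b))
      - (∑ i, w i * l i ^ a) * (∑ i, w i * l i ^ b)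
      - (∑ i, w i * l i ^ b) * (∑ i, w i * l i ^ a) := by
    simp only [Finset.sum_mul_sum, ← Finset.sum_add_distrib, ← Finset.sum_sub_distrib]
    refine Finset.sum_congr rfl fun i _ => Finset.sum_congr rfl fun j _ => ?_
    ring
  rw [e] at key
  linarith

set_option linter.unusedSectionVars false

/-! ### Quadratic forms of matrix powers under rank one perturbations -/

section MatrixMoments

variable {𝕜 ι : Type*} [RCLike 𝕜] [Fintype ι] [DecidableEq ι]

/-- The real part of the quadratic form `x* A x`. -/
def quadForm (A : Matrix ι ι 𝕜) (x : ι → 𝕜) : ℝ :=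
  RCLike.re (star x ⬝ᵥ A *ᵥ x)

/-- The weights |⟨u_i, x⟩|², with u_i the eigenvectors, form the spectral measure of x. One measure
serves all powers, so relations between quadratic forms become relations between moments. -/
theorem exists_spectral_moments {A : Matrix ι ι 𝕜} (hA : A.PosSemidef) (x : ι → 𝕜) :
    ∃ w : ι → ℝ, (∀ i, 0 ≤ w i) ∧ ∀ p : ℕ,
      star x ⬝ᵥ (A ^ p) *ᵥ x = ((∑ i, w i * hA.1.eigenvalues i ^ p : ℝ) : 𝕜) := by
  set U : Matrix ι ι 𝕜 := ↑hA.1.eigenvectorUnitary with hU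
  refine ⟨fun i => ‖(star U *ᵥ x) i‖ ^ 2, fun i => by positivity, fun p => ?_⟩
  have h1 : A ^ p = U * diagonal (fun i => ((hA.1.eigenvalues i ^ p : ℝ) : 𝕜)) * star U := by
    conv_lhs => rw [hA.1.spectral_theorem]
    rw [← map_pow, Unitary.conjStarAlgAut_apply, diagonal_pow]
    congr 3
    ext i
    simp
  rw [h1, ← mulVec_mulVec, ← mulVec_mulVec, dotProduct_mulVec, show star x ᵥ* U = star (star U *ᵥ x) by
    rw [star_mulVec, star_eq_conjTranspose, conjTranspose_conjTranspose]]
  simp only [dotProduct, mulVec_diagonal, Pi.star_apply]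
  push_cast
  refine Finset.sum_congr rfl fun i _ => ?_
  rw [star_eq_conjTranspose, ← RCLike.conj_mul]
  simp only [starRingEnd_apply]
  ring

theorem ofReal_quadForm_pow {A : Matrix ι ι 𝕜} (hA : A.PosSemidef) (x : ι → 𝕜) (p : ℕ) :
    star x ⬝ᵥ (A ^ p) *ᵥ x = (quadForm (A ^ p) x : 𝕜) := by
  obtain ⟨w, -, h⟩ := exists_spectral_moments hA x
  rw [quadForm, h p, RCLike.ofReal_re]

theorem quadForm_pow_nonneg {A : Matrix ι ι 𝕜} (hA : A.PosSemidef) (x : ι → 𝕜) (p : ℕ) :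
    0 ≤ quadForm (A ^ p) x := by
  obtain ⟨w, hw, h⟩ := exists_spectral_moments hA x
  rw [quadForm, h p, RCLike.ofReal_re]
  exact Finset.sum_nonneg fun i _ => mul_nonneg (hw i) (pow_nonneg (hA.eigenvalues_nonneg i) _)

/-- Chebyshev's inequality for the spectral measure with the extra weight λ^c; c = 0 serves the
powers of S and c = 1 those of its resolvent. -/
theorem quadForm_pow_mul_le {A : Matrix ι ι 𝕜} (hA : A.PosSemidef) (x : ι → 𝕜) (c a b : ℕ) :
    quadForm (A ^ (c + a)) x * quadForm (A ^ (c + b)) x ≤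
      quadForm (A ^ c) x * quadForm (A ^ (c + (a + b))) x := by
  obtain ⟨w, hw, h⟩ := exists_spectral_moments hA x
  simp only [quadForm, h, RCLike.ofReal_re]
  simp only [pow_add _ c, ← mul_assoc]
  exact sum_pow_mul_sum_pow_le (fun i => mul_nonneg (hw i) (pow_nonneg (hA.eigenvalues_nonneg i) c)) hA.eigenvalues_nonneg a b

/-- Jensen's inequality for the spectral measure of a unit vector. -/
theorem quadForm_pow_le_of_unit {A : Matrix ι ι 𝕜} (hA : A.PosSemidef) {x : ι → 𝕜}
    (hx : star x ⬝ᵥ x = 1) (p : ℕ) : quadForm A x ^ p ≤ quadForm (A ^ p) x := by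
  have h0 : quadForm (A ^ 0) x = 1 := by simp [quadForm, hx]
  induction p with
  | zero => rw [h0, pow_zero]
  | succ p ih =>
    have := quadForm_pow_mul_le hA x 0 p 1
    simp only [zero_add, h0, one_mul, pow_one] at this
    calc quadForm A x ^ (p + 1) = quadForm A x ^ p * quadForm A x := pow_succ _ _
      _ ≤ quadForm (A ^ p) x * quadForm A x :=
        mul_le_mul_of_nonneg_right ih (by simpa using quadForm_pow_nonneg hA x 1)
      _ ≤ _ := this

/-- The trace of a matrix as the sum of its quadratic forms in an eigenbasis of another one. -/
theorem trace_eq_sum_quadForm {D : Matrix ι ι 𝕜} (hD : D.IsHermitian) (C : Matrix ι ι 𝕜) :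
    RCLike.re C.trace = ∑ i, quadForm C (hD.eigenvectorBasis i) := by
  set U : Matrix ι ι 𝕜 := ↑hD.eigenvectorUnitary with hU
  have h1 : C.trace = (star U * C * U).trace := by
    rw [trace_mul_cycle]
    have : U * star U = 1 := Unitary.mul_star_self_of_mem hD.eigenvectorUnitary.2
    rw [this, one_mul]
  rw [h1, trace, map_sum]
  refine Finset.sum_congr rfl fun i _ => ?_
  rw [quadForm, diag_apply, mul_assoc, mul_apply]
  congr 1

/-- The p-th power is not operator monotone in general, but its trace is monotone. For an
eigenvector v of C, ⟨C^p v, v⟩ = ⟨Cv, v⟩^p ≤ ⟨Dv, v⟩^p, and Jensen's inequality moves the power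
inside. -/
theorem trace_pow_le_trace_pow {C D : Matrix ι ι 𝕜} (hC : C.PosSemidef) (hCD : (D - C).PosSemidef)
    (p : ℕ) : RCLike.re (C ^ p).trace ≤ RCLike.re (D ^ p).trace := by
  have hD : D.PosSemidef := by simpa using hCD.add hC
  rw [trace_eq_sum_quadForm hC.1 (C ^ p), trace_eq_sum_quadForm hC.1 (D ^ p)]
  refine Finset.sum_le_sum fun i _ => ?_
  set v := hC.1.eigenvectorBasis i
  have hv : star (v : ι → 𝕜) ⬝ᵥ v = 1 := by
    have := hC.1.eigenvectorBasis.orthonormal.1 i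
    have h2 : inner 𝕜 v v = 1 := by rw [inner_self_eq_norm_sq_to_K, this]; simp
    rw [EuclideanSpace.inner_eq_star_dotProduct, dotProduct_comm] at h2
    exact h2
  have hpow : ∀ p : ℕ, (C ^ p) *ᵥ (v : ι → 𝕜) = ((hC.1.eigenvalues i : 𝕜) ^ p) • (v : ι → 𝕜) := by
    intro p
    induction p with
    | zero => simp
    | succ p ih =>
      have h3 := hC.1.mulVec_eigenvectorBasis i
      rw [pow_succ, ← mulVec_mulVec, h3, mulVec_smul, ih, pow_succ, RCLike.real_smul_eq_coe_smul (K := 𝕜), smul_smul, mul_comm]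
  have h4 : quadForm (C ^ p) v = quadForm C v ^ p := by
    have h1 := hpow 1
    rw [pow_one, pow_one] at h1
    rw [quadForm, quadForm, hpow, h1, dotProduct_smul, dotProduct_smul, hv, ← RCLike.ofReal_pow]
    simp
  rw [h4]
  refine le_trans (pow_le_pow_left₀ (by simpa using quadForm_pow_nonneg hC v 1) ?_ p)
    (quadForm_pow_le_of_unit hD hv p)
  have := hCD.dotProduct_mulVec_nonneg (v : ι → 𝕜)
  rw [sub_mulVec, dotProduct_sub] at this
  have := (RCLike.nonneg_iff.1 this).1
  rw [map_sub] at this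
  exact sub_nonneg.1 this

theorem quadForm_le_trace {A : Matrix ι ι 𝕜} (hA : A.PosSemidef) (x : ι → 𝕜) :
    quadForm A x ≤ RCLike.re (star x ⬝ᵥ x) * RCLike.re A.trace := by
  obtain ⟨w, hw, h⟩ := exists_spectral_moments hA x
  have h0 := h 0
  have h1 := h 1
  simp only [pow_zero, one_mulVec, mul_one, pow_one] at h0 h1
  rw [quadForm, h0, h1, hA.1.trace_eq_sum_eigenvalues, RCLike.ofReal_re, RCLike.ofReal_re,
    ← RCLike.ofReal_sum, RCLike.ofReal_re, Finset.sum_mul]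
  exact Finset.sum_le_sum fun i hi => mul_le_mul_of_nonneg_left
    (Finset.single_le_sum (fun j _ => hA.eigenvalues_nonneg j) hi) (hw i)

theorem pow_quadForm_le_trace {A : Matrix ι ι 𝕜} (hA : A.PosSemidef) {x : ι → 𝕜}
    (hx : star x ⬝ᵥ x = 1) (p : ℕ) : quadForm A x ^ p ≤ RCLike.re (A ^ p).trace := by
  refine (quadForm_pow_le_of_unit hA hx p).trans ((quadForm_le_trace (hA.pow p) x).trans ?_)
  rw [hx, RCLike.one_re, one_mul]

/-- Cauchy–Schwarz for B^{1/2}x and B^{-1/2}x, obtained by evaluating the form of B at B⁻¹x − ax.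
The resulting quadratic polynomial in a is minimal at a = 1/(x*Bx). -/
theorem one_le_quadForm_mul_quadForm_inv {B : Matrix ι ι 𝕜} (hB : B.PosDef) {x : ι → 𝕜}
    (hx : star x ⬝ᵥ x = 1) : 1 ≤ quadForm B x * quadForm B⁻¹ x := by
  have hB0 : 0 < quadForm B x := by
    have hx0 : x ≠ 0 := by rintro rfl; simp at hx
    exact (RCLike.pos_iff.1 (hB.dotProduct_mulVec_pos hx0)).1
  set z := B⁻¹ *ᵥ x with hz
  have hu : IsUnit B.det := (isUnit_iff_isUnit_det B).1 hB.isUnit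
  have hBz : B *ᵥ z = x := by rw [hz, mulVec_mulVec, mul_nonsing_inv _ hu, one_mulVec]
  set a : ℝ := (quadForm B x)⁻¹ with ha
  have key := (RCLike.nonneg_iff.1
    (hB.posSemidef.dotProduct_mulVec_nonneg (z - (a : 𝕜) • x))).1
  have hzBx : star z ⬝ᵥ B *ᵥ x = 1 := by
    rw [dotProduct_mulVec, ← hB.1.eq, ← star_mulVec, hBz, hx]
  have e : star (z - (a : 𝕜) • x) ⬝ᵥ B *ᵥ (z - (a : 𝕜) • x) =
      star (star x ⬝ᵥ z) - 2 * (a : 𝕜) + (a : 𝕜) ^ 2 * (star x ⬝ᵥ B *ᵥ x) := by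
    rw [mulVec_sub, mulVec_smul, hBz, star_sub, star_smul, sub_dotProduct, dotProduct_sub,
      dotProduct_sub, smul_dotProduct, smul_dotProduct, dotProduct_smul, dotProduct_smul, hzBx, hx,
      star_dotProduct]
    simp only [RCLike.star_def, RCLike.conj_ofReal, smul_eq_mul]
    ring
  rw [e] at key
  have e2 : RCLike.re (star (star x ⬝ᵥ z) - 2 * (a : 𝕜) + (a : 𝕜) ^ 2 * (star x ⬝ᵥ B *ᵥ x)) =
      quadForm B⁻¹ x - 2 * a + a ^ 2 * quadForm B x := by
    rw [map_add, map_sub, ← RCLike.ofReal_pow, RCLike.re_ofReal_mul, RCLike.star_def,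
      RCLike.conj_re]
    congr 2
    rw [← RCLike.ofReal_ofNat, RCLike.re_ofReal_mul, RCLike.ofReal_re]
  rw [e2] at key
  have h1 : a * quadForm B x = 1 := inv_mul_cancel₀ hB0.ne'
  have h2 : a ≤ quadForm B⁻¹ x := by nlinarith
  calc 1 = quadForm B x * a := by rw [mul_comm, h1]
    _ ≤ _ := mul_le_mul_of_nonneg_left h2 hB0.le

/-- Removing the factors of a rank one perturbation from a power, one at a time. -/
theorem add_pow_eq_pow_add_sum {R : Type*} [Ring R] (A X : R) (p : ℕ) :
    (A + X) ^ p = A ^ p + ∑ i ∈ Finset.range p, A ^ i * X * (A + X) ^ (p - 1 - i) := by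
  induction p with
  | zero => simp
  | succ p ih =>
    rw [Finset.sum_range_succ', pow_succ', add_mul, pow_zero, one_mul, Nat.sub_zero,
      Nat.add_sub_cancel]
    nth_rewrite 1 [ih]
    rw [mul_add, Finset.mul_sum, pow_succ' A, ← add_assoc]
    congr 2
    refine Finset.sum_congr rfl fun i hi => ?_
    rw [pow_succ' A, show p - (i + 1) = p - 1 - i by omega]
    simp only [mul_assoc]

theorem dotProduct_mul_vecMulVec_mul {𝕜 ι : Type*} [RCLike 𝕜] [Fintype ι]
    (B C : Matrix ι ι 𝕜) (x : ι → 𝕜) :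
    star x ⬝ᵥ (B * vecMulVec x (star x) * C) *ᵥ x =
      (star x ⬝ᵥ B *ᵥ x) * (star x ⬝ᵥ C *ᵥ x) := by
  rw [← mulVec_mulVec, ← mulVec_mulVec, vecMulVec_mulVec, mulVec_smul, dotProduct_smul]
  simp

/-- The sum runs over the position i of the leftmost factor xx*, which splits the quadratic form
into a product of two scalars. -/
theorem quadForm_add_vecMulVec_pow {A : Matrix ι ι 𝕜} (hA : A.PosSemidef) (x : ι → 𝕜) (p : ℕ) :
    quadForm ((A + vecMulVec x (star x)) ^ p) x = quadForm (A ^ p) x +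
      ∑ i ∈ Finset.range p, quadForm (A ^ i) x *
        quadForm ((A + vecMulVec x (star x)) ^ (p - 1 - i)) x := by
  have hB : (A + vecMulVec x (star x)).PosSemidef := hA.add (posSemidef_vecMulVec_self_star x)
  have h : star x ⬝ᵥ ((A + vecMulVec x (star x)) ^ p) *ᵥ x = star x ⬝ᵥ (A ^ p) *ᵥ x +
      ∑ i ∈ Finset.range p, (star x ⬝ᵥ (A ^ i) *ᵥ x) *
        (star x ⬝ᵥ ((A + vecMulVec x (star x)) ^ (p - 1 - i)) *ᵥ x) := by
    rw [add_pow_eq_pow_add_sum, add_mulVec, dotProduct_add, sum_mulVec, dotProduct_sum]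
    simp only [dotProduct_mul_vecMulVec_mul]
  simp only [ofReal_quadForm_pow hA, ofReal_quadForm_pow hB] at h
  exact_mod_cast h

theorem sum_range_choose_sub (p j : ℕ) :
    ∑ i ∈ Finset.range p, (p - 1 - i).choose j = p.choose (j + 1) := by
  rw [Finset.sum_range_reflect (fun i => i.choose j) p]
  induction p with
  | zero => simp
  | succ p ih => rw [Finset.sum_range_succ, ih, Nat.choose_succ_succ, add_comm]

/-- The right side is x*(A + |x|²)^p x, as if xx* were the scalar |x|². In the induction Chebyshev's
inequality merges the two powers of A in each product, and the hockey-stick identity adds up the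
binomial coefficients. -/
theorem quadForm_add_vecMulVec_pow_le {A : Matrix ι ι 𝕜} (hA : A.PosSemidef) (x : ι → 𝕜) (p : ℕ) :
    quadForm ((A + vecMulVec x (star x)) ^ p) x ≤
      ∑ j ∈ Finset.range (p + 1), p.choose j * quadForm (1 : Matrix ι ι 𝕜) x ^ j *
        quadForm (A ^ (p - j)) x := by
  induction p using Nat.strong_induction_on with
  | _ p ih =>
    set r := quadForm (1 : Matrix ι ι 𝕜) x with hr
    have hr0 : 0 ≤ r := by simpa using quadForm_pow_nonneg hA x 0
    rw [quadForm_add_vecMulVec_pow hA, Finset.sum_range_succ', add_comm]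
    simp only [Nat.choose_zero_right, Nat.cast_one, pow_zero, mul_one, one_mul, Nat.sub_zero]
    refine add_le_add_left ?_ _
    calc ∑ i ∈ Finset.range p, quadForm (A ^ i) x *
          quadForm ((A + vecMulVec x (star x)) ^ (p - 1 - i)) x
        ≤ ∑ i ∈ Finset.range p, ∑ j ∈ Finset.range p,
            ((p - 1 - i).choose j : ℝ) * (r ^ (j + 1) * quadForm (A ^ (p - (j + 1))) x) := by
          refine Finset.sum_le_sum fun i hi => ?_
          rw [Finset.mem_range] at hi
          refine (mul_le_mul_of_nonneg_left (ih (p - 1 - i) (by omega))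
            (quadForm_pow_nonneg hA x i)).trans ?_
          rw [Finset.mul_sum]
          have hsub : Finset.range (p - 1 - i + 1) ⊆ Finset.range p :=
            Finset.range_subset_range.2 (by omega)
          refine le_trans (Finset.sum_le_sum fun j hj => ?_)
            (Finset.sum_le_sum_of_subset_of_nonneg hsub fun j _ _ => ?_)
          · rw [Finset.mem_range] at hj
            have h2 := quadForm_pow_mul_le hA x 0 i (p - 1 - i - j)
            have h3 : i + (p - 1 - i - j) = p - (j + 1) := by omega
            rw [pow_zero, zero_add, zero_add, zero_add, h3] at h2
            calc quadForm (A ^ i) x * (((p - 1 - i).choose j : ℝ) * r ^ j *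
                  quadForm (A ^ (p - 1 - i - j)) x)
                = ((p - 1 - i).choose j : ℝ) * (r ^ j * (quadForm (A ^ i) x *
                    quadForm (A ^ (p - 1 - i - j)) x)) := by ring
              _ ≤ ((p - 1 - i).choose j : ℝ) * (r ^ j * (r *
                    quadForm (A ^ (p - (j + 1))) x)) := by gcongr
              _ = _ := by ring
          · exact mul_nonneg (Nat.cast_nonneg _)
              (mul_nonneg (pow_nonneg hr0 _) (quadForm_pow_nonneg hA x _))
      _ = _ := by
          rw [Finset.sum_comm]
          refine Finset.sum_congr rfl fun j _ => ?_
          rw [← Finset.sum_mul, ← Nat.cast_sum, sum_range_choose_sub, mul_assoc]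

/-! ### Resolvents under rank one perturbations -/

section Resolvent

variable {s : ℝ} {A : Matrix ι ι 𝕜}

theorem posDef_smul_one_add (hs : 0 < s) (hA : A.PosSemidef) :
    ((s : 𝕜) • (1 : Matrix ι ι 𝕜) + A).PosDef :=
  (PosDef.one.smul (RCLike.ofReal_pos.2 hs)).add_posSemidef hA

theorem quadForm_resolvent_le (hs : 0 < s) (hA : A.PosSemidef) (x : ι → 𝕜) :
    quadForm ((s : 𝕜) • (1 : Matrix ι ι 𝕜) + A)⁻¹ x ≤ quadForm (1 : Matrix ι ι 𝕜) x / s := by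
  have hB := posDef_smul_one_add hs hA
  set B := (s : 𝕜) • (1 : Matrix ι ι 𝕜) + A with hBdef
  set z := B⁻¹ *ᵥ x with hz
  have hu : IsUnit B.det := (isUnit_iff_isUnit_det B).1 hB.isUnit
  have hBz : B *ᵥ z = x := by rw [hz, mulVec_mulVec, mul_nonsing_inv _ hu, one_mulVec]
  have hx : x = (s : 𝕜) • z + A *ᵥ z := by
    rw [← hBz, hBdef, add_mulVec, smul_mulVec, one_mulVec]
  have e : star x ⬝ᵥ x = (s : 𝕜) * (star x ⬝ᵥ z) + (s : 𝕜) * (star z ⬝ᵥ A *ᵥ z) +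
      star (A *ᵥ z) ⬝ᵥ (A *ᵥ z) := by
    conv_lhs => enter [2]; rw [hx]
    rw [dotProduct_add, dotProduct_smul, smul_eq_mul, add_assoc]
    congr 1
    conv_lhs => enter [1]; rw [hx]
    rw [star_add, add_dotProduct, star_smul, smul_dotProduct]
    simp
  have h1 := (RCLike.nonneg_iff.1 (hA.dotProduct_mulVec_nonneg z)).1
  have h2 := (RCLike.nonneg_iff.1 (dotProduct_star_self_nonneg (star (A *ᵥ z)))).1
  rw [star_star, dotProduct_comm] at h2
  rw [le_div_iff₀ hs, quadForm, quadForm, one_mulVec, e, map_add, map_add, RCLike.re_ofReal_mul,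
    RCLike.re_ofReal_mul]
  nlinarith [mul_nonneg hs.le h1]

theorem resolvent_sub_resolvent (hs : 0 < s) (hA : A.PosSemidef) (x : ι → 𝕜) :
    ((s : 𝕜) • (1 : Matrix ι ι 𝕜) + A)⁻¹ - ((s : 𝕜) • (1 : Matrix ι ι 𝕜) +
      (A + vecMulVec x (star x)))⁻¹ = ((s : 𝕜) • (1 : Matrix ι ι 𝕜) +
      (A + vecMulVec x (star x)))⁻¹ * vecMulVec x (star x) *
      ((s : 𝕜) • (1 : Matrix ι ι 𝕜) + A)⁻¹ := by
  have hB := (posDef_smul_one_add hs hA).isUnit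
  have hC := (posDef_smul_one_add hs (hA.add (posSemidef_vecMulVec_self_star x))).isUnit
  rw [isUnit_iff_isUnit_det] at hB hC
  set B := (s : 𝕜) • (1 : Matrix ι ι 𝕜) + A with hBdef
  set C := (s : 𝕜) • (1 : Matrix ι ι 𝕜) + (A + vecMulVec x (star x)) with hCdef
  have : vecMulVec x (star x) = C - B := by rw [hCdef, hBdef]; abel
  rw [this, mul_sub, sub_mul, nonsing_inv_mul _ hC, one_mul, mul_assoc, mul_nonsing_inv _ hB,
    mul_one]

/-- Expand Q^p = (R + (Q − R))^p by the position of the leftmost Q − R = R xx* Q, where Q and R are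
the resolvents without and with x. -/
theorem quadForm_resolvent_pow (hs : 0 < s) (hA : A.PosSemidef) (x : ι → 𝕜) (p : ℕ) :
    quadForm (((s : 𝕜) • (1 : Matrix ι ι 𝕜) + A)⁻¹ ^ p) x =
      quadForm (((s : 𝕜) • (1 : Matrix ι ι 𝕜) + (A + vecMulVec x (star x)))⁻¹ ^ p) x +
      ∑ i ∈ Finset.range p,
        quadForm (((s : 𝕜) • (1 : Matrix ι ι 𝕜) + (A + vecMulVec x (star x)))⁻¹ ^ (i + 1)) x *
        quadForm (((s : 𝕜) • (1 : Matrix ι ι 𝕜) + A)⁻¹ ^ (p - i)) x := by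
  have hQ := (posDef_smul_one_add hs hA).inv.posSemidef
  have hR := (posDef_smul_one_add hs (hA.add (posSemidef_vecMulVec_self_star x))).inv.posSemidef
  have hsub := resolvent_sub_resolvent hs hA x
  set Q := ((s : 𝕜) • (1 : Matrix ι ι 𝕜) + A)⁻¹
  set R := ((s : 𝕜) • (1 : Matrix ι ι 𝕜) + (A + vecMulVec x (star x)))⁻¹
  have h0 := add_pow_eq_pow_add_sum R (Q - R) p
  rw [add_sub_cancel, hsub] at h0
  have h : star x ⬝ᵥ (Q ^ p) *ᵥ x = star x ⬝ᵥ (R ^ p) *ᵥ x +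
      ∑ i ∈ Finset.range p, (star x ⬝ᵥ (R ^ (i + 1)) *ᵥ x) * (star x ⬝ᵥ (Q ^ (p - i)) *ᵥ x) := by
    rw [h0, add_mulVec, dotProduct_add, sum_mulVec, dotProduct_sum]
    congr 1
    refine Finset.sum_congr rfl fun i hi => ?_
    rw [Finset.mem_range] at hi
    rw [← dotProduct_mul_vecMulVec_mul, pow_succ R, show p - i = p - 1 - i + 1 by omega, pow_succ' Q]
    simp only [mul_assoc]
  simp only [ofReal_quadForm_pow hQ, ofReal_quadForm_pow hR] at h
  exact_mod_cast h

/-- A rank one perturbation changes the powers of the resolvent only by a small factor. -/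
theorem le_quadForm_resolvent_pow (hs : 0 < s) (hA : A.PosSemidef) (x : ι → 𝕜) (p : ℕ) :
    (1 - p * (quadForm (1 : Matrix ι ι 𝕜) x / s)) *
      quadForm (((s : 𝕜) • (1 : Matrix ι ι 𝕜) + A)⁻¹ ^ p) x ≤
      quadForm (((s : 𝕜) • (1 : Matrix ι ι 𝕜) + (A + vecMulVec x (star x)))⁻¹ ^ p) x := by
  have hQ := (posDef_smul_one_add hs hA).inv.posSemidef
  have hR := (posDef_smul_one_add hs (hA.add (posSemidef_vecMulVec_self_star x))).inv.posSemidef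
  have hle := quadForm_resolvent_le hs hA x
  have key := quadForm_resolvent_pow hs hA x
  set Q := ((s : 𝕜) • (1 : Matrix ι ι 𝕜) + A)⁻¹
  set R := ((s : 𝕜) • (1 : Matrix ι ι 𝕜) + (A + vecMulVec x (star x)))⁻¹
  have hRQ : ∀ p, quadForm (R ^ p) x ≤ quadForm (Q ^ p) x := fun p => by
    rw [key p]
    exact le_add_of_nonneg_right (Finset.sum_nonneg fun i _ =>
      mul_nonneg (quadForm_pow_nonneg hR x _) (quadForm_pow_nonneg hQ x _))
  -- Replacing R by Q only increases each term. Chebyshev's inequality with weight λ then moves the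
  -- powers onto one factor, leaving (x*Qx)(x*Q^p x), and x*Qx ≤ |x|²/s.
  have hsum : ∑ i ∈ Finset.range p, quadForm (R ^ (i + 1)) x * quadForm (Q ^ (p - i)) x ≤
      p * (quadForm (1 : Matrix ι ι 𝕜) x / s * quadForm (Q ^ p) x) := by
    rw [← nsmul_eq_mul]
    nth_rewrite 3 [← Finset.card_range p]
    refine Finset.sum_le_card_nsmul _ _ _ fun i hi => ?_
    rw [Finset.mem_range] at hi
    have h2 := quadForm_pow_mul_le hQ x 1 i (p - i - 1)
    rw [show 1 + (p - i - 1) = p - i by omega, show 1 + (i + (p - i - 1)) = p by omega,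
      pow_one, add_comm 1 i] at h2
    refine (mul_le_mul_of_nonneg_right (hRQ _) (quadForm_pow_nonneg hQ x _)).trans (h2.trans ?_)
    exact mul_le_mul_of_nonneg_right hle (quadForm_pow_nonneg hQ x _)
  have := key p
  linarith

/-- With ρ = x*Rx the difference is (1 − ρ)(Qx)(Qx)*. The relation x*Qx = ρ + ρ·x*Qx forces ρ ≤ 1.
-/
theorem posSemidef_resolvent_sub_resolvent (hs : 0 < s) (hA : A.PosSemidef) (x : ι → 𝕜) :
    (((s : 𝕜) • (1 : Matrix ι ι 𝕜) + A)⁻¹ - ((s : 𝕜) • (1 : Matrix ι ι 𝕜) +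
      (A + vecMulVec x (star x)))⁻¹).PosSemidef := by
  have hQ := (posDef_smul_one_add hs hA).inv.posSemidef
  have hR := (posDef_smul_one_add hs (hA.add (posSemidef_vecMulVec_self_star x))).inv.posSemidef
  have hsub := resolvent_sub_resolvent hs hA x
  have key := quadForm_resolvent_pow hs hA x 1
  set Q := ((s : 𝕜) • (1 : Matrix ι ι 𝕜) + A)⁻¹
  set R := ((s : 𝕜) • (1 : Matrix ι ι 𝕜) + (A + vecMulVec x (star x)))⁻¹
  simp only [pow_one, Finset.range_one, Finset.sum_singleton, zero_add, Nat.sub_zero] at key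
  have hQ0 : 0 ≤ quadForm Q x := by simpa using quadForm_pow_nonneg hQ x 1
  have hR0 : 0 ≤ quadForm R x := by simpa using quadForm_pow_nonneg hR x 1
  have hR1 : quadForm R x ≤ 1 := by
    by_contra! h
    nlinarith
  have hRx : R *ᵥ x = ((1 - quadForm R x : ℝ) : 𝕜) • (Q *ᵥ x) := by
    have h2 : Q - R = Q * vecMulVec x (star x) * R := by
      have := congrArg conjTranspose hsub
      simpa [conjTranspose_mul, hQ.1.eq, hR.1.eq, conjTranspose_vecMulVec, mul_assoc] using this
    have h3 := congrArg (fun M => M *ᵥ x) h2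
    have h4 := ofReal_quadForm_pow hR x 1
    rw [pow_one] at h4
    simp only [sub_mulVec, ← mulVec_mulVec, vecMulVec_mulVec, h4, mulVec_smul] at h3
    rw [RCLike.ofReal_sub, RCLike.ofReal_one, sub_smul, one_smul]
    rw [sub_eq_iff_eq_add, op_smul_eq_smul] at h3
    rw [eq_sub_iff_add_eq']
    exact h3.symm
  have e : Q - R = ((1 - quadForm R x : ℝ) : 𝕜) • vecMulVec (Q *ᵥ x) (star (Q *ᵥ x)) := by
    rw [hsub, mul_vecMulVec, hRx, vecMulVec_mul, star_mulVec, hQ.1.eq, smul_vecMulVec]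
  rw [e]
  exact (posSemidef_vecMulVec_self_star _).smul (RCLike.ofReal_nonneg.2 (by linarith))

end Resolvent

end MatrixMoments

end RKHSSampling

open MeasureTheory
open scoped ENNReal InnerProductSpace

namespace RKHSSampling

open Matrix ProbabilityTheory
open scoped ComplexOrder MatrixOrder

set_option linter.unusedSectionVars false

/-! ### Sums of random rank one matrices and averaging over one sample -/

section SampleMatrix

variable {𝕜 ι κ D : Type*} [RCLike 𝕜] [Fintype ι] [DecidableEq ι] [Fintype κ] [DecidableEq κ]
  [MeasurableSpace D]

/-- The sum of the rank one matrices `z i (z i)*` for `i` in `s`. -/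
def gramSum (s : Finset κ) (z : κ → ι → 𝕜) : Matrix ι ι 𝕜 :=
  ∑ i ∈ s, vecMulVec (z i) (star (z i))

theorem posSemidef_gramSum (s : Finset κ) (z : κ → ι → 𝕜) : (gramSum s z).PosSemidef :=
  posSemidef_sum _ fun i _ => posSemidef_vecMulVec_self_star (z i)

theorem gramSum_eq_erase_add {s : Finset κ} {i : κ} (hi : i ∈ s) (z : κ → ι → 𝕜) :
    gramSum s z = gramSum (s.erase i) z + vecMulVec (z i) (star (z i)) :=
  (Finset.sum_erase_add _ _ hi).symm

theorem continuous_gramSum (s : Finset κ) :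
    Continuous fun z : κ → ι → 𝕜 => gramSum s z :=
  continuous_finsetSum _ fun i _ =>
    (continuous_apply i).matrix_vecMulVec (continuous_apply i).star

theorem gramSum_congr {s : Finset κ} {z z' : κ → ι → 𝕜} (h : ∀ j ∈ s, z j = z' j) :
    gramSum s z = gramSum s z' :=
  Finset.sum_congr rfl fun j hj => by rw [h j hj]

theorem re_trace_mul_vecMulVec (A : Matrix ι ι 𝕜) (x : ι → 𝕜) :
    RCLike.re (A * vecMulVec x (star x)).trace = quadForm A x := by
  rw [mul_vecMulVec, trace_vecMulVec, dotProduct_comm]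
  rfl

theorem re_trace_mul_gramSum (A : Matrix ι ι 𝕜) (s : Finset κ) (z : κ → ι → 𝕜) :
    RCLike.re (A * gramSum s z).trace = ∑ i ∈ s, quadForm A (z i) := by
  simp only [gramSum, Finset.mul_sum, trace_sum, map_sum, re_trace_mul_vecMulVec]

theorem continuous_quadForm {X : Type*} [TopologicalSpace X] {A : X → Matrix ι ι 𝕜}
    {x : X → ι → 𝕜} (hA : Continuous A) (hx : Continuous x) :
    Continuous fun t => quadForm (A t) (x t) :=
  RCLike.continuous_re.comp (hx.star.dotProduct (hA.matrix_mulVec hx))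

/-- A bounded measurable feature map `ψ` with diagonal second moment matrix. -/
structure IsFeatureMap (ν : Measure D) (ψ : D → ι → 𝕜) (r : ℝ) (d : ι → ℝ) : Prop where
  measurable : Measurable ψ
  bound : ∀ y, quadForm (1 : Matrix ι ι 𝕜) (ψ y) ≤ r
  moment : ∀ a b, ∫ y, star (ψ y a) * ψ y b ∂ν = diagonal (fun a => (d a : 𝕜)) a b

theorem quadForm_one (x : ι → 𝕜) : quadForm (1 : Matrix ι ι 𝕜) x = ∑ a, ‖x a‖ ^ 2 := by
  rw [quadForm, one_mulVec, dotProduct, map_sum]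
  refine Finset.sum_congr rfl fun a _ => ?_
  rw [Pi.star_apply, RCLike.star_def, RCLike.conj_mul, ← RCLike.ofReal_pow, RCLike.ofReal_re]

variable {ν : Measure D} [IsProbabilityMeasure ν] {ψ : D → ι → 𝕜} {r : ℝ} {d : ι → ℝ}

theorem IsFeatureMap.norm_le (h : IsFeatureMap ν ψ r d) (y : D) : ‖ψ y‖ ≤ √r := by
  refine (pi_norm_le_iff_of_nonneg (Real.sqrt_nonneg _)).2 fun a => Real.le_sqrt_of_sq_le ?_
  refine le_trans ?_ (h.bound y)
  rw [quadForm_one]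
  exact Finset.single_le_sum (f := fun a => ‖ψ y a‖ ^ 2) (fun _ _ => by positivity)
    (Finset.mem_univ a)

/-- The features stay in a compact ball, on which a continuous function is bounded; this settles all
integrability questions below. -/
theorem IsFeatureMap.integrable_comp {E : Type*} [NormedAddCommGroup E]
    [SecondCountableTopology E] [MeasurableSpace E] [BorelSpace E]
    (h : IsFeatureMap ν ψ r d) {g : (κ → ι → 𝕜) → E} (hg : Continuous g) :
    Integrable (fun x : κ → D => g fun i => ψ (x i)) (Measure.pi fun _ => ν) := by
  obtain ⟨C, hC⟩ := (isCompact_closedBall (0 : κ → ι → 𝕜) √r).exists_bound_of_continuousOn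
    hg.continuousOn
  refine Integrable.of_bound (C := C) ?_ (Filter.Eventually.of_forall fun x => hC _ ?_)
  · exact (hg.measurable.comp (measurable_pi_lambda _ fun i =>
      h.measurable.comp (measurable_pi_apply i))).aestronglyMeasurable
  · rw [mem_closedBall_zero_iff]
    exact (pi_norm_le_iff_of_nonneg (Real.sqrt_nonneg _)).2 fun i => h.norm_le _

/-- Averaging a quadratic form over the `i`-th sample point, when the matrix does not depend
on it. -/
theorem IsFeatureMap.integral_quadForm (h : IsFeatureMap ν ψ r d) {i : κ}
    {G : (κ → ι → 𝕜) → Matrix ι ι 𝕜} (hG : Continuous G)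
    (hGi : ∀ z z', (∀ j ≠ i, z j = z' j) → G z = G z') :
    ∫ x, quadForm (G fun j => ψ (x j)) (ψ (x i)) ∂(Measure.pi fun _ : κ => ν) =
      ∫ x, ∑ a, d a * RCLike.re ((G fun j => ψ (x j)) a a) ∂(Measure.pi fun _ : κ => ν) := by
  have hGab : ∀ a b, Continuous fun z => G z a b := fun a b => hG.matrix_elem a b
  have hindep : iIndepFun (fun j (x : κ → D) => x j) (Measure.pi fun _ : κ => ν) :=
    iIndepFun_pi (X := fun _ : κ => (id : D → D)) fun _ => aemeasurable_id
  have hmul : ∀ a b, ∫ x, (star (ψ (x i) a) * ψ (x i) b) * (G fun j => ψ (x j)) a b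
      ∂(Measure.pi fun _ : κ => ν) =
      (∫ y, star (ψ y a) * ψ y b ∂ν) *
        ∫ x, (G fun j => ψ (x j)) a b ∂(Measure.pi fun _ : κ => ν) := by
    intro a b
    have hI := hindep.indepFun_finset {i} (Finset.univ.erase i) (by simp)
      (fun j => measurable_pi_apply j)
    have hm1 : Measurable fun w : ({i} : Finset κ) → D =>
        star (ψ (w ⟨i, Finset.mem_singleton_self i⟩) a) *
          ψ (w ⟨i, Finset.mem_singleton_self i⟩) b := by
      have : Measurable fun w : ({i} : Finset κ) → D => ψ (w ⟨i, Finset.mem_singleton_self i⟩) :=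
        h.measurable.comp (measurable_pi_apply _)
      exact (continuous_star.measurable.comp ((measurable_pi_apply a).comp this)).mul ((measurable_pi_apply b).comp this)
    -- To make G a function of the coordinates other than i, its i-th argument is set to 0; by `hGi`
    -- this does not change its value.
    have hm2 : Measurable fun w : ((Finset.univ.erase i : Finset κ)) → D =>
        (G fun j => if hj : j ∈ Finset.univ.erase i then ψ (w ⟨j, hj⟩) else 0) a b := by
      refine (hGab a b).measurable.comp (measurable_pi_lambda _ fun j => ?_)
      by_cases hj : j ∈ Finset.univ.erase i
      · simp only [hj, dite_true]
        exact h.measurable.comp (measurable_pi_apply _)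
      · simp only [hj, dite_false]
        exact measurable_const
    have hI2 := hI.comp hm1 hm2
    have e2 : ((fun w : ((Finset.univ.erase i : Finset κ)) → D =>
        (G fun j => if hj : j ∈ Finset.univ.erase i then ψ (w ⟨j, hj⟩) else 0) a b) ∘
        fun (x : κ → D) (j : (Finset.univ.erase i : Finset κ)) => x j) =
        fun x => (G fun j => ψ (x j)) a b := by
      funext x
      refine congrFun (congrFun (hGi _ _ fun j hj => ?_) a) b
      simp [hj]
    rw [e2] at hI2
    have key := hI2.integral_fun_mul_eq_mul_integral
      (hm1.comp (measurable_pi_lambda _ fun j => measurable_pi_apply _)).aestronglyMeasurable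
      (h.integrable_comp (hGab a b)).aestronglyMeasurable
    refine key.trans ?_
    congr 1
    have hmp := measurePreserving_eval (fun _ : κ => ν) i
    have hms : Measurable fun y => star (ψ y a) * ψ y b :=
      (continuous_star.measurable.comp ((measurable_pi_apply a).comp h.measurable)).mul
        ((measurable_pi_apply b).comp h.measurable)
    have hmap := integral_map (μ := Measure.pi fun _ : κ => ν) hmp.measurable.aemeasurable
      hms.aestronglyMeasurable
    rw [hmp.map_eq] at hmap
    exact hmap.symm
  have hint : ∀ a b, Integrable (fun x : κ → D =>
      (star (ψ (x i) a) * ψ (x i) b) * (G fun j => ψ (x j)) a b) (Measure.pi fun _ => ν) :=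
    fun a b => h.integrable_comp (g := fun z => (star (z i a) * z i b) * G z a b)
      (((continuous_apply_apply i a).star.mul (continuous_apply_apply i b)).mul (hGab a b))
  have e1 : ∀ x : κ → D, quadForm (G fun j => ψ (x j)) (ψ (x i)) = RCLike.re
      (∑ a, ∑ b, (star (ψ (x i) a) * ψ (x i) b) * (G fun j => ψ (x j)) a b) := by
    intro x
    rw [quadForm, dotProduct]
    congr 1
    refine Finset.sum_congr rfl fun a _ => ?_
    rw [mulVec, dotProduct, Finset.mul_sum]
    refine Finset.sum_congr rfl fun b _ => ?_
    rw [Pi.star_apply]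
    ring
  have hint2 : Integrable (fun x : κ → D => ∑ a, ∑ b,
      (star (ψ (x i) a) * ψ (x i) b) * (G fun j => ψ (x j)) a b) (Measure.pi fun _ => ν) :=
    integrable_finsetSum _ fun a _ => integrable_finsetSum _ fun b _ => hint a b
  have e3 : ∀ x : κ → D, ∑ a, d a * RCLike.re ((G fun j => ψ (x j)) a a) =
      RCLike.re (∑ a, (d a : 𝕜) * (G fun j => ψ (x j)) a a) := by
    intro x
    rw [map_sum]
    exact Finset.sum_congr rfl fun a _ => (RCLike.re_ofReal_mul _ _).symm
  simp only [e1, e3]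
  rw [integral_re hint2, integral_re (integrable_finsetSum _ fun a _ =>
    (h.integrable_comp (hGab a a)).const_mul _)]
  congr 1
  rw [integral_finsetSum _ fun a _ => integrable_finsetSum _ fun b _ => hint a b,
    integral_finsetSum _ fun a _ => (h.integrable_comp (hGab a a)).const_mul _]
  refine Finset.sum_congr rfl fun a _ => ?_
  rw [integral_finsetSum _ fun b _ => hint a b, integral_const_mul]
  simp only [hmul, h.moment]
  rw [Finset.sum_eq_single a (fun b _ hb => by rw [diagonal_apply_ne' _ hb, zero_mul])
    (fun h => absurd (Finset.mem_univ a) h), diagonal_apply_eq]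

end SampleMatrix

/-! ### Upper frame bound: moments of the trace -/

section UpperTail

variable {𝕜 ι κ D : Type*} [RCLike 𝕜] [Fintype ι] [DecidableEq ι] [Fintype κ] [DecidableEq κ]
  [MeasurableSpace D] {ν : Measure D} [IsProbabilityMeasure ν] {ψ : D → ι → 𝕜} {r : ℝ} {d : ι → ℝ}

/-- The bound for the `p`-th moment of a sum of `n` random rank one matrices. -/
noncomputable def momentBound (τ n r : ℝ) (p : ℕ) : ℝ :=
  τ * n ^ p * Real.exp (r * p ^ 2 / (2 * n))

theorem momentBound_sub_le {τ n r : ℝ} (hτ : 0 ≤ τ) (hn : 0 < n) (hr : 0 ≤ r) {p j : ℕ}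
    (hj : j ≤ p) : momentBound τ n r (p - j) ≤ (n ^ j)⁻¹ * momentBound τ n r p := by
  have h1 : n ^ p = n ^ (p - j) * n ^ j := by rw [← pow_add, Nat.sub_add_cancel hj]
  have h2 : (n ^ j)⁻¹ * momentBound τ n r p =
      τ * n ^ (p - j) * Real.exp (r * p ^ 2 / (2 * n)) := by
    rw [momentBound, h1]
    field_simp
  rw [h2, momentBound]
  have h3 : ((p - j : ℕ) : ℝ) ≤ p := by exact_mod_cast Nat.sub_le p j
  gcongr

/-- This recursion dictates the form of the bound: (1 + r/n)^p ≤ exp(pr/n), and 2p + p² ≤ (p + 1)²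
in the exponent. -/
theorem mul_momentBound_le {τ n r : ℝ} (hτ : 0 ≤ τ) (hn : 0 < n) (hr : 0 ≤ r) (p : ℕ) :
    n * (1 + r / n) ^ p * momentBound τ n r p ≤ momentBound τ n r (p + 1) := by
  have h1 : (1 + r / n) ^ p ≤ Real.exp (p * (r / n)) := by
    rw [Real.exp_nat_mul]
    have : 0 ≤ r / n := by positivity
    exact pow_le_pow_left₀ (by positivity) (by linarith [Real.add_one_le_exp (r / n)]) p
  calc n * (1 + r / n) ^ p * momentBound τ n r p
      ≤ n * Real.exp (p * (r / n)) * momentBound τ n r p := by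
        have : 0 ≤ momentBound τ n r p := by unfold momentBound; positivity
        gcongr
    _ = τ * n ^ (p + 1) * Real.exp (p * (r / n) + r * p ^ 2 / (2 * n)) := by
        rw [momentBound, Real.exp_add]
        ring
    _ ≤ momentBound τ n r (p + 1) := by
        rw [momentBound]
        have h2 : p * (r / n) + r * p ^ 2 / (2 * n) ≤ r * ((p + 1 : ℕ) : ℝ) ^ 2 / (2 * n) := by
          have e : r * ((p + 1 : ℕ) : ℝ) ^ 2 / (2 * n) - (p * (r / n) + r * p ^ 2 / (2 * n)) =
              r / (2 * n) := by
            push_cast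
            field_simp
            ring
          have : 0 ≤ r / (2 * n) := by positivity
          linarith
        gcongr

/-- Write tr S^{p+1} = ∑ z_i* S^p z_i, remove z_i from S in each summand and average over it, which
produces traces weighted by d of lower powers. Since d ≤ 1, the weighted trace is in turn at most
the trace. At p = 0 the trace is the dimension while the weighted trace is τ = ∑ d_a; starting from
the latter keeps the bound free of the dimension. All subsets of the sample are needed because
samples get removed. -/
theorem IsFeatureMap.moment_le (h : IsFeatureMap ν ψ r d) (hd0 : ∀ a, 0 ≤ d a)
    (hd1 : ∀ a, d a ≤ 1) (hr : 0 ≤ r) {n : ℝ} (hn : 0 < n) (hκ : Fintype.card κ ≤ n) (p : ℕ) :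
    ∀ s : Finset κ,
      ∫ x, ∑ a, d a * RCLike.re ((gramSum s (fun j => ψ (x j)) ^ p) a a)
        ∂(Measure.pi fun _ : κ => ν) ≤ momentBound (∑ a, d a) n r p ∧
      (p ≠ 0 → ∫ x, RCLike.re (gramSum s (fun j => ψ (x j)) ^ p).trace
        ∂(Measure.pi fun _ : κ => ν) ≤ momentBound (∑ a, d a) n r p) := by
  have hτ : 0 ≤ ∑ a, d a := Finset.sum_nonneg fun a _ => hd0 a
  have hcont : ∀ (s : Finset κ) (q : ℕ), Continuous fun z : κ → ι → 𝕜 => gramSum s z ^ q :=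
    fun s q => (continuous_gramSum s).pow q
  have hpsd : ∀ (s : Finset κ) (q : ℕ) (z : κ → ι → 𝕜), (gramSum s z ^ q).PosSemidef :=
    fun s q z => (posSemidef_gramSum s z).pow q
  have hintTr : ∀ (s : Finset κ) (q : ℕ), Integrable (fun x : κ → D =>
      RCLike.re (gramSum s (fun j => ψ (x j)) ^ q).trace) (Measure.pi fun _ => ν) :=
    fun s q => h.integrable_comp (g := fun z => RCLike.re (gramSum s z ^ q).trace)
      (RCLike.continuous_re.comp (hcont s q).matrix_trace)
  have hintD : ∀ (s : Finset κ) (q : ℕ), Integrable (fun x : κ → D =>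
      ∑ a, d a * RCLike.re ((gramSum s (fun j => ψ (x j)) ^ q) a a)) (Measure.pi fun _ => ν) :=
    fun s q => h.integrable_comp (g := fun z => ∑ a, d a * RCLike.re ((gramSum s z ^ q) a a))
      (continuous_finsetSum _ fun a _ => continuous_const.mul
        (RCLike.continuous_re.comp ((hcont s q).matrix_elem a a)))
  induction p using Nat.strong_induction_on with
  | _ p ih =>
    rcases p with _ | p
    · intro s
      refine ⟨?_, fun h => absurd rfl h⟩
      simp [momentBound]
    intro s
    have hqint : ∀ i q, Integrable (fun x : κ → D =>
        quadForm (gramSum (s.erase i) (fun j => ψ (x j)) ^ q) (ψ (x i)))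
        (Measure.pi fun _ => ν) := fun i q =>
      h.integrable_comp (g := fun z => quadForm (gramSum (s.erase i) z ^ q) (z i))
        (continuous_quadForm (hcont _ _) (continuous_apply i))
    have hle : ∀ x : κ → D, RCLike.re (gramSum s (fun j => ψ (x j)) ^ (p + 1)).trace ≤
        ∑ i ∈ s, ∑ j ∈ Finset.range (p + 1), (p.choose j * r ^ j) *
          quadForm (gramSum (s.erase i) (fun j => ψ (x j)) ^ (p - j)) (ψ (x i)) := by
      intro x
      rw [pow_succ, re_trace_mul_gramSum]
      refine Finset.sum_le_sum fun i hi => ?_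
      rw [gramSum_eq_erase_add hi]
      refine (quadForm_add_vecMulVec_pow_le (posSemidef_gramSum _ _) _ p).trans
        (Finset.sum_le_sum fun j _ => ?_)
      have h1 := h.bound (x i)
      have h2 := quadForm_pow_nonneg (posSemidef_gramSum (s.erase i) fun j => ψ (x j))
        (ψ (x i)) (p - j)
      have h3 : 0 ≤ quadForm (1 : Matrix ι ι 𝕜) (ψ (x i)) := by
        rw [quadForm_one]; positivity
      gcongr
    have htr : ∫ x, RCLike.re (gramSum s (fun j => ψ (x j)) ^ (p + 1)).trace
        ∂(Measure.pi fun _ : κ => ν) ≤ momentBound (∑ a, d a) n r (p + 1) := by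
      refine (integral_mono (hintTr s (p + 1)) (integrable_finsetSum _ fun i _ =>
        integrable_finsetSum _ fun j _ => (hqint i (p - j)).const_mul _) hle).trans ?_
      rw [integral_finsetSum _ fun i _ =>
        integrable_finsetSum _ fun j _ => (hqint i (p - j)).const_mul _]
      refine le_trans ?_ (mul_momentBound_le hτ hn hr p)
      have hi : ∀ i ∈ s, ∫ x, ∑ j ∈ Finset.range (p + 1), (p.choose j * r ^ j) *
          quadForm (gramSum (s.erase i) (fun j => ψ (x j)) ^ (p - j)) (ψ (x i))
          ∂(Measure.pi fun _ : κ => ν) ≤ (1 + r / n) ^ p * momentBound (∑ a, d a) n r p := by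
        intro i hi
        -- Each lost power of S costs a factor 1/n in the bound, so the coefficients add up to the
        -- binomial expansion of (1 + r/n)^p.
        rw [integral_finsetSum _ fun j _ => (hqint i (p - j)).const_mul _, add_comm 1 (r / n),
          add_pow, Finset.sum_mul]
        refine Finset.sum_le_sum fun j hj => ?_
        have hj' : j ≤ p := Nat.lt_succ_iff.1 (Finset.mem_range.1 hj)
        rw [integral_const_mul, h.integral_quadForm (hcont (s.erase i) (p - j))
          (fun z z' hz => by
            rw [gramSum_congr fun j hj => hz j (Finset.ne_of_mem_erase hj)])]
        have h1 := (ih (p - j) (by omega) (s.erase i)).1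
        have h2 := momentBound_sub_le hτ hn hr hj'
        calc _ ≤ (p.choose j * r ^ j) * ((n ^ j)⁻¹ * momentBound (∑ a, d a) n r p) :=
              mul_le_mul_of_nonneg_left (h1.trans h2) (by positivity)
          _ = _ := by rw [div_pow, one_pow]; field_simp
      have hB : 0 ≤ (1 + r / n) ^ p * momentBound (∑ a, d a) n r p := by
        unfold momentBound; positivity
      calc _ ≤ ∑ i ∈ s, (1 + r / n) ^ p * momentBound (∑ a, d a) n r p := Finset.sum_le_sum hi
        _ = s.card * ((1 + r / n) ^ p * momentBound (∑ a, d a) n r p) := by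
          rw [Finset.sum_const, nsmul_eq_mul]
        _ ≤ n * ((1 + r / n) ^ p * momentBound (∑ a, d a) n r p) := by
          refine mul_le_mul_of_nonneg_right (le_trans ?_ hκ) hB
          exact_mod_cast Finset.card_le_univ s
        _ = _ := by ring
    refine ⟨(integral_mono (hintD s (p + 1)) (hintTr s (p + 1)) fun x => ?_).trans htr, fun _ => htr⟩
    simp only [trace, map_sum, diag_apply]
    refine Finset.sum_le_sum fun a _ => ?_
    have := (RCLike.nonneg_iff.1 ((hpsd s (p + 1) fun j => ψ (x j)).diag_nonneg (i := a))).1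
    exact mul_le_of_le_one_left this (hd1 a)

/-- A unit vector with form at least M makes tr S^p at least M^p, so one Markov bound covers all v
simultaneously. -/
theorem IsFeatureMap.measure_exists_le_quadForm (h : IsFeatureMap ν ψ r d) (hd0 : ∀ a, 0 ≤ d a)
    (hd1 : ∀ a, d a ≤ 1) (hr : 0 ≤ r) {n : ℝ} (hn : 0 < n) (hκ : Fintype.card κ ≤ n) {p : ℕ}
    (hp : p ≠ 0) {M : ℝ} (hM : 0 < M) :
    (Measure.pi fun _ : κ => ν) {x | ∃ v : ι → 𝕜, star v ⬝ᵥ v = 1 ∧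
      M ≤ quadForm (gramSum Finset.univ fun j => ψ (x j)) v} ≤
      ENNReal.ofReal (momentBound (∑ a, d a) n r p / M ^ p) := by
  have hint : Integrable (fun x : κ → D =>
      RCLike.re (gramSum Finset.univ (fun j => ψ (x j)) ^ p).trace) (Measure.pi fun _ => ν) :=
    h.integrable_comp (g := fun z => RCLike.re (gramSum Finset.univ z ^ p).trace)
      (RCLike.continuous_re.comp ((continuous_gramSum _).pow p).matrix_trace)
  have hsub : {x : κ → D | ∃ v : ι → 𝕜, star v ⬝ᵥ v = 1 ∧
      M ≤ quadForm (gramSum Finset.univ fun j => ψ (x j)) v} ⊆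
      {x | M ^ p ≤ RCLike.re (gramSum Finset.univ (fun j => ψ (x j)) ^ p).trace} := by
    rintro x ⟨v, hv, hMv⟩
    exact (pow_le_pow_left₀ hM.le hMv p).trans (pow_quadForm_le_trace (posSemidef_gramSum _ _) hv p)
  refine (measure_mono hsub).trans ?_
  rw [← ofReal_measureReal]
  refine ENNReal.ofReal_le_ofReal ?_
  rw [le_div_iff₀ (by positivity), mul_comm]
  exact (mul_meas_ge_le_integral_of_nonneg (Filter.Eventually.of_forall fun x =>
    (RCLike.nonneg_iff.1 ((posSemidef_gramSum _ _).pow p).trace_nonneg).1) hint _).trans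
    ((h.moment_le hd0 hd1 hr hn hκ p Finset.univ).2 hp)

end UpperTail

/-! ### Lower frame bound: moments of the resolvent -/

section LowerTail

variable {𝕜 ι κ D : Type*} [RCLike 𝕜] [Fintype ι] [DecidableEq ι] [Fintype κ] [DecidableEq κ]
  [MeasurableSpace D] {ν : Measure D} [IsProbabilityMeasure ν] {ψ : D → ι → 𝕜} {r : ℝ}

theorem continuous_resolvent_gramSum (s : Finset κ) {t : ℝ} (ht : 0 < t) :
    Continuous fun z : κ → ι → 𝕜 => ((t : 𝕜) • (1 : Matrix ι ι 𝕜) + gramSum s z)⁻¹ := by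
  have h1 : Continuous fun z : κ → ι → 𝕜 => (t : 𝕜) • (1 : Matrix ι ι 𝕜) + gramSum s z :=
    continuous_const.add (continuous_gramSum s)
  simp only [inv_def, Ring.inverse_eq_inv']
  refine Continuous.smul (h1.matrix_det.inv₀ fun z => ?_) h1.matrix_adjugate
  exact ((isUnit_iff_isUnit_det _).1
    (posDef_smul_one_add ht (posSemidef_gramSum s z)).isUnit).ne_zero

/-- For B = t + S, tr B^{-p} = t tr B^{-(p+1)} + ∑ z_i* B^{-(p+1)} z_i. Removing z_i from B costs at
most the factor w = 1 − P r/t, averaging over z_i gives a full trace since the second moment matrix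
is the identity, and that trace only decreases when z_i is put back. Thus each further power gains
the factor 1/(t + |κ|w) in expectation. -/
theorem IsFeatureMap.resolvent_moment_le (h : IsFeatureMap ν ψ r 1) {t : ℝ} (ht : 0 < t)
    {P : ℕ} (hP : P * (r / t) ≤ 1) (p : ℕ) (hp : p ≤ P) :
    ∫ x, RCLike.re (((t : 𝕜) • (1 : Matrix ι ι 𝕜) +
      gramSum Finset.univ fun j => ψ (x j))⁻¹ ^ p).trace ∂(Measure.pi fun _ : κ => ν) ≤
      Fintype.card ι / (t + Fintype.card κ * (1 - P * (r / t))) ^ p := by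
  have hcont : ∀ (s : Finset κ) (q : ℕ), Continuous fun z : κ → ι → 𝕜 =>
      ((t : 𝕜) • (1 : Matrix ι ι 𝕜) + gramSum s z)⁻¹ ^ q :=
    fun s q => (continuous_resolvent_gramSum s ht).pow q
  have hpsd : ∀ (s : Finset κ) (z : κ → ι → 𝕜),
      ((t : 𝕜) • (1 : Matrix ι ι 𝕜) + gramSum s z)⁻¹.PosSemidef :=
    fun s z => (posDef_smul_one_add ht (posSemidef_gramSum s z)).inv.posSemidef
  have hintTr : ∀ (s : Finset κ) (q : ℕ), Integrable (fun x : κ → D =>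
      RCLike.re (((t : 𝕜) • (1 : Matrix ι ι 𝕜) + gramSum s fun j => ψ (x j))⁻¹ ^ q).trace)
      (Measure.pi fun _ => ν) :=
    fun s q => h.integrable_comp (g := fun z =>
      RCLike.re (((t : 𝕜) • (1 : Matrix ι ι 𝕜) + gramSum s z)⁻¹ ^ q).trace)
      (RCLike.continuous_re.comp (hcont s q).matrix_trace)
  set w : ℝ := 1 - P * (r / t) with hw
  have hw0 : 0 ≤ w := sub_nonneg.2 hP
  have hden : 0 < t + Fintype.card κ * w := by positivity
  induction p with
  | zero => simp
  | succ p ih =>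
    have ih := ih (by omega)
    have hqint : ∀ i, Integrable (fun x : κ → D => quadForm (((t : 𝕜) • (1 : Matrix ι ι 𝕜) +
        gramSum (Finset.univ.erase i) fun j => ψ (x j))⁻¹ ^ (p + 1)) (ψ (x i)))
        (Measure.pi fun _ => ν) := fun i =>
      h.integrable_comp (g := fun z => quadForm (((t : 𝕜) • (1 : Matrix ι ι 𝕜) +
        gramSum (Finset.univ.erase i) z)⁻¹ ^ (p + 1)) (z i))
        (continuous_quadForm (hcont _ _) (continuous_apply i))
    have hpoint : ∀ x : κ → D, t * RCLike.re (((t : 𝕜) • (1 : Matrix ι ι 𝕜) +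
          gramSum Finset.univ fun j => ψ (x j))⁻¹ ^ (p + 1)).trace +
        ∑ i, w * quadForm (((t : 𝕜) • (1 : Matrix ι ι 𝕜) +
          gramSum (Finset.univ.erase i) fun j => ψ (x j))⁻¹ ^ (p + 1)) (ψ (x i)) ≤
        RCLike.re (((t : 𝕜) • (1 : Matrix ι ι 𝕜) +
          gramSum Finset.univ fun j => ψ (x j))⁻¹ ^ p).trace := by
      intro x
      set z : κ → ι → 𝕜 := fun j => ψ (x j) with hz
      set B := (t : 𝕜) • (1 : Matrix ι ι 𝕜) + gramSum Finset.univ z with hB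
      have hu : IsUnit B.det := (isUnit_iff_isUnit_det _).1
        (posDef_smul_one_add ht (posSemidef_gramSum Finset.univ z)).isUnit
      have e : B⁻¹ ^ p = B⁻¹ ^ (p + 1) * B := by
        rw [pow_succ, mul_assoc, nonsing_inv_mul _ hu, mul_one]
      have e2 : RCLike.re (B⁻¹ ^ p).trace = t * RCLike.re (B⁻¹ ^ (p + 1)).trace +
          ∑ i, quadForm (B⁻¹ ^ (p + 1)) (z i) := by
        rw [e, ← re_trace_mul_gramSum]
        conv_lhs => enter [2, 1, 2]; rw [hB]
        rw [mul_add, trace_add, map_add, mul_smul_comm, mul_one, trace_smul, smul_eq_mul,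
          RCLike.re_ofReal_mul]
      rw [e2]
      refine add_le_add le_rfl (Finset.sum_le_sum fun i hi => ?_)
      rw [hB, gramSum_eq_erase_add hi]
      refine le_trans ?_ (le_quadForm_resolvent_pow ht (posSemidef_gramSum _ _) (z i) (p + 1))
      refine mul_le_mul_of_nonneg_right ?_ (quadForm_pow_nonneg (hpsd _ _) _ _)
      rw [hw]
      have h1 := h.bound (x i)
      have h2 : ((p + 1 : ℕ) : ℝ) ≤ P := by exact_mod_cast hp
      have h3 : 0 ≤ quadForm (1 : Matrix ι ι 𝕜) (ψ (x i)) := by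
        rw [quadForm_one]; positivity
      have h4 : ((p + 1 : ℕ) : ℝ) * (quadForm (1 : Matrix ι ι 𝕜) (z i) / t) ≤ P * (r / t) := by
        gcongr
      linarith
    have hint := integral_mono ((((hintTr Finset.univ (p + 1)).const_mul t)).add
      (integrable_finsetSum _ fun i _ => (hqint i).const_mul w)) (hintTr Finset.univ p) hpoint
    simp only [Pi.add_apply] at hint
    rw [integral_add ((hintTr Finset.univ (p + 1)).const_mul t)
      (integrable_finsetSum _ fun i _ => (hqint i).const_mul w), integral_const_mul,
      integral_finsetSum _ fun i _ => (hqint i).const_mul w] at hint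
    set q := ∫ x, RCLike.re (((t : 𝕜) • (1 : Matrix ι ι 𝕜) +
      gramSum Finset.univ fun j => ψ (x j))⁻¹ ^ (p + 1)).trace ∂(Measure.pi fun _ : κ => ν) with hq
    have hi : ∀ i ∈ (Finset.univ : Finset κ), w * q ≤
        ∫ x, w * quadForm (((t : 𝕜) • (1 : Matrix ι ι 𝕜) +
          gramSum (Finset.univ.erase i) fun j => ψ (x j))⁻¹ ^ (p + 1)) (ψ (x i))
          ∂(Measure.pi fun _ : κ => ν) := by
      intro i hi
      rw [integral_const_mul, h.integral_quadForm (hcont (Finset.univ.erase i) (p + 1))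
          (fun z z' hz => by
            rw [gramSum_congr fun j hj => hz j (Finset.ne_of_mem_erase hj)])]
      refine mul_le_mul_of_nonneg_left ?_ hw0
      have e : ∀ x : κ → D, ∑ a, (1 : ι → ℝ) a * RCLike.re ((((t : 𝕜) • (1 : Matrix ι ι 𝕜) +
          gramSum (Finset.univ.erase i) fun j => ψ (x j))⁻¹ ^ (p + 1)) a a) =
          RCLike.re (((t : 𝕜) • (1 : Matrix ι ι 𝕜) +
          gramSum (Finset.univ.erase i) fun j => ψ (x j))⁻¹ ^ (p + 1)).trace := by
        intro x
        simp [trace, map_sum]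
      simp only [e]
      refine integral_mono (hintTr _ _) (hintTr _ _) fun x => ?_
      refine trace_pow_le_trace_pow (hpsd _ _) ?_ (p + 1)
      rw [gramSum_eq_erase_add hi]
      exact posSemidef_resolvent_sub_resolvent ht (posSemidef_gramSum _ _) _
    have h5 := Finset.card_nsmul_le_sum _ _ _ hi
    rw [nsmul_eq_mul, Finset.card_univ] at h5
    have h6 : (t + Fintype.card κ * w) * q ≤ Fintype.card ι / (t + Fintype.card κ * w) ^ p := by
      linarith
    rw [pow_succ, ← div_div, le_div_iff₀ hden, mul_comm]
    exact h6

/-- If v*Sv ≤ M for a unit vector v, then v*(t + S)⁻¹v ≥ 1/(t + M), so the trace of the P-th power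
is at least (t + M)^{-P}; then Markov's inequality. -/
theorem IsFeatureMap.measure_exists_quadForm_le (h : IsFeatureMap ν ψ r 1) {t : ℝ} (ht : 0 < t)
    {P : ℕ} (hP : P * (r / t) ≤ 1) {M : ℝ} (hM : 0 ≤ M) :
    (Measure.pi fun _ : κ => ν) {x | ∃ v : ι → 𝕜, star v ⬝ᵥ v = 1 ∧
      quadForm (gramSum Finset.univ fun j => ψ (x j)) v ≤ M} ≤
      ENNReal.ofReal (Fintype.card ι *
        ((t + M) / (t + Fintype.card κ * (1 - P * (r / t)))) ^ P) := by
  have hint : Integrable (fun x : κ → D => RCLike.re (((t : 𝕜) • (1 : Matrix ι ι 𝕜) +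
      gramSum Finset.univ fun j => ψ (x j))⁻¹ ^ P).trace) (Measure.pi fun _ => ν) :=
    h.integrable_comp (g := fun z => RCLike.re (((t : 𝕜) • (1 : Matrix ι ι 𝕜) +
      gramSum Finset.univ z)⁻¹ ^ P).trace)
      (RCLike.continuous_re.comp ((continuous_resolvent_gramSum _ ht).pow P).matrix_trace)
  have hpd : ∀ z : κ → ι → 𝕜, ((t : 𝕜) • (1 : Matrix ι ι 𝕜) + gramSum Finset.univ z).PosDef :=
    fun z => posDef_smul_one_add ht (posSemidef_gramSum Finset.univ z)
  have hsub : {x : κ → D | ∃ v : ι → 𝕜, star v ⬝ᵥ v = 1 ∧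
      quadForm (gramSum Finset.univ fun j => ψ (x j)) v ≤ M} ⊆
      {x | ((t + M) ^ P)⁻¹ ≤ RCLike.re (((t : 𝕜) • (1 : Matrix ι ι 𝕜) +
        gramSum Finset.univ fun j => ψ (x j))⁻¹ ^ P).trace} := by
    rintro x ⟨v, hv, hMv⟩
    refine le_trans ?_ (pow_quadForm_le_trace (hpd _).inv.posSemidef hv P)
    rw [← inv_pow]
    refine pow_le_pow_left₀ (by positivity) ?_ P
    have h1 := one_le_quadForm_mul_quadForm_inv (hpd fun j => ψ (x j)) hv
    have h2 : quadForm ((t : 𝕜) • (1 : Matrix ι ι 𝕜) + gramSum Finset.univ fun j => ψ (x j)) v =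
        t + quadForm (gramSum Finset.univ fun j => ψ (x j)) v := by
      rw [quadForm, add_mulVec, dotProduct_add, map_add, smul_mulVec, one_mulVec, dotProduct_smul,
        hv, smul_eq_mul, mul_one, RCLike.ofReal_re, quadForm]
    rw [h2] at h1
    have h3 : 0 ≤ quadForm ((t : 𝕜) • (1 : Matrix ι ι 𝕜) +
        gramSum Finset.univ fun j => ψ (x j))⁻¹ v := by
      simpa using quadForm_pow_nonneg (hpd fun j => ψ (x j)).inv.posSemidef v 1
    rw [inv_le_iff_one_le_mul₀' (by positivity)]
    exact h1.trans (mul_le_mul_of_nonneg_right (by linarith) h3)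
  refine (measure_mono hsub).trans ?_
  rw [← ofReal_measureReal]
  refine ENNReal.ofReal_le_ofReal ?_
  have h4 := (mul_meas_ge_le_integral_of_nonneg (Filter.Eventually.of_forall fun x =>
    (RCLike.nonneg_iff.1 ((hpd _).inv.posSemidef.pow P).trace_nonneg).1) hint
    ((t + M) ^ P)⁻¹).trans (h.resolvent_moment_le ht hP P le_rfl)
  rw [inv_mul_le_iff₀ (by positivity)] at h4
  refine h4.trans (le_of_eq ?_)
  rw [div_pow]
  ring

end LowerTail

end RKHSSampling

open MeasureTheory
open scoped ENNReal InnerProductSpace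

namespace RKHSSampling

open Matrix ProbabilityTheory
open scoped ComplexOrder MatrixOrder

set_option linter.unusedSectionVars false

/-! ### Explicit constants in the tail bounds -/

section TailBounds

/-- The power p lies between 8y and 9y. The exponent is at most 9p/128 − p/4 = −23p/128 ≤ −23y/16.
-/
theorem momentBound_div_le {τ n r y : ℝ} (hτ : 0 ≤ τ) (hr : 0 < r) (hy : 1 ≤ y)
    (hn : 64 * r * y ≤ n) :
    momentBound τ n r ⌈8 * y⌉₊ / (4 / 3 * n) ^ ⌈8 * y⌉₊ ≤ τ * Real.exp (-y) := by
  have hn0 : 0 < n := lt_of_lt_of_le (by positivity) hn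
  have hp1 : 8 * y ≤ ⌈8 * y⌉₊ := Nat.le_ceil _
  have hp2 : (⌈8 * y⌉₊ : ℝ) ≤ 9 * y := by
    linarith [Nat.ceil_lt_add_one (show (0 : ℝ) ≤ 8 * y by positivity)]
  set p := ⌈8 * y⌉₊
  have h1 : momentBound τ n r p / (4 / 3 * n) ^ p =
      τ * (Real.exp (r * p ^ 2 / (2 * n)) * (3 / 4) ^ p) := by
    rw [momentBound, mul_pow, show (3 / 4 : ℝ) = (4 / 3)⁻¹ by norm_num, inv_pow]
    field_simp
  rw [h1]
  refine mul_le_mul_of_nonneg_left ?_ hτ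
  have h2 : (3 / 4 : ℝ) ^ p ≤ Real.exp (p * (-(1 / 4))) := by
    rw [Real.exp_nat_mul]
    exact pow_le_pow_left₀ (by norm_num) (by linarith [Real.add_one_le_exp (-(1 / 4 : ℝ))]) p
  have h3 : r * p ^ 2 / (2 * n) ≤ 9 * p / 128 := by
    rw [div_le_div_iff₀ (by positivity) (by norm_num)]
    have : r * p * p ≤ r * p * (9 * y) := by gcongr
    have h4 : p * (64 * r * y) ≤ p * n := by gcongr
    nlinarith
  calc Real.exp (r * p ^ 2 / (2 * n)) * (3 / 4) ^ p
      ≤ Real.exp (9 * p / 128) * Real.exp (p * (-(1 / 4))) := by gcongr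
    _ = Real.exp (9 * p / 128 + p * (-(1 / 4))) := (Real.exp_add _ _).symm
    _ ≤ Real.exp (-y) := Real.exp_le_exp.2 (by linarith)

theorem ceil_mul_div_le {n r y : ℝ} (hr : 0 < r) (hy : 1 ≤ y) (hn : 64 * r * y ≤ n) :
    ⌈40 * y⌉₊ * (r / (4 * n)) ≤ 41 / 256 := by
  have hn0 : 0 < n := lt_of_lt_of_le (by positivity) hn
  have hp2 : (⌈40 * y⌉₊ : ℝ) ≤ 41 * y := by
    linarith [Nat.ceil_lt_add_one (show (0 : ℝ) ≤ 40 * y by positivity)]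
  calc ⌈40 * y⌉₊ * (r / (4 * n)) ≤ 41 * y * (r / (4 * n)) := by gcongr
    _ = 41 * (r * y) / (4 * n) := by ring
    _ ≤ 41 / 256 := by
      rw [div_le_div_iff₀ (by positivity) (by norm_num)]
      linarith

/-- For the shift t = 4n the ratio is (14/3)/(5 − β) with β ≤ 41/256, which is below 29/30; forty
times 1/30 exceeds 1. -/
theorem resolvent_ratio_pow_le {n r y : ℝ} (hr : 0 < r) (hy : 1 ≤ y) (hn : 64 * r * y ≤ n) :
    ((4 * n + 2 / 3 * n) / (4 * n + n * (1 - ⌈40 * y⌉₊ * (r / (4 * n))))) ^ ⌈40 * y⌉₊ ≤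
      Real.exp (-y) := by
  have hn0 : 0 < n := lt_of_lt_of_le (by positivity) hn
  have h1 := ceil_mul_div_le hr hy hn
  have hp1 : 40 * y ≤ ⌈40 * y⌉₊ := Nat.le_ceil _
  set p := ⌈40 * y⌉₊
  have h0 : 0 ≤ p * (r / (4 * n)) := by positivity
  set β := p * (r / (4 * n))
  have hden : 0 < 4 * n + n * (1 - β) := by nlinarith
  have h2 : (4 * n + 2 / 3 * n) / (4 * n + n * (1 - β)) ≤ 29 / 30 := by
    rw [div_le_div_iff₀ hden (by norm_num)]
    nlinarith
  have h3 : (29 / 30 : ℝ) ^ p ≤ Real.exp (p * (-(1 / 30))) := by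
    rw [Real.exp_nat_mul]
    exact pow_le_pow_left₀ (by norm_num) (by linarith [Real.add_one_le_exp (-(1 / 30 : ℝ))]) p
  calc _ ≤ (29 / 30 : ℝ) ^ p := pow_le_pow_left₀ (by positivity) h2 p
    _ ≤ Real.exp (p * (-(1 / 30))) := h3
    _ ≤ Real.exp (-y) := Real.exp_le_exp.2 (by linarith)

variable {𝕜 ι D : Type*} [RCLike 𝕜] [Fintype ι] [DecidableEq ι]
  [MeasurableSpace D] {ν : Measure D} [IsProbabilityMeasure ν] {r : ℝ} {d : ι → ℝ}

/-- An almost everywhere measurable feature map has a measurable modification. -/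
theorem exists_isFeatureMap {φ : D → ι → 𝕜} (hr : 0 ≤ r) (hφ : AEMeasurable φ ν)
    (hbound : ∀ y, ∑ a, ‖φ y a‖ ^ 2 ≤ r)
    (hmom : ∀ a b, ∫ y, star (φ y a) * φ y b ∂ν = diagonal (fun a => (d a : 𝕜)) a b) :
    ∃ ψ : D → ι → 𝕜, IsFeatureMap ν ψ r d ∧ φ =ᵐ[ν] ψ := by
  -- The measurable version may violate the bound on a null set; it is replaced by 0 there, because
  -- the compactness argument needs the bound at every point.
  set S : Set D := {y | quadForm (1 : Matrix ι ι 𝕜) (hφ.mk φ y) ≤ r} with hS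
  have hSm : MeasurableSet S := by
    have : Measurable fun y => quadForm (1 : Matrix ι ι 𝕜) (hφ.mk φ y) :=
      (continuous_quadForm (A := fun _ : ι → 𝕜 => (1 : Matrix ι ι 𝕜)) continuous_const
        continuous_id).measurable.comp hφ.measurable_mk
    exact this measurableSet_Iic
  have hae : φ =ᵐ[ν] S.indicator (hφ.mk φ) := by
    filter_upwards [hφ.ae_eq_mk] with y hy
    have : y ∈ S := by
      rw [hS, Set.mem_ofPred_eq, ← hy, quadForm_one]
      exact hbound y
    rw [Set.indicator_of_mem this, hy]
  refine ⟨S.indicator (hφ.mk φ), ⟨hφ.measurable_mk.indicator hSm, fun y => ?_, fun a b => ?_⟩, hae⟩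
  · by_cases hy : y ∈ S
    · rw [Set.indicator_of_mem hy]
      exact hy
    · rw [Set.indicator_of_notMem hy, quadForm_one]
      simpa using hr
  · rw [← hmom a b]
    refine integral_congr_ae ?_
    filter_upwards [hae] with y hy
    rw [hy]

theorem quadForm_gramSum {κ : Type*} (s : Finset κ) (z : κ → ι → 𝕜) (v : ι → 𝕜) :
    quadForm (gramSum s z) v = ∑ i ∈ s, ‖∑ a, star (v a) * z i a‖ ^ 2 := by
  rw [quadForm, gramSum, sum_mulVec, dotProduct_sum, map_sum]
  refine Finset.sum_congr rfl fun i _ => ?_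
  rw [vecMulVec_mulVec, dotProduct_smul, op_smul_eq_smul, smul_eq_mul]
  have : star (z i) ⬝ᵥ v = star (star v ⬝ᵥ z i) := by
    rw [star_dotProduct]
  rw [this, RCLike.star_def, RCLike.conj_mul, ← RCLike.ofReal_pow, RCLike.ofReal_re]
  rfl

theorem measure_pi_congr_feature {n : ℕ} {φ ψ : D → ι → 𝕜} (h : φ =ᵐ[ν] ψ)
    (p : (Fin n → ι → 𝕜) → Prop) :
    (Measure.pi fun _ : Fin n => ν) {x | p fun i => φ (x i)} =
      (Measure.pi fun _ : Fin n => ν) {x | p fun i => ψ (x i)} := by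
  have hall : ∀ᵐ x ∂(Measure.pi fun _ : Fin n => ν), ∀ i, φ (x i) = ψ (x i) :=
    ae_all_iff.2 fun i => (Measure.quasiMeasurePreserving_eval (fun _ : Fin n => ν) i).ae h
  refine measure_congr ?_
  filter_upwards [hall] with x hx
  have : (fun i => φ (x i)) = fun i => ψ (x i) := funext hx
  exact congrArg p this

theorem measure_exists_large_le {n : ℕ} {φ : D → ι → 𝕜} (hr : 0 < r) (hφ : AEMeasurable φ ν)
    (hbound : ∀ y, ∑ a, ‖φ y a‖ ^ 2 ≤ r)
    (hmom : ∀ a b, ∫ y, star (φ y a) * φ y b ∂ν = diagonal (fun a => (d a : 𝕜)) a b)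
    (hd0 : ∀ a, 0 ≤ d a) (hd1 : ∀ a, d a ≤ 1) {y : ℝ} (hy : 1 ≤ y) (hn : 64 * r * y ≤ n) :
    (Measure.pi fun _ : Fin n => ν) {x | ∃ v : ι → 𝕜, star v ⬝ᵥ v = 1 ∧
      4 / 3 * (n : ℝ) ≤ ∑ i, ‖∑ a, star (v a) * φ (x i) a‖ ^ 2} ≤
      ENNReal.ofReal ((∑ a, d a) * Real.exp (-y)) := by
  obtain ⟨ψ, hψ, hae⟩ := exists_isFeatureMap hr.le hφ hbound hmom
  have hn0 : (0 : ℝ) < n := lt_of_lt_of_le (by positivity) hn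
  rw [measure_pi_congr_feature hae fun z => ∃ v : ι → 𝕜, star v ⬝ᵥ v = 1 ∧
      4 / 3 * (n : ℝ) ≤ ∑ i, ‖∑ a, star (v a) * z i a‖ ^ 2]
  simp only [← quadForm_gramSum]
  refine (hψ.measure_exists_le_quadForm hd0 hd1 hr.le hn0 (by simp) (p := ⌈8 * y⌉₊)
    (Nat.ceil_pos.2 (by linarith)).ne' (by positivity)).trans (ENNReal.ofReal_le_ofReal ?_)
  exact momentBound_div_le (Finset.sum_nonneg fun a _ => hd0 a) hr hy hn

theorem measure_exists_small_le {n : ℕ} {φ : D → ι → 𝕜} (hr : 0 < r) (hφ : AEMeasurable φ ν)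
    (hbound : ∀ y, ∑ a, ‖φ y a‖ ^ 2 ≤ r)
    (hmom : ∀ a b, ∫ y, star (φ y a) * φ y b ∂ν = (1 : Matrix ι ι 𝕜) a b)
    {y : ℝ} (hy : 1 ≤ y) (hn : 64 * r * y ≤ n) :
    (Measure.pi fun _ : Fin n => ν) {x | ∃ v : ι → 𝕜, star v ⬝ᵥ v = 1 ∧
      ∑ i, ‖∑ a, star (v a) * φ (x i) a‖ ^ 2 ≤ 2 / 3 * (n : ℝ)} ≤
      ENNReal.ofReal (Fintype.card ι * Real.exp (-y)) := by
  obtain ⟨ψ, hψ, hae⟩ := exists_isFeatureMap (d := 1) hr.le hφ hbound (by simpa using hmom)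
  have hn0 : (0 : ℝ) < n := lt_of_lt_of_le (by positivity) hn
  rw [measure_pi_congr_feature hae fun z => ∃ v : ι → 𝕜, star v ⬝ᵥ v = 1 ∧
      ∑ i, ‖∑ a, star (v a) * z i a‖ ^ 2 ≤ 2 / 3 * (n : ℝ)]
  simp only [← quadForm_gramSum]
  refine (hψ.measure_exists_quadForm_le (t := 4 * n) (by positivity) (P := ⌈40 * y⌉₊)
    ((ceil_mul_div_le hr hy hn).trans (by norm_num)) (by positivity)).trans
    (ENNReal.ofReal_le_ofReal ?_)
  rw [Fintype.card_fin]
  exact mul_le_mul_of_nonneg_left (resolvent_ratio_pow_le hr hy hn) (Nat.cast_nonneg _)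

end TailBounds

end RKHSSampling

open MeasureTheory
open scoped ENNReal InnerProductSpace

namespace RKHSSampling

set_option linter.unusedSectionVars false

/-! ### Eigensystems and approximation numbers -/

section Eigenbasis

variable {𝕜 D H : Type*} [RCLike 𝕜] [MeasurableSpace D]
  [NormedAddCommGroup H] [InnerProductSpace 𝕜 H] [RKHS 𝕜 H D 𝕜] [CompleteSpace H]
  {μ : Measure D} {h : EmbedsInL2 μ H} {b : ℕ → H}

theorem coeFn_embedding (h : EmbedsInL2 μ H) (f : H) : ⇑(embedding h f) =ᵐ[μ] (⇑f : D → 𝕜) :=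
  (h.memLp f).coeFn_toLp

theorem enorm_embedding (h : EmbedsInL2 μ H) (f : H) :
    ‖embedding h f‖ₑ = eLpNorm (⇑f : D → 𝕜) 2 μ :=
  Lp.enorm_toLp (h.memLp f)

theorem embedding_injective (h : EmbedsInL2 μ H) : Function.Injective (embedding h) := by
  intro f g hfg
  refine h.eq_of_ae_eq f g ((coeFn_embedding h f).symm.trans ?_)
  rw [hfg]
  exact coeFn_embedding h g

theorem inner_opW_left (h : EmbedsInL2 μ H) (f g : H) :
    ⟪opW h f, g⟫_𝕜 = ⟪embedding h f, embedding h g⟫_𝕜 := by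
  rw [opW, ContinuousLinearMap.comp_apply, ContinuousLinearMap.adjoint_inner_left]

/-- The embedding preserves orthogonality to an eigenvector of `W`. -/
theorem inner_embedding_eq_zero {f g : H} (hf : ∃ t : 𝕜, opW h f = t • f) (hfg : ⟪f, g⟫_𝕜 = 0) :
    ⟪embedding h f, embedding h g⟫_𝕜 = 0 := by
  obtain ⟨t, ht⟩ := hf
  rw [← inner_opW_left, ht, inner_smul_left, hfg, mul_zero]

/-- An orthogonal family of eigenfunctions as in `IsEigenbasis`, without its completeness. -/
structure IsEigensystem (h : EmbedsInL2 μ H) (b : ℕ → H) : Prop where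
  eigen : ∀ j, ∃ t : 𝕜, opW h (b j) = t • b j
  orthogonal : ∀ i j, i ≠ j → ⟪b i, b j⟫_𝕜 = 0
  ne_zero_of_succ : ∀ j, b (j + 1) ≠ 0 → b j ≠ 0
  normalized : ∀ j, b j ≠ 0 → ‖embedding h (b j)‖ = 1
  norm_le_succ : ∀ j, b (j + 1) ≠ 0 → ‖b j‖ ≤ ‖b (j + 1)‖

theorem IsEigenbasis.eigensystem (hb : IsEigenbasis h b) : IsEigensystem h b where
  eigen := hb.eigen
  orthogonal := hb.orthogonal
  ne_zero_of_succ := hb.ne_zero_of_succ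
  normalized j hj := by
    have h1 := hb.normalized j hj
    rw [← enorm_embedding h] at h1
    rw [← toReal_enorm, h1, ENNReal.toReal_one]
  norm_le_succ := hb.norm_le_succ

namespace IsEigensystem

theorem eq_zero_of_le (hb : IsEigensystem h b) {i j : ℕ} (hij : i ≤ j) (hi : b i = 0) :
    b j = 0 := by
  induction j, hij using Nat.le_induction with
  | base => exact hi
  | succ j _ ih =>
    by_contra hj
    exact hb.ne_zero_of_succ j hj ih

theorem ne_zero_of_le (hb : IsEigensystem h b) {i j : ℕ} (hij : i ≤ j) (hj : b j ≠ 0) :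
    b i ≠ 0 := fun hi => hj (hb.eq_zero_of_le hij hi)

theorem norm_le_norm (hb : IsEigensystem h b) {i j : ℕ} (hij : i ≤ j) (hj : b j ≠ 0) :
    ‖b i‖ ≤ ‖b j‖ := by
  induction j, hij using Nat.le_induction with
  | base => exact le_rfl
  | succ j _ ih => exact (ih (hb.ne_zero_of_succ j hj)).trans (hb.norm_le_succ j hj)

theorem inner_embedding (hb : IsEigensystem h b) {i j : ℕ} (hij : i ≠ j) :
    ⟪embedding h (b i), embedding h (b j)⟫_𝕜 = 0 :=
  inner_embedding_eq_zero (hb.eigen i) (hb.orthogonal i j hij)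

theorem _root_.RKHSSampling.norm_sq_sum_smul_of_orthogonal {V : Type*} [NormedAddCommGroup V]
    [InnerProductSpace 𝕜 V] {u : ℕ → V} (hu : ∀ i j, i ≠ j → ⟪u i, u j⟫_𝕜 = 0) (s : Finset ℕ)
    (c : ℕ → 𝕜) : ‖∑ j ∈ s, c j • u j‖ ^ 2 = ∑ j ∈ s, ‖c j‖ ^ 2 * ‖u j‖ ^ 2 := by
  classical
  induction s using Finset.induction_on with
  | empty => simp
  | insert a s ha ih =>
    rw [Finset.sum_insert ha, Finset.sum_insert ha, ← ih, sq,
      norm_add_sq_eq_norm_sq_add_norm_sq_of_inner_eq_zero (𝕜 := 𝕜)]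
    · rw [norm_smul]; ring
    · rw [inner_smul_left, inner_sum, Finset.sum_eq_zero, mul_zero]
      intro j hj
      rw [inner_smul_right, hu a j (fun h => ha (h ▸ hj)), mul_zero]

theorem norm_sq_sum (hb : IsEigensystem h b) (s : Finset ℕ) (c : ℕ → 𝕜) :
    ‖∑ j ∈ s, c j • b j‖ ^ 2 = ∑ j ∈ s, ‖c j‖ ^ 2 * ‖b j‖ ^ 2 :=
  norm_sq_sum_smul_of_orthogonal hb.orthogonal s c

theorem norm_sq_embedding_sum (hb : IsEigensystem h b) (s : Finset ℕ) (c : ℕ → 𝕜)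
    (hc : ∀ j ∈ s, b j = 0 → c j = 0) :
    ‖embedding h (∑ j ∈ s, c j • b j)‖ ^ 2 = ∑ j ∈ s, ‖c j‖ ^ 2 := by
  simp only [map_sum, map_smul]
  rw [norm_sq_sum_smul_of_orthogonal (u := fun j => embedding h (b j))
    (fun i j hij => hb.inner_embedding hij) s c]
  refine Finset.sum_congr rfl fun j hj => ?_
  by_cases h0 : b j = 0
  · simp [hc j hj h0]
  · rw [hb.normalized j h0]
    ring

/-- Elements of the span of the basis, with coefficients that vanish where the basis does. -/
theorem _root_.RKHSSampling.exists_eq_sum_of_mem_span {f : H}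
    (hf : f ∈ Submodule.span 𝕜 (Set.range b)) (k : ℕ) :
    ∃ (N : ℕ) (c : ℕ → 𝕜), k ≤ N ∧ (∀ j, b j = 0 → c j = 0) ∧
      f = ∑ j ∈ Finset.range N, c j • b j := by
  classical
  obtain ⟨c, rfl⟩ := Finsupp.mem_span_range_iff_exists_finsupp.1 hf
  refine ⟨max k (c.support.sup id + 1), fun j => if b j = 0 then 0 else c j, le_max_left _ _,
    fun j hj => if_pos hj, ?_⟩
  rw [Finsupp.sum]
  refine (Finset.sum_subset (fun j hj => ?_) fun j _ hj => ?_).trans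
    (Finset.sum_congr rfl fun j _ => ?_)
  · rw [Finset.mem_range]
    exact lt_of_lt_of_le (Nat.lt_succ_of_le (Finset.le_sup (f := id) hj)) (le_max_right _ _)
  · rw [Finsupp.notMem_support_iff.1 hj, zero_smul]
  · by_cases h0 : b j = 0 <;> simp [h0]

theorem _root_.RKHSSampling.worstCaseError_eq (h : EmbedsInL2 μ H) {A : H → D → 𝕜}
    {B : H → Lp 𝕜 2 μ} (hAB : ∀ f, A f =ᵐ[μ] B f) :
    worstCaseError μ A = ⨆ (f : H) (_ : ‖f‖ ≤ 1), ‖embedding h f - B f‖ₑ := by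
  refine iSup_congr fun f => iSup_congr fun _ => ?_
  rw [Lp.enorm_def]
  refine eLpNorm_congr_ae ?_
  filter_upwards [Lp.coeFn_sub (embedding h f) (B f), coeFn_embedding h f, hAB f] with x h1 h2 h3
  rw [h1, Pi.sub_apply, h2, h3]

theorem _root_.RKHSSampling.coeFn_sum_smul {n : ℕ} (c : Fin n → 𝕜) (φ : Fin n → Lp 𝕜 2 μ) :
    (fun x => ∑ i, c i * φ i x) =ᵐ[μ] ⇑(∑ i, c i • φ i) := by
  have h1 : ∀ᵐ x ∂μ, ∀ i, (c i • φ i : Lp 𝕜 2 μ) x = c i * φ i x :=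
    ae_all_iff.2 fun i => by
      filter_upwards [Lp.coeFn_smul (c i) (φ i)] with x hx
      rw [hx, Pi.smul_apply, smul_eq_mul]
  filter_upwards [h1, Lp.coeFn_finsetSum Finset.univ fun i => c i • φ i] with x hx h2
  rw [h2, Finset.sum_apply]
  exact Finset.sum_congr rfl fun i _ => (hx i).symm

theorem _root_.RKHSSampling.approxNumber_eq (h : EmbedsInL2 μ H) (n : ℕ) :
    approxNumber μ H n = ⨅ (L : Fin n → H →L[𝕜] 𝕜) (φ : Fin n → Lp 𝕜 2 μ),
      ⨆ (f : H) (_ : ‖f‖ ≤ 1), ‖embedding h f - ∑ i, L i f • φ i‖ₑ :=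
  iInf_congr fun L => iInf_congr fun φ =>
    worstCaseError_eq h fun f => coeFn_sum_smul (fun i => L i f) φ

/-- The singular numbers of the embedding are at most its approximation numbers. -/
theorem inv_norm_le_approxNumber (hb : IsEigensystem h b) {j : ℕ} (hj : b j ≠ 0) :
    ENNReal.ofReal ‖b j‖⁻¹ ≤ approxNumber μ H j := by
  rw [approxNumber_eq h]
  refine le_iInf fun L => le_iInf fun φ => ?_
  -- On the span of b_0, …, b_j one has ‖f‖_H ≤ ‖b_j‖ ‖f‖_{L₂}. Its dimension is j + 1, so some
  -- nonzero f in it is annihilated by all j functionals, and the algorithm returns 0 for it.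
  let Λ : (Fin (j + 1) → 𝕜) →ₗ[𝕜] (Fin j → 𝕜) :=
    LinearMap.pi fun i => (L i).toLinearMap ∘ₗ Fintype.linearCombination 𝕜 fun l : Fin (j + 1) => b l
  obtain ⟨c, hc, hc0⟩ := Submodule.exists_mem_ne_zero_of_ne_bot
    (LinearMap.ker_ne_bot_of_finrank_lt (f := Λ) (by simp))
  set c' : ℕ → 𝕜 := fun l => if hl : l < j + 1 then c ⟨l, hl⟩ else 0 with hc'
  set f : H := ∑ l ∈ Finset.range (j + 1), c' l • b l with hf
  have hfc : f = Fintype.linearCombination 𝕜 (fun l : Fin (j + 1) => b l) c := by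
    rw [hf, Finset.sum_range, Fintype.linearCombination_apply]
    exact Finset.sum_congr rfl fun l _ => by
      rw [hc']
      simp only [l.2, dite_true]
  have hL : ∀ i, L i f = 0 := fun i => by
    rw [hfc]
    exact congrFun (LinearMap.mem_ker.1 hc) i
  have hbl : ∀ l ∈ Finset.range (j + 1), b l ≠ 0 := fun l hl =>
    hb.ne_zero_of_le (Nat.lt_succ_iff.1 (Finset.mem_range.1 hl)) hj
  have hE : ‖embedding h f‖ ^ 2 = ∑ l ∈ Finset.range (j + 1), ‖c' l‖ ^ 2 :=
    hb.norm_sq_embedding_sum _ _ fun l hl h0 => absurd h0 (hbl l hl)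
  have hN : ‖f‖ ^ 2 ≤ ‖embedding h f‖ ^ 2 * ‖b j‖ ^ 2 := by
    rw [hE, hf, hb.norm_sq_sum, Finset.sum_mul]
    refine Finset.sum_le_sum fun l hl => ?_
    have := hb.norm_le_norm (Nat.lt_succ_iff.1 (Finset.mem_range.1 hl)) hj
    gcongr
  have hf0 : f ≠ 0 := by
    intro h0
    obtain ⟨l, hl⟩ := Function.ne_iff.1 hc0
    rw [h0, map_zero, norm_zero, zero_pow two_ne_zero] at hE
    have := (Finset.sum_eq_zero_iff_of_nonneg fun _ _ => by positivity).1 hE.symm l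
      (Finset.mem_range.2 l.2)
    rw [hc'] at this
    simp only [l.2, dite_true] at this
    exact hl (by simpa using this)
  have hfn : 0 < ‖f‖ := norm_pos_iff.2 hf0
  have hbn : 0 < ‖b j‖ := norm_pos_iff.2 hj
  have hN2 : ‖f‖ ≤ ‖embedding h f‖ * ‖b j‖ := by
    refine le_of_sq_le_sq ?_ (by positivity)
    rw [mul_pow]
    exact hN
  set g : H := ((‖f‖⁻¹ : ℝ) : 𝕜) • f with hg
  have hgn : ‖g‖ ≤ 1 := by
    rw [hg, norm_smul, RCLike.norm_ofReal, abs_of_pos (by positivity), inv_mul_cancel₀ hfn.ne']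
  refine le_iSup₂_of_le g hgn ?_
  have hLg : ∀ i, L i g = 0 := fun i => by rw [hg, map_smul, hL, smul_zero]
  simp only [hLg, zero_smul, Finset.sum_const_zero, sub_zero]
  rw [← ofReal_norm]
  refine ENNReal.ofReal_le_ofReal ?_
  rw [hg, map_smul, norm_smul, RCLike.norm_ofReal, abs_of_pos (by positivity), inv_mul_eq_div,
    inv_eq_one_div, div_le_div_iff₀ hbn hfn, one_mul]
  exact hN2

end IsEigensystem

namespace IsEigenbasis

theorem dense_span (hb : IsEigenbasis h b) : Dense (Submodule.span 𝕜 (Set.range b) : Set H) :=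
  Submodule.dense_iff_topologicalClosure_eq_top.2 hb.complete

theorem zero_ne_zero [Nontrivial H] (hb : IsEigenbasis h b) : b 0 ≠ 0 := by
  intro h0
  have h1 : Set.range b ⊆ {0} := by
    rintro _ ⟨j, rfl⟩
    exact hb.eigensystem.eq_zero_of_le (Nat.zero_le j) h0
  have h2 : Submodule.span 𝕜 (Set.range b) = ⊥ := by
    rw [Submodule.span_eq_bot]
    exact fun x hx => h1 hx
  have h3 := hb.complete
  rw [h2, IsClosed.submodule_topologicalClosure_eq
    (Submodule.closed_of_finiteDimensional (⊥ : Submodule 𝕜 H))] at h3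
  exact bot_ne_top h3

/-- The orthogonal expansion in b_0, …, b_{j−1} is exact: it reproduces every basis function and is
continuous. -/
theorem approxNumber_eq_zero (hb : IsEigenbasis h b) {j : ℕ} (hj : b j = 0) :
    approxNumber μ H j = 0 := by
  rw [approxNumber_eq h, ← nonpos_iff_eq_zero]
  refine iInf₂_le_of_le (fun i : Fin j => ((‖b i‖ ^ 2)⁻¹ : 𝕜) • innerSL 𝕜 (b i))
    (fun i => embedding h (b i)) (iSup₂_le fun f _ => ?_)
  have key : ContinuousLinearMap.id 𝕜 H =
      ∑ i : Fin j, (((‖b i‖ ^ 2)⁻¹ : 𝕜) • innerSL 𝕜 (b i)).smulRight (b i) := by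
    refine ContinuousLinearMap.ext_on hb.dense_span ?_
    rintro _ ⟨l, rfl⟩
    rw [_root_.sum_apply]
    simp only [ContinuousLinearMap.smulRight_apply, _root_.smul_apply,
      innerSL_apply_apply, ContinuousLinearMap.id_apply, smul_eq_mul]
    by_cases h0 : b l = 0
    · simp [h0]
    · have hlj : l < j := by
        by_contra! hlj
        exact h0 (hb.eigensystem.eq_zero_of_le hlj hj)
      rw [Finset.sum_eq_single ⟨l, hlj⟩]
      · rw [inner_self_eq_norm_sq_to_K, inv_mul_cancel₀, one_smul]
        simpa using h0
      · intro i _ hi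
        rw [hb.orthogonal i l fun e => hi (Fin.ext e), mul_zero, zero_smul]
      · simp
  have hf := congrArg (fun T : H →L[𝕜] H => embedding h (T f)) key
  simp only [ContinuousLinearMap.id_apply, _root_.sum_apply, map_sum,
    ContinuousLinearMap.smulRight_apply, map_smul] at hf
  rw [← hf, sub_self, enorm_zero]

end IsEigenbasis

end Eigenbasis

end RKHSSampling

open MeasureTheory
open scoped ENNReal InnerProductSpace

namespace RKHSSampling

set_option linter.unusedSectionVars false

/-! ### Existence of the eigenbasis by greedy maximization -/

section Existence

variable {𝕜 D H : Type*} [RCLike 𝕜] [MeasurableSpace D]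
  [NormedAddCommGroup H] [InnerProductSpace 𝕜 H] [RKHS 𝕜 H D 𝕜] [CompleteSpace H]
  {μ : Measure D} (h : EmbedsInL2 μ H)

theorem exists_approxNumber_lt (hsum : ∑' j : ℕ, approxNumber μ H j ^ 2 ≠ ∞) {ε : ℝ≥0∞}
    (hε : ε ≠ 0) : ∃ N, ∀ n ≥ N, approxNumber μ H n < ε := by
  have h1 := ENNReal.tendsto_atTop_zero_of_tsum_ne_top hsum
  have h2 : ∀ᶠ n in Filter.atTop, approxNumber μ H n ^ 2 < ε ^ 2 :=
    h1.eventually (gt_mem_nhds (by positivity))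
  obtain ⟨N, hN⟩ := Filter.eventually_atTop.1 h2
  refine ⟨N, fun n hn => ?_⟩
  by_contra! hcon
  exact absurd (hN n hn) (not_lt.2 (pow_le_pow_left₀ zero_le hcon 2))

/-- The embedding is compact as a limit of operators of finite rank. -/
theorem isCompactOperator_embedding (hsum : ∑' j : ℕ, approxNumber μ H j ^ 2 ≠ ∞) :
    IsCompactOperator (embedding h) := by
  have hcl := isClosed_setOfPred_isCompactOperator (σ₁₂ := RingHom.id 𝕜) (M₁ := H) (M₂ := Lp 𝕜 2 μ)
  refine hcl.closure_subset (Metric.mem_closure_iff.2 fun ε hε => ?_)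
  obtain ⟨N, hN⟩ := exists_approxNumber_lt (H := H) hsum
    (ε := ENNReal.ofReal (ε / 2)) (by simpa using hε)
  have hN := hN N le_rfl
  rw [approxNumber_eq h] at hN
  obtain ⟨L, hL⟩ := iInf_lt_iff.1 hN
  obtain ⟨φ, hφ⟩ := iInf_lt_iff.1 hL
  have hrank1 : ∀ i, (L i).smulRight (φ i) ∈ compactOperator (RingHom.id 𝕜) H (Lp 𝕜 2 μ) := by
    intro i
    have : IsCompactOperator (ContinuousLinearMap.toSpanSingleton 𝕜 (φ i)) :=
      isCompactOperator_of_locallyCompactSpace_rng _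
    exact this.comp_clm (L i)
  refine ⟨∑ i, (L i).smulRight (φ i), Submodule.sum_mem _ fun i _ => hrank1 i, ?_⟩
  rw [dist_eq_norm]
  refine lt_of_le_of_lt (ContinuousLinearMap.opNorm_le_of_unit_norm (𝕜 := 𝕜) (C := ε / 2) (by positivity) fun f hf => ?_)
    (half_lt_self hε)
  have h1 := (le_iSup₂ (f := fun (f : H) (_ : ‖f‖ ≤ 1) =>
    ‖embedding h f - ∑ i, L i f • φ i‖ₑ) f hf.le).trans hφ.le
  rw [← ofReal_norm, ENNReal.ofReal_le_ofReal_iff (by positivity)] at h1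
  simpa using h1

theorem isSymmetric_opW : (opW h : H →ₗ[𝕜] H).IsSymmetric := fun f g => by
  have := inner_opW_left h f g
  have h2 := inner_opW_left h g f
  rw [ContinuousLinearMap.coe_coe, this, ← inner_conj_symm f, h2, inner_conj_symm]

/-- On every closed subspace that is invariant under `W`, the largest value of `‖f‖_{L₂} / ‖f‖_H`
is attained at an eigenvector of `W`. -/
theorem exists_maximal_eigenvector (hsum : ∑' j : ℕ, approxNumber μ H j ^ 2 ≠ ∞)
    (K : Submodule 𝕜 H) [CompleteSpace K] (hK : ∀ f ∈ K, opW h f ∈ K) (hK0 : K ≠ ⊥) :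
    ∃ v ∈ K, (∃ t : 𝕜, opW h v = t • v) ∧ ‖embedding h v‖ = 1 ∧
      ∀ f ∈ K, ‖embedding h f‖ * ‖v‖ ≤ ‖f‖ := by
  have hcpt : IsCompactOperator (opW h) :=
    (isCompactOperator_embedding h hsum).clm_comp (embedding h).adjoint
  have : Nontrivial K := (Submodule.nontrivial_iff_ne_bot).2 hK0
  let T : K →L[𝕜] K := (opW h).restrict hK
  have hT : IsCompactOperator T := hcpt.restrict' hK
  have hTs : T.IsSymmetric := (isSymmetric_opW h).restrict_invariant hK
  have hinner : ∀ f : K, ⟪T f, f⟫_𝕜 = ((‖embedding h f‖ ^ 2 : ℝ) : 𝕜) := by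
    intro f
    have := inner_opW_left h (f : H) f
    rw [inner_self_eq_norm_sq_to_K] at this
    rw [RCLike.ofReal_pow, ← this]
    rfl
  have hle : ∀ f : K, ‖embedding h f‖ ^ 2 ≤ ‖T‖ * ‖f‖ ^ 2 := by
    intro f
    have h1 : ‖embedding h f‖ ^ 2 = ‖⟪T f, f⟫_𝕜‖ := by
      rw [hinner, RCLike.norm_ofReal, abs_of_nonneg (by positivity)]
    rw [h1]
    refine (norm_inner_le_norm _ _).trans ?_
    rw [sq, ← mul_assoc]
    exact mul_le_mul_of_nonneg_right (T.le_opNorm f) (norm_nonneg _)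
  have hT0 : 0 < ‖T‖ := by
    obtain ⟨f, hf⟩ := exists_ne (0 : K)
    have : 0 < ‖embedding h f‖ := norm_pos_iff.2 fun h0 => hf (by
      have := embedding_injective h (h0.trans (map_zero (embedding h)).symm)
      exact_mod_cast this)
    by_contra! hcon
    have := hle f
    nlinarith [sq_nonneg ‖f‖, pow_pos ‹0 < ‖embedding h f‖› 2]
  -- The norm of a symmetric operator is the supremum of its absolute Rayleigh quotients, which are
  -- nonnegative for T. If ‖T‖ were in the resolvent set, they would stay away from ‖T‖. Compactness
  -- then turns the spectral value into an eigenvalue.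
  have hspec : algebraMap ℝ 𝕜 ‖T‖ ∈ spectrum 𝕜 T := by
    by_contra hns
    obtain ⟨ε, hε, hlt⟩ := T.rayleighQuotient_le_of_norm_mem_resolventSet (by
      simpa [spectrum] using hns)
    have h1 := T.norm_eq_iSup_rayleighQuotient hTs
    have h2 : ⨆ x, |T.rayleighQuotient x| ≤ ‖T‖ - ε := by
      refine ciSup_le fun x => ?_
      rw [abs_of_nonneg]
      · exact hlt x
      · rw [ContinuousLinearMap.rayleighQuotient, ContinuousLinearMap.reApplyInnerSelf_apply,
          hinner, RCLike.ofReal_re]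
        positivity
    linarith
  have hne : algebraMap ℝ 𝕜 ‖T‖ ≠ 0 := by simpa using hT0.ne'
  obtain ⟨u, hu⟩ := ((hT.hasEigenvalue_iff_mem_spectrum hne).2 hspec).exists_hasEigenvector
  have hTu : T u = ((‖T‖ : ℝ) : 𝕜) • u := hu.apply_eq_smul
  have hu0 : (u : H) ≠ 0 := by exact_mod_cast hu.2
  have hun : 0 < ‖(u : H)‖ := norm_pos_iff.2 hu0
  have hEu : ‖embedding h u‖ ^ 2 = ‖T‖ * ‖(u : H)‖ ^ 2 := by
    have h1 := hinner u
    rw [hTu, inner_smul_left, inner_self_eq_norm_sq_to_K, RCLike.conj_ofReal] at h1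
    exact_mod_cast h1.symm
  have hEu0 : 0 < ‖embedding h u‖ := by
    by_contra! hcon
    have : ‖embedding h u‖ = 0 := le_antisymm hcon (norm_nonneg _)
    rw [this, zero_pow two_ne_zero] at hEu
    have : 0 < ‖T‖ * ‖(u : H)‖ ^ 2 := by positivity
    linarith
  have hWu : opW h u = ((‖T‖ : ℝ) : 𝕜) • (u : H) := congrArg Subtype.val hTu
  refine ⟨((‖embedding h u‖⁻¹ : ℝ) : 𝕜) • (u : H), K.smul_mem _ u.2, ⟨((‖T‖ : ℝ) : 𝕜), ?_⟩, ?_,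
    fun f hf => ?_⟩
  · rw [map_smul, hWu, smul_comm]
  · rw [map_smul, norm_smul, RCLike.norm_ofReal, abs_of_pos (by positivity),
      inv_mul_cancel₀ hEu0.ne']
  · rw [norm_smul, RCLike.norm_ofReal, abs_of_pos (by positivity), inv_mul_eq_div, mul_div_assoc',
      div_le_iff₀ hEu0]
    refine le_of_sq_le_sq ?_ (by positivity)
    rw [mul_pow, mul_pow, hEu]
    have := hle ⟨f, hf⟩
    have h3 : ‖embedding h f‖ ^ 2 ≤ ‖T‖ * ‖f‖ ^ 2 := this
    nlinarith [sq_nonneg ‖(u : H)‖]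

open Classical in
/-- The next basis function of the greedy construction, orthogonal to `V`; it is zero if there is
none. -/
noncomputable def greedyVector (V : Submodule 𝕜 H) : H :=
  if hv : ∃ v ∈ Vᗮ, (∃ t : 𝕜, opW h v = t • v) ∧ ‖embedding h v‖ = 1 ∧
    ∀ f ∈ Vᗮ, ‖embedding h f‖ * ‖v‖ ≤ ‖f‖ then hv.choose else 0

/-- The spans of the greedily constructed basis functions. -/
noncomputable def greedySpan : ℕ → Submodule 𝕜 H
  | 0 => ⊥
  | n + 1 => greedySpan n ⊔ Submodule.span 𝕜 {greedyVector h (greedySpan n)}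

theorem greedyVector_mem_orthogonal (V : Submodule 𝕜 H) : greedyVector h V ∈ Vᗮ := by
  rw [greedyVector]
  split_ifs with hv
  · exact hv.choose_spec.1
  · exact zero_mem _

theorem greedyVector_eigen (V : Submodule 𝕜 H) :
    ∃ t : 𝕜, opW h (greedyVector h V) = t • greedyVector h V := by
  rw [greedyVector]
  split_ifs with hv
  · exact hv.choose_spec.2.1
  · exact ⟨0, by simp⟩

theorem greedyVector_spec {V : Submodule 𝕜 H} (hV : greedyVector h V ≠ 0) :
    ‖embedding h (greedyVector h V)‖ = 1 ∧
      ∀ f ∈ Vᗮ, ‖embedding h f‖ * ‖greedyVector h V‖ ≤ ‖f‖ := by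
  rw [greedyVector] at hV ⊢
  split_ifs at hV ⊢ with hv
  · exact hv.choose_spec.2.2
  · exact absurd rfl hV

theorem greedyVector_ne_zero (hsum : ∑' j : ℕ, approxNumber μ H j ^ 2 ≠ ∞)
    {V : Submodule 𝕜 H} (hV : ∀ f ∈ V, opW h f ∈ V) (hV0 : Vᗮ ≠ ⊥) : greedyVector h V ≠ 0 := by
  have hinv : ∀ f ∈ Vᗮ, opW h f ∈ Vᗮ := fun f hf g hg => by
    have := isSymmetric_opW h g f
    rw [ContinuousLinearMap.coe_coe] at this
    rw [← this]
    exact hf _ (hV g hg)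
  have hv := exists_maximal_eigenvector h hsum Vᗮ hinv hV0
  rw [greedyVector, dif_pos hv]
  intro h0
  have := hv.choose_spec.2.2.1
  rw [h0, map_zero, norm_zero] at this
  exact zero_ne_one this

theorem greedySpan_mono : Monotone (greedySpan h) :=
  monotone_nat_of_le_succ fun _ => le_sup_left

theorem greedyVector_mem_greedySpan {i n : ℕ} (hin : i < n) :
    greedyVector h (greedySpan h i) ∈ greedySpan h n :=
  greedySpan_mono h hin
    (Submodule.mem_sup_right (Submodule.mem_span_singleton_self _))

theorem opW_mem_greedySpan (n : ℕ) : ∀ f ∈ greedySpan h n, opW h f ∈ greedySpan h n := by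
  induction n with
  | zero =>
    intro f hf
    rw [greedySpan, Submodule.mem_bot] at hf
    rw [hf, map_zero]
    exact zero_mem _
  | succ n ih =>
    intro f hf
    obtain ⟨g, hg, v, hv, rfl⟩ := Submodule.mem_sup.1 hf
    obtain ⟨c, rfl⟩ := Submodule.mem_span_singleton.1 hv
    obtain ⟨t, ht⟩ := greedyVector_eigen h (greedySpan h n)
    rw [map_add, map_smul, ht]
    exact Submodule.add_mem_sup (ih g hg) (Submodule.smul_mem _ _
      (Submodule.smul_mem _ _ (Submodule.mem_span_singleton_self _)))

theorem isEigensystem_greedy (hsum : ∑' j : ℕ, approxNumber μ H j ^ 2 ≠ ∞) :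
    IsEigensystem h fun n => greedyVector h (greedySpan h n) where
  eigen j := greedyVector_eigen h _
  orthogonal := by
    have key : ∀ i j, i < j →
        ⟪greedyVector h (greedySpan h i), greedyVector h (greedySpan h j)⟫_𝕜 = 0 := fun i j hij =>
      greedyVector_mem_orthogonal h (greedySpan h j) _ (greedyVector_mem_greedySpan h hij)
    intro i j hij
    rcases lt_or_gt_of_ne hij with hij | hij
    · exact key i j hij
    · exact inner_eq_zero_symm.1 (key j i hij)
  ne_zero_of_succ j hj := by
    refine greedyVector_ne_zero h hsum (opW_mem_greedySpan h j) fun h0 => hj ?_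
    have h1 := Submodule.orthogonal_le (greedySpan_mono h (Nat.le_succ j))
      (greedyVector_mem_orthogonal h (greedySpan h (j + 1)))
    rw [h0] at h1
    exact (Submodule.mem_bot 𝕜).1 h1
  normalized j hj := (greedyVector_spec h hj).1
  norm_le_succ j hj := by
    -- The complements shrink, so b (j + 1) was already a competitor when b j was chosen as a
    -- maximizer.
    have h1 := Submodule.orthogonal_le (greedySpan_mono h (Nat.le_succ j))
      (greedyVector_mem_orthogonal h (greedySpan h (j + 1)))
    by_cases h0 : greedyVector h (greedySpan h j) = 0
    · rw [h0, norm_zero]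
      exact norm_nonneg _
    · have := (greedyVector_spec h h0).2 _ h1
      rwa [(greedyVector_spec h hj).1, one_mul] at this

theorem greedySpan_le_span (n : ℕ) : greedySpan h n ≤
    Submodule.span 𝕜 (Set.range fun n => greedyVector h (greedySpan h n)) := by
  induction n with
  | zero => exact bot_le
  | succ n ih =>
    refine sup_le ih (Submodule.span_mono ?_)
    rintro _ rfl
    exact ⟨n, rfl⟩

theorem exists_isEigenbasis (hsum : ∑' j : ℕ, approxNumber μ H j ^ 2 ≠ ∞) :
    ∃ b : ℕ → H, IsEigenbasis h b := by
  have hes := isEigensystem_greedy h hsum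
  set b : ℕ → H := fun n => greedyVector h (greedySpan h n) with hb
  refine ⟨b, hes.eigen, hes.orthogonal, ?_, hes.ne_zero_of_succ, fun j hj => ?_, hes.norm_le_succ⟩
  · rw [Submodule.topologicalClosure_eq_top_iff, Submodule.eq_bot_iff]
    intro f hf
    have hfV : ∀ n, f ∈ (greedySpan h n)ᗮ := fun n =>
      Submodule.orthogonal_le (greedySpan_le_span h n) hf
    -- For such f ≠ 0 the construction never stops, and maximality gives 1/‖b_N‖ ≥ ‖f‖_{L₂}/‖f‖_H
    -- for all N, contradicting 1/‖b_N‖ ≤ a_N → 0.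
    by_contra hf0
    have hne : ∀ n, b n ≠ 0 := fun n =>
      greedyVector_ne_zero h hsum (opW_mem_greedySpan h n)
        ((Submodule.ne_bot_iff _).2 ⟨f, hfV n, hf0⟩)
    have hfn : 0 < ‖f‖ := norm_pos_iff.2 hf0
    have hEf : 0 < ‖embedding h f‖ := norm_pos_iff.2 fun h0 =>
      hf0 (embedding_injective h (h0.trans (map_zero _).symm))
    obtain ⟨N, hN⟩ := exists_approxNumber_lt (H := H) hsum
      (ε := ENNReal.ofReal (‖embedding h f‖ / ‖f‖)) (by
        rw [ne_eq, ENNReal.ofReal_eq_zero, not_le]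
        positivity)
    have h1 := (hes.inv_norm_le_approxNumber (hne N)).trans_lt (hN N le_rfl)
    rw [ENNReal.ofReal_lt_ofReal_iff (by positivity)] at h1
    have hbN : 0 < ‖b N‖ := norm_pos_iff.2 (hne N)
    have h2 : ‖embedding h f‖ * ‖b N‖ ≤ ‖f‖ := (greedyVector_spec h (hne N)).2 f (hfV N)
    rw [inv_eq_one_div, div_lt_div_iff₀ hbN hfn, one_mul] at h1
    linarith
  · rw [← enorm_embedding h, ← ofReal_norm, hes.normalized j hj, ENNReal.ofReal_one]

end Existence

end RKHSSampling

open MeasureTheory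
open scoped ENNReal InnerProductSpace

namespace RKHSSampling

set_option linter.unusedSectionVars false

/-! ### The sampling density and the rescaled basis -/

section Density

variable {𝕜 D H : Type*} [RCLike 𝕜] [MeasurableSpace D]
  [NormedAddCommGroup H] [InnerProductSpace 𝕜 H] [RKHS 𝕜 H D 𝕜] [CompleteSpace H]
  {μ : Measure D} {h : EmbedsInL2 μ H} {b : ℕ → H} {k : ℕ}

theorem sum_range_add_tsum_eq_tsum (f : ℕ → ℝ≥0∞) (k : ℕ) :
    ∑ j ∈ Finset.range k, f j + ∑' j, f (k + j) = ∑' j, f j := by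
  simp only [add_comm k]
  exact ENNReal.summable.sum_add_tsum_nat_add'

theorem tailSum_ne_top (hsum : ∑' j : ℕ, approxNumber μ H j ^ 2 ≠ ∞) (k : ℕ) :
    tailSum μ H k ≠ ∞ := by
  refine ne_top_of_le_ne_top hsum ?_
  rw [← sum_range_add_tsum_eq_tsum (fun j => approxNumber μ H j ^ 2) k]
  exact le_add_self

namespace IsEigenbasis

/-- With `ne_zero_of_tailSum_ne_zero` this shows that T = 0 exactly when b k = 0, so the case
distinction in the density detects dim H ≤ k. -/
theorem eq_zero_of_tailSum_eq_zero (hb : IsEigenbasis h b) (hT : tailSum μ H k = 0) {j : ℕ}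
    (hj : k ≤ j) : b j = 0 := by
  by_contra h0
  have h1 := ENNReal.tsum_eq_zero.1 hT (j - k)
  rw [Nat.add_sub_cancel' hj] at h1
  have h2 := hb.eigensystem.inv_norm_le_approxNumber h0
  rw [pow_eq_zero_iff two_ne_zero |>.1 h1, nonpos_iff_eq_zero, ENNReal.ofReal_eq_zero] at h2
  have : 0 < ‖b j‖⁻¹ := inv_pos.2 (norm_pos_iff.2 h0)
  linarith

theorem ne_zero_of_tailSum_ne_zero (hb : IsEigenbasis h b) (hT : tailSum μ H k ≠ 0) {j : ℕ}
    (hj : j ≤ k) : b j ≠ 0 := by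
  intro h0
  refine hT (ENNReal.tsum_eq_zero.2 fun i => ?_)
  rw [hb.approxNumber_eq_zero (hb.eigensystem.eq_zero_of_le (by omega) h0), zero_pow two_ne_zero]

/-- The dimension of `V_k` is the number of nonzero functions among the first `k`. -/
theorem exists_dim (hb : IsEigenbasis h b) [Nontrivial H] (hk : 0 < k) :
    ∃ m, 0 < m ∧ m ≤ k ∧ Module.finrank 𝕜 (spanFirst 𝕜 b k) = m ∧ (∀ j < m, b j ≠ 0) ∧
      (∀ j, m ≤ j → j < k → b j = 0) ∧
      spanFirst 𝕜 b k = Submodule.span 𝕜 (Set.range fun j : Fin m => b j) := by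
  classical
  have hex : ∃ j, k ≤ j ∨ b j = 0 := ⟨k, Or.inl le_rfl⟩
  set m := Nat.find hex with hm
  have hmk : m ≤ k := Nat.find_min' hex (Or.inl le_rfl)
  have hne : ∀ j < m, b j ≠ 0 := fun j hj h0 => Nat.find_min hex hj (Or.inr h0)
  have hz : ∀ j, m ≤ j → j < k → b j = 0 := fun j hmj hjk => by
    rcases Nat.find_spec hex with h1 | h1
    · omega
    · exact hb.eigensystem.eq_zero_of_le hmj h1
  have hspan : spanFirst 𝕜 b k = Submodule.span 𝕜 (Set.range fun j : Fin m => b j) := by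
    refine le_antisymm (Submodule.span_le.2 ?_) (Submodule.span_mono ?_)
    · rintro _ ⟨j, hj, rfl⟩
      rcases lt_or_ge j m with h1 | h1
      · exact Submodule.subset_span ⟨⟨j, h1⟩, rfl⟩
      · rw [hz j h1 hj]
        exact zero_mem _
    · rintro _ ⟨j, rfl⟩
      exact ⟨j, lt_of_lt_of_le j.2 hmk, rfl⟩
  refine ⟨m, ?_, hmk, ?_, hne, hz, hspan⟩
  · rw [Nat.pos_iff_ne_zero]
    intro h0
    rcases Nat.find_spec hex with h1 | h1
    · omega
    · rw [← hm, h0] at h1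
      exact hb.zero_ne_zero h1
  · rw [hspan, finrank_span_eq_card, Fintype.card_fin]
    exact linearIndependent_of_ne_zero_of_inner_eq_zero (fun j => hne j j.2)
      fun i j hij => hb.orthogonal i j fun e => hij (Fin.ext e)

open Classical in
theorem lintegral_enorm_sq (hb : IsEigenbasis h b) (j : ℕ) :
    ∫⁻ x, ‖b j x‖ₑ ^ 2 ∂μ = if b j = 0 then 0 else 1 := by
  split_ifs with h0
  · simp [h0]
  · have h1 := eLpNorm_nnreal_pow_eq_lintegral (μ := μ) (f := (⇑(b j) : D → 𝕜)) (p := 2)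
      two_ne_zero
    rw [ENNReal.coe_ofNat, hb.normalized j h0] at h1
    simpa using h1.symm

theorem _root_.RKHSSampling.aemeasurable_enorm_sq (h : EmbedsInL2 μ H) (f : H) :
    AEMeasurable (fun x => ‖f x‖ₑ ^ 2) μ :=
  (h.memLp f).1.enorm.pow_const 2

theorem _root_.RKHSSampling.aemeasurable_density (h : EmbedsInL2 μ H) (b : ℕ → H) (k : ℕ) :
    AEMeasurable (density μ b k) μ := by
  have h1 : AEMeasurable (fun x => ∑ j ∈ Finset.range k, ‖b j x‖ₑ ^ 2) μ :=
    Finset.aemeasurable_fun_sum _ fun j _ => aemeasurable_enorm_sq h (b j)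
  have h2 : AEMeasurable
      (fun x => ∑' j : ℕ, approxNumber μ H (k + j) ^ 2 * ‖b (k + j) x‖ₑ ^ 2) μ :=
    AEMeasurable.tsum fun j => (aemeasurable_enorm_sq h (b (k + j))).const_mul _
  unfold density
  split_ifs
  · exact h1.const_mul _
  · exact ((h1.const_mul _).add (h2.const_mul _)).const_mul _

theorem lintegral_density (hb : IsEigenbasis h b) [Nontrivial H]
    (hsum : ∑' j : ℕ, approxNumber μ H j ^ 2 ≠ ∞) (hk : 0 < k) :
    ∫⁻ x, density μ b k x ∂μ = 1 := by
  classical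
  have hA : ∀ m ≤ k, (∀ j < m, b j ≠ 0) → (∀ j, m ≤ j → j < k → b j = 0) →
      ∫⁻ x, ∑ j ∈ Finset.range k, ‖b j x‖ₑ ^ 2 ∂μ = m := by
    intro m hmk hne hz
    rw [lintegral_finsetSum' _ fun j _ => aemeasurable_enorm_sq h (b j)]
    simp only [hb.lintegral_enorm_sq]
    rw [← Finset.sum_subset (f := fun j => if b j = 0 then (0 : ℝ≥0∞) else 1)
      (Finset.range_subset_range.2 hmk)]
    · rw [Finset.sum_congr rfl fun j hj => if_neg (hne j (Finset.mem_range.1 hj))]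
      simp
    · intro j hj hjm
      exact if_pos (hz j (not_lt.1 fun hlt => hjm (Finset.mem_range.2 hlt)) (Finset.mem_range.1 hj))
  have hAm : AEMeasurable (fun x => ∑ j ∈ Finset.range k, ‖b j x‖ₑ ^ 2) μ :=
    Finset.aemeasurable_fun_sum _ fun j _ => aemeasurable_enorm_sq h (b j)
  have hBm : ∀ j, AEMeasurable
      (fun x => approxNumber μ H (k + j) ^ 2 * ‖b (k + j) x‖ₑ ^ 2) μ :=
    fun j => (aemeasurable_enorm_sq h (b (k + j))).const_mul _
  by_cases hT : tailSum μ H k = 0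
  · obtain ⟨m, hm0, hmk, hfin, hne, hz, -⟩ := hb.exists_dim hk
    simp only [density, if_pos hT, hfin]
    rw [lintegral_const_mul'' _ hAm, hA m hmk hne hz]
    exact ENNReal.inv_mul_cancel (by exact_mod_cast hm0.ne') (ENNReal.natCast_ne_top m)
  · simp only [density, if_neg hT]
    have hB : ∫⁻ x, ∑' j : ℕ, approxNumber μ H (k + j) ^ 2 * ‖b (k + j) x‖ₑ ^ 2 ∂μ =
        tailSum μ H k := by
      rw [lintegral_tsum hBm]
      refine tsum_congr fun j => ?_
      rw [lintegral_const_mul'' _ (aemeasurable_enorm_sq h _), hb.lintegral_enorm_sq]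
      split_ifs with h0
      · rw [hb.approxNumber_eq_zero h0]
        simp
      · rw [mul_one]
    have hsumm : AEMeasurable (fun x => (k : ℝ≥0∞)⁻¹ * ∑ j ∈ Finset.range k, ‖b j x‖ₑ ^ 2 +
        (tailSum μ H k)⁻¹ * ∑' j : ℕ, approxNumber μ H (k + j) ^ 2 * ‖b (k + j) x‖ₑ ^ 2) μ :=
      (hAm.const_mul _).add ((AEMeasurable.tsum hBm).const_mul _)
    rw [lintegral_const_mul'' _ hsumm, lintegral_add_left' (hAm.const_mul _),
      lintegral_const_mul'' _ hAm,
      lintegral_const_mul'' _ (AEMeasurable.tsum hBm), hB,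
      hA k le_rfl (fun j hj => hb.ne_zero_of_tailSum_ne_zero hT hj.le) (fun j h1 h2 => by omega),
      ENNReal.inv_mul_cancel (by exact_mod_cast hk.ne') (ENNReal.natCast_ne_top k),
      ENNReal.inv_mul_cancel hT (tailSum_ne_top hsum k), one_add_one_eq_two]
    exact ENNReal.inv_mul_cancel two_ne_zero ENNReal.ofNat_ne_top

theorem isProbabilityMeasure (hb : IsEigenbasis h b) [Nontrivial H]
    (hsum : ∑' j : ℕ, approxNumber μ H j ^ 2 ≠ ∞) (hk : 0 < k) :
    IsProbabilityMeasure (μ.withDensity (density μ b k)) :=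
  ⟨by rw [withDensity_apply _ MeasurableSet.univ, Measure.restrict_univ,
    hb.lintegral_density hsum hk]⟩

end IsEigenbasis

/-- The scale that relates the `H`-norm of the part orthogonal to `V_k` to the `L₂`-norm on
`V_k`. -/
noncomputable def tailScale (μ : Measure D) (b : ℕ → H) (k : ℕ) : ℝ :=
  if tailSum μ H k = 0 then 1 else (‖b k‖ ^ 2)⁻¹ + (tailSum μ H k).toReal / k

/-- The factors by which the basis functions are rescaled. -/
noncomputable def basisWeight (μ : Measure D) (b : ℕ → H) (k j : ℕ) : ℝ :=
  if j < k then 1 else (√(tailScale μ b k) * ‖b j‖)⁻¹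

namespace IsEigenbasis

theorem tailScale_pos (hb : IsEigenbasis h b) : 0 < tailScale μ b k := by
  unfold tailScale
  split_ifs with hT
  · exact one_pos
  · have : 0 < ‖b k‖ := norm_pos_iff.2 (hb.ne_zero_of_tailSum_ne_zero hT le_rfl)
    positivity

theorem basisWeight_pos (hb : IsEigenbasis h b) {j : ℕ} (hj : b j ≠ 0) :
    0 < basisWeight μ b k j := by
  have h1 := hb.tailScale_pos (k := k)
  have h2 : 0 < ‖b j‖ := norm_pos_iff.2 hj
  unfold basisWeight
  split_ifs <;> positivity

theorem basisWeight_sq (hb : IsEigenbasis h b) {j : ℕ} (hj : k ≤ j) :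
    basisWeight μ b k j ^ 2 = (tailScale μ b k)⁻¹ * (‖b j‖ ^ 2)⁻¹ := by
  rw [basisWeight, if_neg (not_lt.2 hj), inv_pow, mul_pow, Real.sq_sqrt hb.tailScale_pos.le,
    mul_inv]

/-- For j ≥ k this is what the summand ‖b_k‖⁻² of `tailScale` is for, by monotonicity of the norms.
-/
theorem basisWeight_sq_le_one (hb : IsEigenbasis h b) {j : ℕ} (hj : b j ≠ 0) :
    basisWeight μ b k j ^ 2 ≤ 1 := by
  rcases lt_or_ge j k with hjk | hjk
  · rw [basisWeight, if_pos hjk, one_pow]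
  · have hT : tailSum μ H k ≠ 0 := fun hT => hj (hb.eq_zero_of_tailSum_eq_zero hT hjk)
    have hbk : 0 < ‖b k‖ := norm_pos_iff.2 (hb.ne_zero_of_tailSum_ne_zero hT le_rfl)
    have hle := hb.eigensystem.norm_le_norm hjk hj
    have hbj : 0 < ‖b j‖ := lt_of_lt_of_le hbk hle
    rw [hb.basisWeight_sq hjk, ← mul_inv]
    refine inv_le_one_of_one_le₀ ?_
    rw [← div_le_iff₀ (by positivity), one_div, tailScale, if_neg hT]
    have : (‖b j‖ ^ 2)⁻¹ ≤ (‖b k‖ ^ 2)⁻¹ := by gcongr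
    have : 0 ≤ (tailSum μ H k).toReal / k := by positivity
    linarith

/-- This is what the summand T/k of `tailScale` is for; it is combined with ‖b_j‖⁻¹ ≤ a_j. -/
theorem ofReal_basisWeight_sq_le (hb : IsEigenbasis h b)
    (hsum : ∑' j : ℕ, approxNumber μ H j ^ 2 ≠ ∞) (hk : 0 < k) (hT : tailSum μ H k ≠ 0) {j : ℕ}
    (hjk : k ≤ j) (hj : b j ≠ 0) :
    ENNReal.ofReal (basisWeight μ b k j ^ 2) ≤
      k * ((tailSum μ H k)⁻¹ * approxNumber μ H j ^ 2) := by
  have hTt := tailSum_ne_top hsum k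
  have hT0 : 0 < (tailSum μ H k).toReal := ENNReal.toReal_pos hT hTt
  have hk0 : (0 : ℝ) < k := by exact_mod_cast hk
  have hbj : 0 < ‖b j‖ := norm_pos_iff.2 hj
  have h1 : basisWeight μ b k j ^ 2 ≤ k * ((tailSum μ H k).toReal⁻¹ * (‖b j‖⁻¹) ^ 2) := by
    rw [hb.basisWeight_sq hjk, inv_pow, ← mul_assoc]
    refine mul_le_mul_of_nonneg_right ?_ (by positivity)
    rw [inv_le_comm₀ hb.tailScale_pos (by positivity), mul_inv, inv_inv, tailScale, if_neg hT,
      ← div_eq_inv_mul]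
    have : 0 ≤ (‖b k‖ ^ 2)⁻¹ := by positivity
    linarith
  refine (ENNReal.ofReal_le_ofReal h1).trans ?_
  rw [ENNReal.ofReal_mul hk0.le, ENNReal.ofReal_mul (by positivity), ENNReal.ofReal_natCast,
    ENNReal.ofReal_inv_of_pos hT0, ENNReal.ofReal_toReal hTt, ENNReal.ofReal_pow (by positivity)]
  have := hb.eigensystem.inv_norm_le_approxNumber hj
  gcongr

/-- The two halves of the density control the functions inside and outside V_k. If T = 0, the sum is
m·ϱ_k with m = dim V_k ≤ k. -/
theorem sum_basisWeight_le_density (hb : IsEigenbasis h b) [Nontrivial H]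
    (hsum : ∑' j : ℕ, approxNumber μ H j ^ 2 ≠ ∞) (hk : 0 < k) (N : ℕ) (y : D) :
    ∑ j ∈ Finset.range N, ENNReal.ofReal (basisWeight μ b k j ^ 2) * ‖b j y‖ₑ ^ 2 ≤
      2 * k * density μ b k y := by
  have hk0 : (k : ℝ≥0∞) ≠ 0 := by exact_mod_cast hk.ne'
  have hkt : (k : ℝ≥0∞) ≠ ∞ := ENNReal.natCast_ne_top k
  refine (ENNReal.sum_le_tsum _).trans ?_
  rw [← sum_range_add_tsum_eq_tsum _ k]
  have hfirst : ∑ j ∈ Finset.range k, ENNReal.ofReal (basisWeight μ b k j ^ 2) * ‖b j y‖ₑ ^ 2 =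
      ∑ j ∈ Finset.range k, ‖b j y‖ₑ ^ 2 := by
    refine Finset.sum_congr rfl fun j hj => ?_
    rw [basisWeight, if_pos (Finset.mem_range.1 hj)]
    simp
  rw [hfirst]
  by_cases hT : tailSum μ H k = 0
  · obtain ⟨m, hm0, hmk, hfin, -, -, -⟩ := hb.exists_dim (k := k) hk
    have hz : ∑' j, ENNReal.ofReal (basisWeight μ b k (k + j) ^ 2) * ‖b (k + j) y‖ₑ ^ 2 = 0 := by
      refine ENNReal.tsum_eq_zero.2 fun j => ?_
      rw [hb.eq_zero_of_tailSum_eq_zero hT (Nat.le_add_right k j)]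
      simp
    have hm : (m : ℝ≥0∞) ≠ 0 := by exact_mod_cast hm0.ne'
    rw [hz, add_zero, density, if_pos hT, hfin]
    calc ∑ j ∈ Finset.range k, ‖b j y‖ₑ ^ 2
        = m * ((m : ℝ≥0∞)⁻¹ * ∑ j ∈ Finset.range k, ‖b j y‖ₑ ^ 2) := by
          rw [← mul_assoc, ENNReal.mul_inv_cancel hm (ENNReal.natCast_ne_top m), one_mul]
      _ ≤ 2 * k * ((m : ℝ≥0∞)⁻¹ * ∑ j ∈ Finset.range k, ‖b j y‖ₑ ^ 2) := by
          gcongr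
          calc (m : ℝ≥0∞) ≤ 1 * k := by rw [one_mul]; exact_mod_cast hmk
            _ ≤ 2 * k := by gcongr; exact one_le_two
  · rw [density, if_neg hT]
    have h2 : (2 : ℝ≥0∞) * k * (2⁻¹ * ((k : ℝ≥0∞)⁻¹ * ∑ j ∈ Finset.range k, ‖b j y‖ₑ ^ 2 +
        (tailSum μ H k)⁻¹ * ∑' j : ℕ, approxNumber μ H (k + j) ^ 2 * ‖b (k + j) y‖ₑ ^ 2)) =
        ∑ j ∈ Finset.range k, ‖b j y‖ₑ ^ 2 + k * ((tailSum μ H k)⁻¹ *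
          ∑' j : ℕ, approxNumber μ H (k + j) ^ 2 * ‖b (k + j) y‖ₑ ^ 2) := by
      rw [mul_comm 2 (k : ℝ≥0∞), mul_assoc, ← mul_assoc 2,
        ENNReal.mul_inv_cancel two_ne_zero ENNReal.ofNat_ne_top, one_mul, mul_add, ← mul_assoc,
        ENNReal.mul_inv_cancel hk0 hkt, one_mul]
    rw [h2, ← ENNReal.tsum_mul_left, ← ENNReal.tsum_mul_left]
    refine add_le_add le_rfl (ENNReal.tsum_le_tsum fun j => ?_)
    by_cases h0 : b (k + j) = 0
    · simp [h0]
    · have := hb.ofReal_basisWeight_sq_le hsum hk hT (Nat.le_add_right k j) h0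
      calc _ ≤ k * ((tailSum μ H k)⁻¹ * approxNumber μ H (k + j) ^ 2) * ‖b (k + j) y‖ₑ ^ 2 := by
            gcongr
        _ = _ := by ring

/-- The diagonal of the second moment matrix of the rescaled basis functions. -/
noncomputable def _root_.RKHSSampling.momentDiag (μ : Measure D) (b : ℕ → H) (k j : ℕ) : ℝ :=
  open Classical in if b j = 0 then 0 else basisWeight μ b k j ^ 2

theorem _root_.RKHSSampling.momentDiag_nonneg (j : ℕ) : 0 ≤ momentDiag μ b k j := by
  unfold momentDiag
  split_ifs <;> positivity

theorem momentDiag_le_one (hb : IsEigenbasis h b) (j : ℕ) : momentDiag μ b k j ≤ 1 := by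
  unfold momentDiag
  split_ifs with h0
  · exact zero_le_one
  · exact hb.basisWeight_sq_le_one h0

/-- The first k entries are at most 1, and the others are at most k a_j²/T, which again add up to k.
-/
theorem sum_momentDiag_le (hb : IsEigenbasis h b)
    (hsum : ∑' j : ℕ, approxNumber μ H j ^ 2 ≠ ∞) (hk : 0 < k) (N : ℕ) :
    ∑ j ∈ Finset.range N, momentDiag μ b k j ≤ 2 * k := by
  rw [← ENNReal.ofReal_le_ofReal_iff (by positivity),
    ENNReal.ofReal_sum_of_nonneg fun j _ => momentDiag_nonneg j]
  refine (ENNReal.sum_le_tsum _).trans ?_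
  rw [← sum_range_add_tsum_eq_tsum _ k, ENNReal.ofReal_mul zero_le_two, ENNReal.ofReal_natCast,
    ENNReal.ofReal_ofNat, two_mul]
  refine add_le_add ?_ ?_
  · calc ∑ j ∈ Finset.range k, ENNReal.ofReal (momentDiag μ b k j)
        ≤ ∑ j ∈ Finset.range k, 1 := Finset.sum_le_sum fun j _ => by
          rw [← ENNReal.ofReal_one]
          exact ENNReal.ofReal_le_ofReal (hb.momentDiag_le_one j)
      _ = k := by simp
  · by_cases hT : tailSum μ H k = 0
    · have : ∀ j, ENNReal.ofReal (momentDiag μ b k (k + j)) = 0 := fun j => by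
        rw [momentDiag, if_pos (hb.eq_zero_of_tailSum_eq_zero hT (Nat.le_add_right k j)),
          ENNReal.ofReal_zero]
      simp [this]
    · calc ∑' j, ENNReal.ofReal (momentDiag μ b k (k + j))
          ≤ ∑' j, k * ((tailSum μ H k)⁻¹ * approxNumber μ H (k + j) ^ 2) := by
            refine ENNReal.tsum_le_tsum fun j => ?_
            rw [momentDiag]
            split_ifs with h0
            · simp
            · exact hb.ofReal_basisWeight_sq_le hsum hk hT (Nat.le_add_right k j) h0
        _ = k * ((tailSum μ H k)⁻¹ * tailSum μ H k) := by
            rw [ENNReal.tsum_mul_left, ENNReal.tsum_mul_left, tailSum]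
        _ = k := by rw [ENNReal.inv_mul_cancel hT (tailSum_ne_top hsum k), mul_one]

end IsEigenbasis

/-- The rescaled basis functions divided by the square root of the density. -/
noncomputable def feature (μ : Measure D) (b : ℕ → H) (k N : ℕ) (y : D) (a : Fin N) : 𝕜 :=
  ((basisWeight μ b k a / √(density μ b k y).toReal : ℝ) : 𝕜) * b a y

namespace IsEigenbasis

theorem _root_.RKHSSampling.norm_sq_feature (N : ℕ) (y : D) (a : Fin N) :
    ‖feature μ b k N y a‖ ^ 2 =
      basisWeight μ b k a ^ 2 * ‖b a y‖ ^ 2 / (density μ b k y).toReal := by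
  rw [feature, norm_mul, RCLike.norm_ofReal, mul_pow, sq_abs, div_pow,
    Real.sq_sqrt ENNReal.toReal_nonneg]
  ring

theorem sum_basisWeight_le_density_toReal (hb : IsEigenbasis h b) [Nontrivial H]
    (hsum : ∑' j : ℕ, approxNumber μ H j ^ 2 ≠ ∞) (hk : 0 < k) (N : ℕ) {y : D}
    (hy : density μ b k y ≠ ∞) :
    ∑ a : Fin N, basisWeight μ b k a ^ 2 * ‖b a y‖ ^ 2 ≤ 2 * k * (density μ b k y).toReal := by
  have h1 := hb.sum_basisWeight_le_density hsum hk N y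
  rw [Finset.sum_range] at h1
  rw [← ENNReal.ofReal_le_ofReal_iff (by positivity),
    ENNReal.ofReal_sum_of_nonneg fun a _ => by positivity, ENNReal.ofReal_mul (by positivity),
    ENNReal.ofReal_toReal hy]
  convert! h1 using 2 with a
  · rw [ENNReal.ofReal_mul (by positivity), ENNReal.ofReal_pow (norm_nonneg _), ofReal_norm]
  · rw [ENNReal.ofReal_mul zero_le_two, ENNReal.ofReal_natCast, ENNReal.ofReal_ofNat]

theorem sum_norm_sq_feature_le (hb : IsEigenbasis h b) [Nontrivial H]
    (hsum : ∑' j : ℕ, approxNumber μ H j ^ 2 ≠ ∞) (hk : 0 < k) (N : ℕ) (y : D) :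
    ∑ a, ‖feature μ b k N y a‖ ^ 2 ≤ 2 * k := by
  simp only [norm_sq_feature, ← Finset.sum_div]
  by_cases hy : (density μ b k y).toReal = 0
  · rw [hy, div_zero]
    positivity
  · rw [div_le_iff₀ (lt_of_le_of_ne ENNReal.toReal_nonneg (Ne.symm hy))]
    exact hb.sum_basisWeight_le_density_toReal hsum hk N fun h => hy (by rw [h, ENNReal.toReal_top])

theorem _root_.RKHSSampling.aemeasurable_feature (h : EmbedsInL2 μ H) (b : ℕ → H) (k N : ℕ) :
    AEMeasurable (feature μ b k N) (μ.withDensity (density μ b k)) := by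
  refine AEMeasurable.mono_ac ?_ (withDensity_absolutelyContinuous μ _)
  refine aemeasurable_pi_lambda _ fun a => ?_
  refine AEMeasurable.mul ?_ (h.memLp (b a)).1.aemeasurable
  exact RCLike.measurable_ofReal.comp_aemeasurable
    ((aemeasurable_density h b k).ennreal_toReal.sqrt.const_div _)

theorem integral_feature (hb : IsEigenbasis h b) [Nontrivial H]
    (hsum : ∑' j : ℕ, approxNumber μ H j ^ 2 ≠ ∞) (hk : 0 < k) (N : ℕ) (a c : Fin N) :
    ∫ y, star (feature μ b k N y a) * feature μ b k N y c ∂(μ.withDensity (density μ b k)) =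
      Matrix.diagonal (fun a : Fin N => (momentDiag μ b k a : 𝕜)) a c := by
  have htop : ∀ᵐ y ∂μ, density μ b k y < ∞ :=
    ae_lt_top' (aemeasurable_density h b k) (by rw [hb.lintegral_density hsum hk]; simp)
  rw [integral_withDensity_eq_integral_toReal_smul₀ (aemeasurable_density h b k) htop]
  have hae : ∀ᵐ y ∂μ, (density μ b k y).toReal •
      (star (feature μ b k N y a) * feature μ b k N y c) =
      ((basisWeight μ b k a * basisWeight μ b k c : ℝ) : 𝕜) *
        ⟪embedding h (b a) y, embedding h (b c) y⟫_𝕜 := by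
    filter_upwards [htop, coeFn_embedding h (b a), coeFn_embedding h (b c)] with y hy h1 h2
    rw [h1, h2, RCLike.inner_apply, feature, feature, star_mul', RCLike.star_def,
      RCLike.conj_ofReal, RCLike.real_smul_eq_coe_mul]
    -- Where the density vanishes, so do all rescaled basis functions, so the convention for
    -- division by zero loses no mass.
    by_cases h0 : (density μ b k y).toReal = 0
    · have h3 := hb.sum_basisWeight_le_density_toReal hsum hk N hy.ne
      rw [h0, mul_zero] at h3
      have h4 := (Finset.sum_eq_zero_iff_of_nonneg fun a _ => by positivity).1
        (le_antisymm h3 (Finset.sum_nonneg fun a _ => by positivity)) c (Finset.mem_univ c)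
      rw [← mul_pow, pow_eq_zero_iff two_ne_zero] at h4
      rw [h0, RCLike.ofReal_zero, zero_mul]
      rcases mul_eq_zero.1 h4 with h5 | h5
      · rw [h5]; simp
      · rw [norm_eq_zero.1 h5]; simp
    · have h5 : √(density μ b k y).toReal * √(density μ b k y).toReal = (density μ b k y).toReal :=
        Real.mul_self_sqrt ENNReal.toReal_nonneg
      have h6 : √(density μ b k y).toReal ≠ 0 := fun h => h0 (by rw [← h5, h, zero_mul])
      have h7 : (density μ b k y).toReal * (basisWeight μ b k a / √(density μ b k y).toReal *
          (basisWeight μ b k c / √(density μ b k y).toReal)) =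
          basisWeight μ b k a * basisWeight μ b k c := by
        nth_rewrite 1 [← h5]
        field_simp
      rw [← h7]
      push_cast
      ring
  rw [integral_congr_ae hae, integral_const_mul, ← L2.inner_def]
  by_cases hac : a = c
  · subst hac
    rw [Matrix.diagonal_apply_eq, momentDiag, inner_self_eq_norm_sq_to_K]
    split_ifs with h0
    · simp [h0]
    · rw [hb.eigensystem.normalized _ h0]
      push_cast
      ring
  · rw [Matrix.diagonal_apply_ne _ hac,
      hb.eigensystem.inner_embedding fun e => hac (Fin.ext e), mul_zero]

end IsEigenbasis

end Density

end RKHSSampling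

open MeasureTheory
open scoped ENNReal InnerProductSpace

namespace RKHSSampling

set_option linter.unusedSectionVars false

/-! ### From frame bounds to norm inequalities for samples -/

section Sampling

open Matrix

variable {𝕜 D H : Type*} [RCLike 𝕜] [MeasurableSpace D]
  [NormedAddCommGroup H] [InnerProductSpace 𝕜 H] [RKHS 𝕜 H D 𝕜] [CompleteSpace H]
  {μ : Measure D} {h : EmbedsInL2 μ H} {b : ℕ → H} {k n : ℕ}

instance finiteDimensional_spanFirst (b : ℕ → H) (k : ℕ) :
    FiniteDimensional 𝕜 (spanFirst 𝕜 b k) :=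
  FiniteDimensional.span_of_finite 𝕜 ((Set.finite_Iio k).image b)

theorem exists_unit_sum_eq {ι : Type*} [Fintype ι] (z : Fin n → ι → 𝕜) {u : ι → 𝕜}
    (hu : ∑ a, ‖u a‖ ^ 2 ≠ 0) :
    ∃ v : ι → 𝕜, star v ⬝ᵥ v = 1 ∧ ∑ i, ‖∑ a, u a * z i a‖ ^ 2 =
      (∑ i, ‖∑ a, star (v a) * z i a‖ ^ 2) * ∑ a, ‖u a‖ ^ 2 := by
  set S := ∑ a, ‖u a‖ ^ 2 with hS
  have hS0 : 0 ≤ S := Finset.sum_nonneg fun a _ => by positivity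
  have hsq : √S ^ 2 = S := Real.sq_sqrt hS0
  refine ⟨fun a => ((√S)⁻¹ : ℝ) * star (u a), ?_, ?_⟩
  · have h1 : ∀ a, star (((√S)⁻¹ : ℝ) * star (u a) : 𝕜) * (((√S)⁻¹ : ℝ) * star (u a)) =
        ((S⁻¹ * ‖u a‖ ^ 2 : ℝ) : 𝕜) := fun a => by
      rw [RCLike.star_def, RCLike.conj_mul, norm_mul, RCLike.norm_ofReal,
        RCLike.norm_conj, abs_of_nonneg (by positivity), ← RCLike.ofReal_pow, mul_pow, inv_pow, hsq]
    simp only [dotProduct, Pi.star_apply, h1]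
    rw [← RCLike.ofReal_sum, ← Finset.mul_sum, ← hS, inv_mul_cancel₀ hu, RCLike.ofReal_one]
  · have h1 : ∀ i, ‖∑ a, star (((√S)⁻¹ : ℝ) * star (u a) : 𝕜) * z i a‖ ^ 2 =
        S⁻¹ * ‖∑ a, u a * z i a‖ ^ 2 := fun i => by
      have : ∑ a, star (((√S)⁻¹ : ℝ) * star (u a) : 𝕜) * z i a =
          ((√S)⁻¹ : ℝ) * ∑ a, u a * z i a := by
        rw [Finset.mul_sum]
        refine Finset.sum_congr rfl fun a _ => ?_
        rw [star_mul', star_star, RCLike.star_def, RCLike.conj_ofReal, mul_assoc]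
      rw [this, norm_mul, RCLike.norm_ofReal, mul_pow, sq_abs, inv_pow, hsq]
    simp only [h1]
    rw [← Finset.mul_sum, mul_comm, mul_inv_cancel_left₀ hu]

theorem sum_le_of_forall_unit {ι : Type*} [Fintype ι] {z : Fin n → ι → 𝕜} {M : ℝ}
    (hM : ∀ v : ι → 𝕜, star v ⬝ᵥ v = 1 → ∑ i, ‖∑ a, star (v a) * z i a‖ ^ 2 ≤ M) (u : ι → 𝕜) :
    ∑ i, ‖∑ a, u a * z i a‖ ^ 2 ≤ M * ∑ a, ‖u a‖ ^ 2 := by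
  by_cases hu : ∑ a, ‖u a‖ ^ 2 = 0
  · have h1 : ∀ a, u a = 0 := fun a => by
      have := (Finset.sum_eq_zero_iff_of_nonneg fun a _ => by positivity).1 hu a (Finset.mem_univ a)
      exact norm_eq_zero.1 (pow_eq_zero_iff two_ne_zero |>.1 this)
    simp [h1]
  · obtain ⟨v, hv, he⟩ := exists_unit_sum_eq z hu
    rw [he]
    exact mul_le_mul_of_nonneg_right (hM v hv) (Finset.sum_nonneg fun a _ => by positivity)

theorem le_sum_of_forall_unit {ι : Type*} [Fintype ι] {z : Fin n → ι → 𝕜} {M : ℝ}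
    (hM : ∀ v : ι → 𝕜, star v ⬝ᵥ v = 1 → M ≤ ∑ i, ‖∑ a, star (v a) * z i a‖ ^ 2) (u : ι → 𝕜) :
    M * ∑ a, ‖u a‖ ^ 2 ≤ ∑ i, ‖∑ a, u a * z i a‖ ^ 2 := by
  by_cases hu : ∑ a, ‖u a‖ ^ 2 = 0
  · rw [hu, mul_zero]
    exact Finset.sum_nonneg fun i _ => by positivity
  · obtain ⟨v, hv, he⟩ := exists_unit_sum_eq z hu
    rw [he]
    exact mul_le_mul_of_nonneg_right (hM v hv) (Finset.sum_nonneg fun a _ => by positivity)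

/-- The vector of samples of a function, weighted with the inverse square root of the density. -/
noncomputable def samplingMap (μ : Measure D) (b : ℕ → H) (k : ℕ) (x : Fin n → D) :
    H →ₗ[𝕜] EuclideanSpace 𝕜 (Fin n) where
  toFun f := WithLp.toLp 2 fun i => (((√(density μ b k (x i)).toReal)⁻¹ : ℝ) : 𝕜) * f (x i)
  map_add' f g := by
    ext i
    simp [mul_add]
  map_smul' c f := by
    ext i
    simp [mul_left_comm]

theorem samplingMap_apply (x : Fin n → D) (f : H) (i : Fin n) :
    samplingMap μ b k x f i = (((√(density μ b k (x i)).toReal)⁻¹ : ℝ) : 𝕜) * f (x i) := rfl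

theorem continuous_samplingMap (x : Fin n → D) : Continuous (samplingMap (𝕜 := 𝕜) μ b k x) := by
  refine (PiLp.continuous_toLp 2 _).comp (continuous_pi fun i => ?_)
  exact continuous_const.mul (RKHS.continuous_eval (x i))

theorem samplingMap_sum (hb : IsEigenbasis h b) (x : Fin n → D) (N : ℕ) (c : ℕ → 𝕜)
    (hc : ∀ j, b j = 0 → c j = 0) :
    ‖samplingMap μ b k x (∑ j ∈ Finset.range N, c j • b j)‖ ^ 2 =
      ∑ i, ‖∑ a : Fin N, (c a / (basisWeight μ b k a : ℝ)) * feature μ b k N (x i) a‖ ^ 2 := by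
  rw [EuclideanSpace.norm_sq_eq]
  refine Finset.sum_congr rfl fun i _ => ?_
  congr 2
  rw [map_sum, Finset.sum_range, WithLp.ofLp_sum, Finset.sum_apply]
  refine Finset.sum_congr rfl fun a _ => ?_
  rw [map_smul, PiLp.smul_apply, samplingMap_apply, feature, smul_eq_mul]
  by_cases h0 : b a = 0
  · rw [hc a h0]; simp
  · have : ((basisWeight μ b k a : ℝ) : 𝕜) ≠ 0 := by
      exact_mod_cast (hb.basisWeight_pos h0).ne'
    push_cast
    field_simp

namespace IsEigenbasis

theorem starProjection_sum (hb : IsEigenbasis h b) {N : ℕ} (hN : k ≤ N) (c : ℕ → 𝕜) :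
    (spanFirst 𝕜 b k).starProjection (∑ j ∈ Finset.range N, c j • b j) =
      ∑ j ∈ Finset.range k, c j • b j := by
  refine Submodule.eq_starProjection_of_mem_orthogonal (K := spanFirst 𝕜 b k) ?_ ?_
  · exact Submodule.sum_mem _ fun j hj => Submodule.smul_mem _ _
      (Submodule.subset_span ⟨j, Finset.mem_range.1 hj, rfl⟩)
  · rw [← Finset.sum_range_add_sum_Ico _ hN, add_sub_cancel_left]
    refine Submodule.sum_mem _ fun j hj => Submodule.smul_mem _ _ ?_
    have hle : spanFirst 𝕜 b k ≤ (𝕜 ∙ b j)ᗮ := Submodule.span_le.2 (by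
      rintro _ ⟨i, hi, rfl⟩
      refine Submodule.mem_orthogonal_singleton_iff_inner_right.2 (hb.orthogonal j i fun e => ?_)
      exact absurd (e ▸ (Finset.mem_Ico.1 hj).1) (not_le.2 hi))
    exact fun u hu => inner_eq_zero_symm.1 (Submodule.mem_orthogonal_singleton_iff_inner_right.1 (hle hu))

theorem sub_starProjection_sum (hb : IsEigenbasis h b) {N : ℕ} (hN : k ≤ N) (c : ℕ → 𝕜) :
    (∑ j ∈ Finset.range N, c j • b j) -
      (spanFirst 𝕜 b k).starProjection (∑ j ∈ Finset.range N, c j • b j) =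
      ∑ j ∈ Finset.Ico k N, c j • b j := by
  rw [hb.starProjection_sum hN, ← Finset.sum_range_add_sum_Ico _ hN, add_sub_cancel_left]

/-- Closed conditions on an element of `H` need to be checked only for finite sums. -/
theorem induction_sum (hb : IsEigenbasis h b) (k : ℕ) {p : H → Prop} (hp : IsClosed {f | p f})
    (hs : ∀ (N : ℕ) (c : ℕ → 𝕜), k ≤ N → (∀ j, b j = 0 → c j = 0) →
      p (∑ j ∈ Finset.range N, c j • b j)) (f : H) : p f := by
  refine hb.dense_span.induction (P := p) (fun f hf => ?_) hp f
  obtain ⟨N, c, hN, hc, rfl⟩ := exists_eq_sum_of_mem_span hf k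
  exact hs N c hN hc

theorem sub_starProjection_eq_zero (hb : IsEigenbasis h b) (hT : tailSum μ H k = 0) (f : H) :
    f - (spanFirst 𝕜 b k).starProjection f = 0 := by
  refine hb.induction_sum k (p := fun f => f - (spanFirst 𝕜 b k).starProjection f = 0) ?_ ?_ f
  · exact isClosed_eq (by fun_prop) continuous_const
  · intro N c hN _
    rw [hb.sub_starProjection_sum hN]
    exact Finset.sum_eq_zero fun j hj => by
      rw [hb.eq_zero_of_tailSum_eq_zero hT (Finset.mem_Ico.1 hj).1, smul_zero]

theorem norm_sq_embedding_sub_starProjection_le (hb : IsEigenbasis h b) (hbk : b k ≠ 0) (f : H) :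
    ‖embedding h (f - (spanFirst 𝕜 b k).starProjection f)‖ ^ 2 ≤
      (‖b k‖ ^ 2)⁻¹ * ‖f - (spanFirst 𝕜 b k).starProjection f‖ ^ 2 := by
  refine hb.induction_sum k (p := fun f =>
    ‖embedding h (f - (spanFirst 𝕜 b k).starProjection f)‖ ^ 2 ≤
      (‖b k‖ ^ 2)⁻¹ * ‖f - (spanFirst 𝕜 b k).starProjection f‖ ^ 2) ?_ ?_ f
  · exact isClosed_le (by fun_prop) (by fun_prop)
  · intro N c hN hc
    rw [hb.sub_starProjection_sum hN,
      hb.eigensystem.norm_sq_embedding_sum _ c fun j _ => hc j, hb.eigensystem.norm_sq_sum,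
      Finset.mul_sum]
    refine Finset.sum_le_sum fun j hj => ?_
    by_cases h0 : b j = 0
    · simp [hc j h0]
    · have h1 : 0 < ‖b k‖ := norm_pos_iff.2 hbk
      have h2 := hb.eigensystem.norm_le_norm (Finset.mem_Ico.1 hj).1 h0
      rw [← div_eq_inv_mul, le_div_iff₀ (by positivity)]
      gcongr

/-- The weighted sum of squares is controlled by the `L₂`-norm on `V_k` and by the norm of `H` on
the orthogonal complement of `V_k`. -/
theorem norm_sq_samplingMap_le (hb : IsEigenbasis h b) {x : Fin n → D} {M : ℝ}
    (hM : ∀ (N : ℕ) (v : Fin N → 𝕜), star v ⬝ᵥ v = 1 →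
      ∑ i, ‖∑ a, star (v a) * feature μ b k N (x i) a‖ ^ 2 ≤ M) (f : H) :
    ‖samplingMap μ b k x f‖ ^ 2 ≤ M * (‖embedding h ((spanFirst 𝕜 b k).starProjection f)‖ ^ 2 +
      tailScale μ b k * ‖f - (spanFirst 𝕜 b k).starProjection f‖ ^ 2) := by
  have hcont := continuous_samplingMap (𝕜 := 𝕜) (μ := μ) (b := b) (k := k) x
  refine hb.induction_sum k (p := fun f => ‖samplingMap μ b k x f‖ ^ 2 ≤
    M * (‖embedding h ((spanFirst 𝕜 b k).starProjection f)‖ ^ 2 +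
      tailScale μ b k * ‖f - (spanFirst 𝕜 b k).starProjection f‖ ^ 2)) ?_ ?_ f
  · exact isClosed_le (by fun_prop) (by fun_prop)
  · intro N c hN hc
    rw [hb.sub_starProjection_sum hN, hb.starProjection_sum hN, samplingMap_sum hb x N c hc,
      hb.eigensystem.norm_sq_embedding_sum _ c fun j _ => hc j, hb.eigensystem.norm_sq_sum]
    refine (sum_le_of_forall_unit (hM N) _).trans_eq ?_
    -- Dividing by the weights leaves |c_j|² for j < k and turns it into q|c_j|²‖b_j‖² for j ≥ k.
    rw [← Finset.sum_range (fun a => ‖c a / ((basisWeight μ b k a : ℝ) : 𝕜)‖ ^ 2),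
      ← Finset.sum_range_add_sum_Ico _ hN, Finset.mul_sum]
    congr 2
    · refine Finset.sum_congr rfl fun j hj => ?_
      rw [basisWeight, if_pos (Finset.mem_range.1 hj), RCLike.ofReal_one, div_one]
    · refine Finset.sum_congr rfl fun j hj => ?_
      rw [norm_div, RCLike.norm_ofReal, div_pow, sq_abs,
        hb.basisWeight_sq (Finset.mem_Ico.1 hj).1, ← mul_inv, div_inv_eq_mul]
      ring

/-- Only the m nonzero functions among the first k enter, since the lower tail bound needs the
identity as second moment matrix; their weights are 1. -/
theorem le_norm_sq_samplingMap (hb : IsEigenbasis h b) {m : ℕ} (hmk : m ≤ k)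
    (hne : ∀ j < m, b j ≠ 0)
    (hspan : spanFirst 𝕜 b k = Submodule.span 𝕜 (Set.range fun j : Fin m => b j)) {x : Fin n → D}
    {M : ℝ} (hM : ∀ v : Fin m → 𝕜, star v ⬝ᵥ v = 1 →
      M ≤ ∑ i, ‖∑ a, star (v a) * feature μ b k m (x i) a‖ ^ 2) {g : H}
    (hg : g ∈ spanFirst 𝕜 b k) :
    M * ‖embedding h g‖ ^ 2 ≤ ‖samplingMap μ b k x g‖ ^ 2 := by
  classical
  rw [hspan, Submodule.mem_span_range_iff_exists_fun] at hg
  obtain ⟨c, rfl⟩ := hg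
  set d : ℕ → 𝕜 := fun j => if hj : j < m ∧ b j ≠ 0 then c ⟨j, hj.1⟩ else 0 with hd
  have hd0 : ∀ j, b j = 0 → d j = 0 := fun j hj => dif_neg fun h => h.2 hj
  have hcd : ∀ j : Fin m, c j = d j := fun j => by rw [hd]; simp [hne j j.2]
  have hs : ∑ j : Fin m, c j • b j = ∑ j ∈ Finset.range m, d j • b j := by
    rw [Finset.sum_range]
    exact Finset.sum_congr rfl fun j _ => by rw [hcd j]
  rw [hs, samplingMap_sum hb x m d hd0, hb.eigensystem.norm_sq_embedding_sum _ d fun j _ => hd0 j]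
  refine Eq.trans_le ?_ (le_sum_of_forall_unit hM _)
  rw [Finset.sum_range]
  congr 1
  refine Finset.sum_congr rfl fun j _ => ?_
  rw [basisWeight, if_pos (j.2.trans_le hmk), RCLike.ofReal_one, div_one]

theorem inner_embedding_starProjection (hb : IsEigenbasis h b) {g : H}
    (hg : g ∈ spanFirst 𝕜 b k) (f : H) :
    ⟪embedding h g, embedding h (f - (spanFirst 𝕜 b k).starProjection f)⟫_𝕜 = 0 := by
  have hf := Submodule.sub_starProjection_mem_orthogonal (K := spanFirst 𝕜 b k) f
  induction hg using Submodule.span_induction with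
  | mem y hy =>
    obtain ⟨j, hj, rfl⟩ := hy
    exact inner_embedding_eq_zero (hb.eigen j) (hf _ (Submodule.subset_span ⟨j, hj, rfl⟩))
  | zero => rw [map_zero, inner_zero_left]
  | add y z _ _ hy hz => rw [map_add, inner_add_left, hy, hz, add_zero]
  | smul t y _ hy => rw [map_smul, inner_smul_left, hy, mul_zero]

end IsEigenbasis

end Sampling

end RKHSSampling

open MeasureTheory
open scoped ENNReal InnerProductSpace

namespace RKHSSampling

set_option linter.unusedSectionVars false

/-! ### Error of weighted least squares -/

section LeastSquares

variable {𝕜 D H : Type*} [RCLike 𝕜] [MeasurableSpace D]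
  [NormedAddCommGroup H] [InnerProductSpace 𝕜 H] [RKHS 𝕜 H D 𝕜] [CompleteSpace H]
  {μ : Measure D} {h : EmbedsInL2 μ H} {b : ℕ → H} {k n : ℕ} {x : Fin n → D}

theorem sum_enorm_sq_div_density (hx0 : ∀ i, density μ b k (x i) ≠ 0)
    (hx1 : ∀ i, density μ b k (x i) ≠ ∞) (f g : H) :
    ∑ i, ‖g (x i) - f (x i)‖ₑ ^ 2 / density μ b k (x i) =
      ENNReal.ofReal (‖samplingMap μ b k x (g - f)‖ ^ 2) := by
  rw [EuclideanSpace.norm_sq_eq, ENNReal.ofReal_sum_of_nonneg fun i _ => by positivity]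
  refine Finset.sum_congr rfl fun i _ => ?_
  have h1 : 0 < (density μ b k (x i)).toReal := ENNReal.toReal_pos (hx0 i) (hx1 i)
  rw [samplingMap_apply, norm_mul, RCLike.norm_ofReal, mul_pow, sq_abs, inv_pow,
    Real.sq_sqrt h1.le, ← div_eq_inv_mul, ENNReal.ofReal_div_of_pos h1, ENNReal.ofReal_toReal (hx1 i),
    ENNReal.ofReal_pow (norm_nonneg _), ofReal_norm, RKHS.coe_sub, Pi.sub_apply]

/-- The orthogonal projection of the data onto the sample vectors of functions in `V_k`. -/
noncomputable def projectedSamples (μ : Measure D) (b : ℕ → H) (k : ℕ) (x : Fin n → D) (f : H) :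
    EuclideanSpace 𝕜 (Fin n) :=
  ((spanFirst 𝕜 b k).map (samplingMap μ b k x)).starProjection (samplingMap μ b k x f)

theorem norm_sq_samplingMap_sub {g : H} (hg : g ∈ spanFirst 𝕜 b k) (f : H) :
    ‖samplingMap (𝕜 := 𝕜) μ b k x (g - f)‖ ^ 2 =
      ‖samplingMap (𝕜 := 𝕜) μ b k x g - projectedSamples (𝕜 := 𝕜) μ b k x f‖ ^ 2 +
      ‖projectedSamples (𝕜 := 𝕜) μ b k x f - samplingMap (𝕜 := 𝕜) μ b k x f‖ ^ 2 := by
  have hs : samplingMap (𝕜 := 𝕜) μ b k x (g - f) =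
      (samplingMap (𝕜 := 𝕜) μ b k x g - projectedSamples (𝕜 := 𝕜) μ b k x f) +
      (projectedSamples (𝕜 := 𝕜) μ b k x f - samplingMap (𝕜 := 𝕜) μ b k x f) := by
    rw [map_sub]; abel
  rw [hs, sq, sq, sq]
  refine norm_add_sq_eq_norm_sq_add_norm_sq_of_inner_eq_zero (𝕜 := 𝕜) _ _ ?_
  rw [← neg_sub (samplingMap μ b k x f), inner_neg_right, neg_eq_zero]
  exact Submodule.sub_starProjection_mem_orthogonal _ _
    (Submodule.sub_mem _ (Submodule.mem_map_of_mem hg) (Submodule.starProjection_apply_mem _ _))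

/-- By Pythagoras, minimizing means matching the projection of the data onto the sample vectors of
V_k, which is attained because it lies in the image of V_k. -/
theorem isWeightedLeastSquares_iff (hx0 : ∀ i, density μ b k (x i) ≠ 0)
    (hx1 : ∀ i, density μ b k (x i) ≠ ∞) (f g : H) :
    IsWeightedLeastSquares μ b k x f g ↔
      g ∈ spanFirst 𝕜 b k ∧ samplingMap μ b k x g = projectedSamples μ b k x f := by
  simp only [IsWeightedLeastSquares, sum_enorm_sq_div_density hx0 hx1]
  refine and_congr_right fun hg => ⟨fun hmin => ?_, fun he g' hg' => ?_⟩
  · obtain ⟨g', hg', he⟩ := Submodule.mem_map.1 (Submodule.starProjection_apply_mem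
      ((spanFirst 𝕜 b k).map (samplingMap μ b k x)) (samplingMap μ b k x f))
    have h1 := (ENNReal.ofReal_le_ofReal_iff (by positivity)).1 (hmin g' hg')
    rw [norm_sq_samplingMap_sub hg, norm_sq_samplingMap_sub hg', he, projectedSamples, sub_self,
      norm_zero] at h1
    rw [← sub_eq_zero, ← norm_eq_zero, ← pow_eq_zero_iff two_ne_zero]
    refine le_antisymm ?_ (by positivity)
    rw [projectedSamples]
    linarith
  · refine ENNReal.ofReal_le_ofReal ?_
    rw [norm_sq_samplingMap_sub hg, norm_sq_samplingMap_sub hg', he, sub_self, norm_zero]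
    have : 0 ≤ ‖samplingMap (𝕜 := 𝕜) μ b k x g' - projectedSamples μ b k x f‖ ^ 2 := by positivity
    linarith

theorem existsUnique_isWeightedLeastSquares
    (hx0 : ∀ i, density μ b k (x i) ≠ 0) (hx1 : ∀ i, density μ b k (x i) ≠ ∞) {M : ℝ} (hM : 0 < M)
    (hlow : ∀ g ∈ spanFirst 𝕜 b k,
      M * ‖embedding h g‖ ^ 2 ≤ ‖samplingMap (𝕜 := 𝕜) μ b k x g‖ ^ 2) (f : H) :
    ∃! g, IsWeightedLeastSquares μ b k x f g := by
  obtain ⟨g, hg, he⟩ := Submodule.mem_map.1 (Submodule.starProjection_apply_mem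
    ((spanFirst 𝕜 b k).map (samplingMap μ b k x)) (samplingMap μ b k x f))
  refine ⟨g, (isWeightedLeastSquares_iff hx0 hx1 f g).2 ⟨hg, he⟩, fun g' hg' => ?_⟩
  obtain ⟨hg1, hg2⟩ := (isWeightedLeastSquares_iff hx0 hx1 f g').1 hg'
  have h1 := hlow (g' - g) (Submodule.sub_mem _ hg1 hg)
  rw [map_sub (samplingMap μ b k x), hg2, he, projectedSamples, sub_self, norm_zero, zero_pow two_ne_zero] at h1
  have h2 : ‖embedding h (g' - g)‖ ^ 2 = 0 :=
    le_antisymm (nonpos_of_mul_nonpos_right h1 hM) (by positivity)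
  rw [pow_eq_zero_iff two_ne_zero, norm_eq_zero, ← map_zero (embedding h)] at h2
  exact sub_eq_zero.1 (embedding_injective h h2)

namespace IsEigenbasis

/-- The error of the weighted least squares method for one function. -/
theorem norm_sq_embedding_sub_le (hb : IsEigenbasis h b)
    (hx0 : ∀ i, density μ b k (x i) ≠ 0) (hx1 : ∀ i, density μ b k (x i) ≠ ∞) {M : ℝ} (hM : 0 < M)
    (hlow : ∀ g ∈ spanFirst 𝕜 b k,
      M * ‖embedding h g‖ ^ 2 ≤ ‖samplingMap (𝕜 := 𝕜) μ b k x g‖ ^ 2)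
    (hup : ∀ f : H, ‖samplingMap (𝕜 := 𝕜) μ b k x f‖ ^ 2 ≤
      2 * M * (‖embedding h ((spanFirst 𝕜 b k).starProjection f)‖ ^ 2 +
        tailScale μ b k * ‖f - (spanFirst 𝕜 b k).starProjection f‖ ^ 2))
    {f g : H} (hg : IsWeightedLeastSquares μ b k x f g) :
    ‖embedding h (f - g)‖ ^ 2 ≤
      ‖embedding h (f - (spanFirst 𝕜 b k).starProjection f)‖ ^ 2 +
        tailScale μ b k * ‖f - (spanFirst 𝕜 b k).starProjection f‖ ^ 2 := by
  obtain ⟨hgV, hgs⟩ := (isWeightedLeastSquares_iff hx0 hx1 f g).1 hg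
  set P := (spanFirst 𝕜 b k).starProjection with hP
  have hPf : P f ∈ spanFirst 𝕜 b k := Submodule.starProjection_apply_mem _ _
  have hdV : g - P f ∈ spanFirst 𝕜 b k := Submodule.sub_mem _ hgV hPf
  have hPd : P (g - P f + (f - P f)) = g - P f := by
    rw [map_add, map_sub, map_sub, Submodule.starProjection_eq_self_iff.2 hgV,
      Submodule.starProjection_eq_self_iff.2 hPf, sub_self, add_zero]
  have hu := hup (g - P f + (f - P f))
  rw [hPd, add_sub_cancel_left] at hu
  -- Plain f − P f would give a worse constant. Adding g − P f doubles the V_k-part of its samples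
  -- and keeps the residual, which is orthogonal to it.
  have hs : samplingMap (𝕜 := 𝕜) μ b k x (g - P f + (f - P f)) =
      (2 : 𝕜) • samplingMap (𝕜 := 𝕜) μ b k x (g - P f) +
        (samplingMap (𝕜 := 𝕜) μ b k x f - projectedSamples μ b k x f) := by
    rw [map_add, two_smul, map_sub, map_sub, hgs]
    abel
  have hort : ⟪(2 : 𝕜) • samplingMap (𝕜 := 𝕜) μ b k x (g - P f),
      samplingMap (𝕜 := 𝕜) μ b k x f - projectedSamples μ b k x f⟫_𝕜 = 0 :=
    Submodule.sub_starProjection_mem_orthogonal _ _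
      (Submodule.smul_mem _ _ (Submodule.mem_map_of_mem hdV))
  have hpy := norm_add_sq_eq_norm_sq_add_norm_sq_of_inner_eq_zero (𝕜 := 𝕜) _ _ hort
  rw [← hs, ← sq, norm_smul, RCLike.norm_ofNat, ← sq] at hpy
  have hl := hlow _ hdV
  have h1 : 0 ≤ ‖samplingMap (𝕜 := 𝕜) μ b k x f - projectedSamples μ b k x f‖ *
    ‖samplingMap (𝕜 := 𝕜) μ b k x f - projectedSamples μ b k x f‖ := by positivity
  -- With a = ‖g − Pf‖²_{L₂}, the two frame bounds read 4Ma ≤ 2M(a + q‖f − Pf‖²_H).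
  have h2 : ‖embedding h (g - P f)‖ ^ 2 ≤ tailScale μ b k * ‖f - P f‖ ^ 2 := by
    refine le_of_mul_le_mul_left ?_ hM
    nlinarith
  have h3 : embedding h (f - g) = -embedding h (g - P f) + embedding h (f - P f) := by
    rw [← map_neg, ← map_add]
    congr 1
    abel
  have h4 := norm_add_sq_eq_norm_sq_add_norm_sq_of_inner_eq_zero (𝕜 := 𝕜)
    (-embedding h (g - P f)) (embedding h (f - P f))
    (by rw [inner_neg_left, hb.inner_embedding_starProjection hdV, neg_zero])
  rw [h3, sq, h4, norm_neg, ← sq, ← sq]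
  linarith

/-- The left side is 2σ² + T/k with k = 2l and σ = 1/‖b_k‖, at most 4/k·(lσ² + T). The l indices
from l to 2l − 1 have a_j ≥ σ, so lσ² + T is at most the tail from l. -/
theorem inv_norm_sq_add_tailScale_le (hb : IsEigenbasis h b)
    (hsum : ∑' j : ℕ, approxNumber μ H j ^ 2 ≠ ∞) {l : ℕ} (hl : 0 < l)
    (hT : tailSum μ H (2 * l) ≠ 0) :
    ENNReal.ofReal ((‖b (2 * l)‖ ^ 2)⁻¹ + tailScale μ b (2 * l)) ≤
      4 / ((2 * l : ℕ) : ℝ≥0∞) * tailSum μ H l := by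
  have hTt := tailSum_ne_top hsum (2 * l)
  have hbk := hb.ne_zero_of_tailSum_ne_zero hT le_rfl
  have hl0 : (0 : ℝ) < l := by exact_mod_cast hl
  set s := (‖b (2 * l)‖ ^ 2)⁻¹ with hs
  set T := (tailSum μ H (2 * l)).toReal with hTdef
  have hsn : 0 ≤ s := by positivity
  have h1 : ENNReal.ofReal (l * s + T) ≤ tailSum μ H l := by
    rw [tailSum, ← sum_range_add_tsum_eq_tsum _ l, ENNReal.ofReal_add (by positivity) (by positivity),
      hTdef, ENNReal.ofReal_toReal hTt, tailSum]
    refine add_le_add ?_ (le_of_eq (tsum_congr fun j => by congr 2; ring))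
    rw [ENNReal.ofReal_mul hl0.le, ENNReal.ofReal_natCast]
    calc (l : ℝ≥0∞) * ENNReal.ofReal s = ∑ j ∈ Finset.range l, ENNReal.ofReal s := by simp
      _ ≤ _ := Finset.sum_le_sum fun j hj => by
        have hj' := Finset.mem_range.1 hj
        have h0 := hb.eigensystem.ne_zero_of_le (show l + j ≤ 2 * l by omega) hbk
        have h2 := hb.eigensystem.norm_le_norm (show l + j ≤ 2 * l by omega) hbk
        have h3 : 0 < ‖b (l + j)‖ := norm_pos_iff.2 h0
        have h4 := hb.eigensystem.inv_norm_le_approxNumber h0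
        calc ENNReal.ofReal s ≤ ENNReal.ofReal (‖b (l + j)‖⁻¹ ^ 2) := by
              refine ENNReal.ofReal_le_ofReal ?_
              rw [hs, inv_pow]
              gcongr
          _ = ENNReal.ofReal ‖b (l + j)‖⁻¹ ^ 2 := ENNReal.ofReal_pow (by positivity) 2
          _ ≤ _ := by gcongr
  have h2 : s + tailScale μ b (2 * l) ≤ 4 / ((2 * l : ℕ) : ℝ) * (l * s + T) := by
    have hTn : 0 ≤ T / l := by positivity
    have e1 : 4 / ((2 * l : ℕ) : ℝ) * (l * s + T) = 2 * s + 2 * (T / l) := by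
      push_cast
      field_simp
      ring
    have e2 : T / ((2 * l : ℕ) : ℝ) = T / l / 2 := by
      push_cast
      field_simp
    rw [tailScale, if_neg hT, e1, ← hs, ← hTdef, e2]
    linarith
  refine (ENNReal.ofReal_le_ofReal h2).trans ?_
  rw [ENNReal.ofReal_mul (by positivity), ENNReal.ofReal_div_of_pos (by exact_mod_cast (by omega)),
    ENNReal.ofReal_natCast, ENNReal.ofReal_ofNat]
  gcongr

theorem worstCaseError_leastSquares_le (hb : IsEigenbasis h b)
    (hsum : ∑' j : ℕ, approxNumber μ H j ^ 2 ≠ ∞) {l : ℕ} (hl : 0 < l) (hkl : k = 2 * l)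
    (hx0 : ∀ i, density μ b k (x i) ≠ 0) (hx1 : ∀ i, density μ b k (x i) ≠ ∞) {M : ℝ} (hM : 0 < M)
    (hlow : ∀ g ∈ spanFirst 𝕜 b k,
      M * ‖embedding h g‖ ^ 2 ≤ ‖samplingMap (𝕜 := 𝕜) μ b k x g‖ ^ 2)
    (hup : ∀ f : H, ‖samplingMap (𝕜 := 𝕜) μ b k x f‖ ^ 2 ≤
      2 * M * (‖embedding h ((spanFirst 𝕜 b k).starProjection f)‖ ^ 2 +
        tailScale μ b k * ‖f - (spanFirst 𝕜 b k).starProjection f‖ ^ 2)) :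
    worstCaseError μ (fun f : H => ⇑(leastSquares μ b k x f)) ^ 2 ≤
      4 / (k : ℝ≥0∞) * tailSum μ H l := by
  have hls : ∀ f, IsWeightedLeastSquares μ b k x f (leastSquares μ b k x f) := fun f => by
    have hex := (existsUnique_isWeightedLeastSquares hx0 hx1 hM hlow f).exists
    rw [leastSquares, dif_pos hex]
    exact hex.choose_spec
  have herr := fun f => hb.norm_sq_embedding_sub_le hx0 hx1 hM hlow hup (hls f)
  have hsq : ∀ R : ℝ, 0 ≤ R → (∀ f : H, ‖f‖ ≤ 1 →
      ‖embedding h (f - leastSquares μ b k x f)‖ ^ 2 ≤ R) →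
      worstCaseError μ (fun f : H => ⇑(leastSquares μ b k x f)) ^ 2 ≤ ENNReal.ofReal R := by
    intro R hR hle
    rw [← Real.sq_sqrt hR, ENNReal.ofReal_pow (Real.sqrt_nonneg R),
      worstCaseError_eq h (B := fun f => embedding h (leastSquares μ b k x f))
        fun f => (coeFn_embedding h _).symm]
    gcongr
    refine iSup₂_le fun f hf => ?_
    rw [← map_sub, ← ofReal_norm]
    exact ENNReal.ofReal_le_ofReal (Real.le_sqrt_of_sq_le (hle f hf))
  by_cases hT : tailSum μ H k = 0
  · refine (hsq 0 le_rfl fun f _ => ?_).trans (by simp)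
    have := herr f
    rw [hb.sub_starProjection_eq_zero hT] at this
    simpa using this
  · have hbk := hb.ne_zero_of_tailSum_ne_zero hT le_rfl
    have hq := hb.tailScale_pos (k := k)
    have hR : 0 ≤ (‖b k‖ ^ 2)⁻¹ + tailScale μ b k := by positivity
    refine (hsq _ hR fun f hf => ?_).trans ?_
    · refine (herr f).trans ((add_le_add_left
        (hb.norm_sq_embedding_sub_starProjection_le hbk f) _).trans ?_)
      rw [← add_mul]
      refine mul_le_of_le_one_right hR (pow_le_one₀ (norm_nonneg _) (le_trans ?_ hf))
      rw [← Submodule.starProjection_orthogonal_val]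
      exact Submodule.norm_starProjection_apply_le _ f
    · subst hkl
      exact hb.inv_norm_sq_add_tailScale_le hsum hl hT

end IsEigenbasis

end LeastSquares

end RKHSSampling

open MeasureTheory
open scoped ENNReal InnerProductSpace

namespace RKHSSampling

set_option linter.unusedSectionVars false

/-! ### The event of good nodes and its probability -/

section GoodNodes

open Matrix

variable {𝕜 D H : Type*} [RCLike 𝕜] [MeasurableSpace D]
  [NormedAddCommGroup H] [InnerProductSpace 𝕜 H] [RKHS 𝕜 H D 𝕜] [CompleteSpace H]
  {μ : Measure D} {h : EmbedsInL2 μ H} {b : ℕ → H} {k n : ℕ}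

/-- The nodes for which the first `N` rescaled basis functions have a large frame bound. -/
def largeNodes (μ : Measure D) (b : ℕ → H) (k n N : ℕ) : Set (Fin n → D) :=
  {x | ∃ v : Fin N → 𝕜, star v ⬝ᵥ v = 1 ∧
    4 / 3 * (n : ℝ) ≤ ∑ i, ‖∑ a, star (v a) * feature μ b k N (x i) a‖ ^ 2}

theorem monotone_largeNodes : Monotone (largeNodes (𝕜 := 𝕜) μ b k n) := by
  refine monotone_nat_of_le_succ fun N x => ?_
  rintro ⟨v, hv, hle⟩
  refine ⟨Fin.snoc v 0, ?_, ?_⟩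
  · rw [dotProduct, Fin.sum_univ_castSucc, ← hv, dotProduct]
    simp
  · refine hle.trans_eq (Finset.sum_congr rfl fun i _ => ?_)
    rw [Fin.sum_univ_castSucc]
    simp [feature]

namespace IsEigenbasis

theorem measure_iUnion_largeNodes_le (hb : IsEigenbasis h b) [Nontrivial H]
    (hsum : ∑' j : ℕ, approxNumber μ H j ^ 2 ≠ ∞) (hk : 0 < k) {y : ℝ} (hy : 1 ≤ y)
    (hn : 128 * k * y ≤ n) :
    (Measure.pi fun _ : Fin n => μ.withDensity (density μ b k))
      (⋃ N, largeNodes (𝕜 := 𝕜) μ b k n N) ≤ ENNReal.ofReal (2 * k * Real.exp (-y)) := by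
  have := hb.isProbabilityMeasure hsum hk
  -- The events increase with N, so a bound uniform in N passes to the union without a union bound.
  -- Continuity from below holds here without measurability.
  rw [monotone_largeNodes.measure_iUnion]
  refine iSup_le fun N => ?_
  have hk0 : (0 : ℝ) < k := by exact_mod_cast hk
  refine (measure_exists_large_le (r := 2 * k) (d := fun a : Fin N => momentDiag μ b k a)
    (by positivity) (aemeasurable_feature h b k N) (hb.sum_norm_sq_feature_le hsum hk N)
    (hb.integral_feature hsum hk N) (fun a => momentDiag_nonneg _)
    (fun a => hb.momentDiag_le_one _) hy (by linarith)).trans ?_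
  refine ENNReal.ofReal_le_ofReal (mul_le_mul_of_nonneg_right ?_ (Real.exp_pos _).le)
  rw [← Finset.sum_range (fun a => momentDiag μ b k a)]
  exact hb.sum_momentDiag_le hsum hk N

theorem measure_small_le (hb : IsEigenbasis h b) [Nontrivial H]
    (hsum : ∑' j : ℕ, approxNumber μ H j ^ 2 ≠ ∞) (hk : 0 < k) {y : ℝ} (hy : 1 ≤ y)
    (hn : 128 * k * y ≤ n) {m : ℕ} (hmk : m ≤ k) (hne : ∀ j < m, b j ≠ 0) :
    (Measure.pi fun _ : Fin n => μ.withDensity (density μ b k))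
      {x | ∃ v : Fin m → 𝕜, star v ⬝ᵥ v = 1 ∧
        ∑ i, ‖∑ a, star (v a) * feature μ b k m (x i) a‖ ^ 2 ≤ 2 / 3 * (n : ℝ)} ≤
      ENNReal.ofReal (k * Real.exp (-y)) := by
  have := hb.isProbabilityMeasure hsum hk
  have hk0 : (0 : ℝ) < k := by exact_mod_cast hk
  have hone : (fun a : Fin m => ((momentDiag μ b k a : ℝ) : 𝕜)) = 1 := by
    funext a
    rw [momentDiag, if_neg (hne a a.2), basisWeight, if_pos (a.2.trans_le hmk)]
    simp
  refine (measure_exists_small_le (r := 2 * k) (by positivity) (aemeasurable_feature h b k m)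
    (hb.sum_norm_sq_feature_le hsum hk m)
    (fun a c => by rw [hb.integral_feature hsum hk m, hone, Matrix.diagonal_one'])
    hy (by linarith)).trans ?_
  refine ENNReal.ofReal_le_ofReal (mul_le_mul_of_nonneg_right ?_ (Real.exp_pos _).le)
  rw [Fintype.card_fin]
  exact_mod_cast hmk

theorem measure_degenerate_eq_zero (hb : IsEigenbasis h b) [Nontrivial H]
    (hsum : ∑' j : ℕ, approxNumber μ H j ^ 2 ≠ ∞) (hk : 0 < k) :
    (Measure.pi fun _ : Fin n => μ.withDensity (density μ b k))
      {x | ¬ ∀ i, density μ b k (x i) ≠ 0 ∧ density μ b k (x i) ≠ ∞} = 0 := by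
  have := hb.isProbabilityMeasure hsum hk
  have hd := aemeasurable_density h b k
  have htop : ∀ᵐ y ∂μ, density μ b k y < ∞ :=
    ae_lt_top' hd (by rw [hb.lintegral_density hsum hk]; simp)
  have hae : ∀ᵐ y ∂(μ.withDensity (density μ b k)),
      density μ b k y ≠ 0 ∧ density μ b k y ≠ ∞ := by
    rw [ae_withDensity_iff' hd]
    filter_upwards [htop] with y hy h0 using ⟨h0, hy.ne⟩
  rw [← ae_iff, ae_all_iff]
  exact fun i => (Measure.quasiMeasurePreserving_eval
    (fun _ : Fin n => μ.withDensity (density μ b k)) i).ae hae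

/-- With high probability, weighted least squares is well defined and has a small error. -/
theorem exists_measurableSet_nodes (hb : IsEigenbasis h b) [Nontrivial H]
    (hsum : ∑' j : ℕ, approxNumber μ H j ^ 2 ≠ ∞) {l : ℕ} (hl : 0 < l) (hkl : k = 2 * l) {y : ℝ}
    (hy : 1 ≤ y) (hn : 128 * k * y ≤ n) :
    ∃ E : Set (Fin n → D), MeasurableSet E ∧
      1 - 3 * k * Real.exp (-y) ≤
        (Measure.pi fun _ : Fin n => μ.withDensity (density μ b k)).real E ∧
      ∀ x ∈ E, (∀ f : H, ∃! g : H, IsWeightedLeastSquares μ b k x f g) ∧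
        worstCaseError μ (fun f : H => ⇑(leastSquares μ b k x f)) ^ 2 ≤
          4 / (k : ℝ≥0∞) * tailSum μ H l := by
  have hk : 0 < k := by omega
  have := hb.isProbabilityMeasure hsum hk
  obtain ⟨m, -, hmk, -, hne, -, hspan⟩ := hb.exists_dim hk
  set P := Measure.pi fun _ : Fin n => μ.withDensity (density μ b k) with hP
  set S : Set (Fin n → D) := {x | ∃ v : Fin m → 𝕜, star v ⬝ᵥ v = 1 ∧
    ∑ i, ‖∑ a, star (v a) * feature μ b k m (x i) a‖ ^ 2 ≤ 2 / 3 * (n : ℝ)} with hS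
  set Z : Set (Fin n → D) :=
    {x | ¬ ∀ i, density μ b k (x i) ≠ 0 ∧ density μ b k (x i) ≠ ∞} with hZ
  set B := (⋃ N, largeNodes (𝕜 := 𝕜) μ b k n N) ∪ S ∪ Z with hB
  have hk0 : (0 : ℝ) < k := by exact_mod_cast hk
  have hPB : P B ≤ ENNReal.ofReal (3 * k * Real.exp (-y)) := by
    have he : 3 * k * Real.exp (-y) = 2 * k * Real.exp (-y) + k * Real.exp (-y) := by ring
    rw [he, ENNReal.ofReal_add (by positivity) (by positivity)]
    refine (measure_union_le _ _).trans ?_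
    rw [hb.measure_degenerate_eq_zero hsum hk, add_zero]
    exact (measure_union_le _ _).trans (add_le_add
      (hb.measure_iUnion_largeNodes_le hsum hk hy hn) (hb.measure_small_le hsum hk hy hn hmk hne))
  -- The bad set involves uncountable unions over v and features that are only almost everywhere
  -- measurable; its measurable hull has the same measure.
  refine ⟨(toMeasurable P B)ᶜ, (measurableSet_toMeasurable P B).compl, ?_, fun x hx => ?_⟩
  · rw [probReal_compl_eq_one_sub (measurableSet_toMeasurable P B), Measure.real,
      measure_toMeasurable]
    exact sub_le_sub_left (ENNReal.toReal_le_of_le_ofReal (by positivity) hPB) 1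
  · have hxB : x ∉ B := fun hxB => hx (subset_toMeasurable P B hxB)
    simp only [hB, Set.mem_union, not_or, Set.mem_iUnion, not_exists] at hxB
    obtain ⟨⟨hx1, hx2⟩, hx3⟩ := hxB
    rw [hZ, Set.mem_ofPred_eq, not_not] at hx3
    have hn0 : (0 : ℝ) < n := lt_of_lt_of_le (by positivity) hn
    have hM : 0 < 2 / 3 * (n : ℝ) := by positivity
    have hlow : ∀ g ∈ spanFirst 𝕜 b k, 2 / 3 * (n : ℝ) * ‖embedding h g‖ ^ 2 ≤
        ‖samplingMap (𝕜 := 𝕜) μ b k x g‖ ^ 2 := fun g hg =>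
      hb.le_norm_sq_samplingMap hmk hne hspan
        (fun v hv => le_of_not_ge fun hle => hx2 ⟨v, hv, hle⟩) hg
    have hup : ∀ f : H, ‖samplingMap (𝕜 := 𝕜) μ b k x f‖ ^ 2 ≤ 2 * (2 / 3 * (n : ℝ)) *
        (‖embedding h ((spanFirst 𝕜 b k).starProjection f)‖ ^ 2 +
          tailScale μ b k * ‖f - (spanFirst 𝕜 b k).starProjection f‖ ^ 2) :=
      hb.norm_sq_samplingMap_le fun N v hv => le_of_not_ge fun hle =>
        hx1 N ⟨v, hv, by linarith⟩
    exact ⟨existsUnique_isWeightedLeastSquares (fun i => (hx3 i).1) (fun i => (hx3 i).2) hM hlow,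
      hb.worstCaseError_leastSquares_le hsum hl hkl (fun i => (hx3 i).1) (fun i => (hx3 i).2) hM
        hlow hup⟩

end IsEigenbasis

/-- The tail bounds require 64 r y ≤ n with r = 2k and y = (2 + c) ln n; the factor 2⁸ in k_n is
made for this. -/
theorem kn_mul_log_le {n : ℕ} (hn : 2 ≤ n) {c : ℝ} (hc : 0 < c) :
    128 * (kn n c : ℝ) * ((2 + c) * Real.log n) ≤ n := by
  have hlog : 0 < Real.log n := Real.log_pos (by exact_mod_cast hn)
  have hy : 0 < (2 + c) * Real.log n := by positivity
  have h1 := Nat.floor_le (show 0 ≤ (n : ℝ) / (2 ^ 8 * (2 + c) * Real.log n) by positivity)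
  rw [le_div_iff₀ (by positivity)] at h1
  rw [kn]
  push_cast
  linarith

theorem one_le_mul_log {n : ℕ} (hn : 2 ≤ n) {c : ℝ} (hc : 0 < c) :
    1 ≤ (2 + c) * Real.log n := by
  have h1 : Real.log 2 ≤ Real.log n := Real.log_le_log two_pos (by exact_mod_cast hn)
  have h2 := Real.log_two_gt_d9
  nlinarith

/-- The three failure terms k e^{-y} are each at most n·n^{-2-c}, which leaves room to spare. -/
theorem kn_mul_exp_le {n : ℕ} (hn : 2 ≤ n) {c : ℝ} (hc : 0 < c) :
    3 * (kn n c : ℝ) * Real.exp (-((2 + c) * Real.log n)) ≤ 8 / (n : ℝ) ^ c := by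
  have hn0 : (0 : ℝ) < n := by exact_mod_cast (by omega)
  have hn1 : (1 : ℝ) ≤ n := by exact_mod_cast (by omega)
  have hkn : (kn n c : ℝ) ≤ n := by
    have h1 := kn_mul_log_le hn hc
    have h2 := one_le_mul_log hn hc
    have h3 : (0 : ℝ) ≤ kn n c := Nat.cast_nonneg _
    nlinarith
  have he : Real.exp (-((2 + c) * Real.log n)) = ((n : ℝ) ^ 2 * (n : ℝ) ^ c)⁻¹ := by
    rw [Real.exp_neg, mul_comm, ← Real.rpow_def_of_pos hn0, Real.rpow_add hn0, Real.rpow_two]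
  have hc0 : 0 < (n : ℝ) ^ c := Real.rpow_pos_of_pos hn0 c
  rw [he, ← div_eq_mul_inv, div_le_div_iff₀ (by positivity) hc0]
  nlinarith [mul_pos (pow_pos hn0 2) hc0, mul_le_mul_of_nonneg_right hkn hc0.le,
    mul_le_mul_of_nonneg_right hn1 (mul_pos hn0 hc0).le]

end GoodNodes

end RKHSSampling

theorem theorem2 {𝕜 D H : Type*} [RCLike 𝕜] [MeasurableSpace D] (μ : Measure D)
    [NormedAddCommGroup H] [InnerProductSpace 𝕜 H] [CompleteSpace H] [Nontrivial H]
    [RKHS 𝕜 H D 𝕜] (h : EmbedsInL2 μ H)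
    (hsum : ∑' j : ℕ, approxNumber μ H j ^ 2 ≠ ∞)
    (n : ℕ) (hn : 2 ≤ n) (c : ℝ) (hc : 0 < c) (hk : 0 < kn n c) :
    (∃ b : ℕ → H, IsEigenbasis h b) ∧
    ∀ b : ℕ → H, IsEigenbasis h b →
      IsProbabilityMeasure (μ.withDensity (density μ b (kn n c))) ∧
      ∃ E : Set (Fin n → D), MeasurableSet E ∧
        1 - 8 / (n : ℝ) ^ c ≤
          (Measure.pi fun _ : Fin n => μ.withDensity (density μ b (kn n c))).real E ∧
        ∀ x ∈ E,
          (∀ f : H, ∃! g : H, IsWeightedLeastSquares μ b (kn n c) x f g) ∧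
          worstCaseError μ (fun f : H => ⇑(leastSquares μ b (kn n c) x f)) ^ 2 ≤
            4 / (kn n c : ℝ≥0∞) * tailSum μ H (kn n c / 2) := by
  refine ⟨exists_isEigenbasis h hsum, fun b hb => ⟨hb.isProbabilityMeasure hsum hk, ?_⟩⟩
  have hkl : kn n c = 2 * (kn n c / 2) := by
    rw [kn, Nat.mul_div_cancel_left _ two_pos]
  obtain ⟨E, hE, hPE, hx⟩ := hb.exists_measurableSet_nodes hsum (l := kn n c / 2) (by omega) hkl
    (one_le_mul_log hn hc) (kn_mul_log_le hn hc)
  exact ⟨E, hE, (sub_le_sub_left (kn_mul_exp_le hn hc) 1).trans hPE, hx⟩
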